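/- Let $n\ge 2$ and let $\mathbb G=\mathbb R^n\times\bigwedge^2(\mathbb R^n)$ be the free-Carnot group of step $2$ and rank $n$, where $\bigwedge^2(\mathbb R^n)$ is the space of skew-symmetric contravariant $2$-tensors, $v\wedge w=v\otimes w-w\otimes v$, and the group law is $$(x_1,Y_1)*(x_2,Y_2)=\bigl(x_1+x_2,\;Y_1+Y_2+\tfrac12\,x_1\wedge x_2\bigr),$$ with identity element $0_{\mathbb G}=(0,0)$ and left translations $L_g(h)=g*h$. Let $d=\dim\mathbb G$ be its topological dimension. Let $\Delta_g=\mathrm dL_g(\mathbb R^n\times\{0\})\subseteq T_g\mathbb G$ be the left-invariant horizontal distribution, let $\|\cdot\|$ be any norm on $\mathbb R^n$, and let $\|\cdot\|_{\mathrm{sf}}$ be its left-invariant extension to $\Delta$, that is, $\|\mathrm dL_g(v,0)\|_{\mathrm{sf}}=\|v\|$. A curve $\gamma\colon[0,1]\to\mathbb G$ is horizontal if it is absolutely continuous and $\dot\gamma(t)\in\Delta_{\gamma(t)}$ for almost every $t$; its length is $\ell(\gamma)=\int_0^1\|\dot\gamma(t)\|_{\mathrm{sf}}\,\mathrm dt$.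 The Carnot–Carathéodory distance is $$d_{\mathrm{cc}}(g,h)=\inf\{\ell(\gamma):\gamma\text{ horizontal},\ g,h\in\gamma([0,1])\}.$$ Then the unit sphere $\mathbb S_{\mathrm{cc}}=\{g\in\mathbb G: d_{\mathrm{cc}}(g,0_{\mathbb G})=1\}$ is Euclidean $(d-1)$-rectifiable. This means that, for every smooth Riemannian metric on $\mathbb G$, with $\mathcal H^{d-1}$ denoting the $(d-1)$-dimensional Hausdorff measure of the induced Riemannian distance, one has $\mathcal H^{d-1}(\mathbb S_{\mathrm{cc}})<\infty$, and there are countably many measurable sets $E_i\subseteq\mathbb R^{d-1}$ and maps $f_i\colon E_i\to\mathbb G$, each Lipschitz from the Euclidean distance to the Riemannian distance, such that $$\mathcal H^{d-1}\Bigl(\mathbb S_{\mathrm{cc}}\setminus\bigcup_{i}f_i(E_i)\Bigr)=0.$$ -/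

import Mathlib

open MeasureTheory Set Bundle
open scoped Manifold ContDiff NNReal

noncomputable section

namespace FreeCarnotStepTwo

/-! ### The free-Carnot group of step 2 and rank `n` -/

/-- `⋀²(ℝⁿ)`: the skew-symmetric contravariant tensors of rank `2` on `ℝⁿ`, a tensor being given by
its array of coordinates in the standard basis. -/
def Bivector (n : ℕ) : Submodule ℝ (Fin n → Fin n → ℝ) where
  carrier := {A | ∀ i j, A i j = -A j i}
  add_mem' := by
    intro A B hA hB i j
    simp only [Pi.add_apply, hA i j, hB i j, neg_add]
  zero_mem' := by
    intro i j
    simp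
  smul_mem' := by
    intro c A hA i j
    simp only [Pi.smul_apply, hA i j, smul_neg]

/-- `v ∧ w = v ⊗ w - w ⊗ v`. -/
def wedge {n : ℕ} (v w : Fin n → ℝ) : Bivector n :=
  ⟨fun i j => v i * w j - w i * v j, fun i j => by ring⟩

/-- The underlying vector space `ℝⁿ × ⋀²(ℝⁿ)` of the free-Carnot group of step `2` and rank `n`,
with its standard structure of smooth manifold (the one of a finite-dimensional vector space).
The norm that Lean finds on it plays no role beyond its topology. -/
abbrev G (n : ℕ) : Type := (Fin n → ℝ) × Bivector n

/-- The group law `(x₁, Y₁) * (x₂, Y₂) = (x₁ + x₂, Y₁ + Y₂ + ½ (x₁ ∧ x₂))`, with identity element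
`(0, 0)` and inverse `(-x, -Y)`. -/
instance instGroup (n : ℕ) : Group (G n) where
  mul g h := (g.1 + h.1, g.2 + h.2 + (1 / 2 : ℝ) • wedge g.1 h.1)
  one := (0, 0)
  inv g := (-g.1, -g.2)
  mul_assoc a b c := by
    refine Prod.ext (add_assoc _ _ _) (Subtype.ext ?_)
    funext i j
    change a.2.1 i j + b.2.1 i j + (1 / 2 : ℝ) * (a.1 i * b.1 j - b.1 i * a.1 j) + c.2.1 i j +
        (1 / 2 : ℝ) * ((a.1 i + b.1 i) * c.1 j - c.1 i * (a.1 j + b.1 j)) =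
      a.2.1 i j + (b.2.1 i j + c.2.1 i j + (1 / 2 : ℝ) * (b.1 i * c.1 j - c.1 i * b.1 j)) +
        (1 / 2 : ℝ) * (a.1 i * (b.1 j + c.1 j) - (b.1 i + c.1 i) * a.1 j)
    ring
  one_mul a := by
    refine Prod.ext (zero_add _) (Subtype.ext ?_)
    funext i j
    change 0 + a.2.1 i j + (1 / 2 : ℝ) * (0 * a.1 j - a.1 i * 0) = a.2.1 i j
    ring
  mul_one a := by
    refine Prod.ext (add_zero _) (Subtype.ext ?_)
    funext i j
    change a.2.1 i j + 0 + (1 / 2 : ℝ) * (a.1 i * 0 - 0 * a.1 j) = a.2.1 i j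
    ring
  inv_mul_cancel a := by
    refine Prod.ext (neg_add_cancel _) (Subtype.ext ?_)
    funext i j
    change -a.2.1 i j + a.2.1 i j + (1 / 2 : ℝ) * (-a.1 i * a.1 j - a.1 i * -a.1 j) = 0
    ring

/-- The differential of the left translation `h ↦ g * h`. Left translations are affine, so their
differential at any point is the same linear map `(v, ω) ↦ (v, ω + ½ (g.1 ∧ v))`. -/
def dL {n : ℕ} (g w : G n) : G n := (w.1, w.2 + (1 / 2 : ℝ) • wedge g.1 w.1)

/-- `dL g w` is the derivative at `t = 0` of the left translate by `g` of any line `t ↦ h + t w`. -/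
theorem hasDerivAt_leftTranslation {n : ℕ} (g h w : G n) :
    HasDerivAt (fun t : ℝ => g * (h + t • w)) (dL g w) 0 := by
  have key : (fun t : ℝ => g * (h + t • w)) = fun t : ℝ => g * h + t • dL g w := by
    funext t
    refine Prod.ext ?_ (Subtype.ext ?_)
    · change g.1 + (h.1 + t • w.1) = g.1 + h.1 + t • w.1
      rw [add_assoc]
    · funext i j
      change g.2.1 i j + (h.2.1 i j + t * w.2.1 i j) +
          (1 / 2 : ℝ) * (g.1 i * (h.1 j + t * w.1 j) - (h.1 i + t * w.1 i) * g.1 j) =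
        g.2.1 i j + h.2.1 i j + (1 / 2 : ℝ) * (g.1 i * h.1 j - h.1 i * g.1 j) +
          t * (w.2.1 i j + (1 / 2 : ℝ) * (g.1 i * w.1 j - w.1 i * g.1 j))
      ring
  rw [key]
  simpa using ((hasDerivAt_id (0 : ℝ)).smul_const (dL g w)).const_add (g * h)

/-! ### The Carnot-Carathéodory distance -/

/-- The fibre at `g` of the horizontal distribution, `Δ_g = dL_g (𝔤₁)` with `𝔤₁ = ℝⁿ × {0}`. -/
def horizontalSpace {n : ℕ} (g : G n) : Set (G n) :=
  Set.range fun v : Fin n → ℝ => dL g (v, 0)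

/-- The left-invariant extension of a norm `N` on the first layer: a tangent vector `w` at `g` is
translated back to the identity element, and its component in the first layer is measured. It is
used for horizontal vectors `w = dL g (v, 0)` only, where its value is `N v`. -/
def sfNorm {n : ℕ} (N : Seminorm ℝ (Fin n → ℝ)) (g w : G n) : ℝ := N (dL g⁻¹ w).1

/-- `γ` (restricted to `[0, 1]`) is a horizontal curve: it is absolutely continuous and
`γ'(t) ∈ Δ_{γ(t)}` for almost every `t ∈ [0, 1]`. -/
def IsHorizontal {n : ℕ} (γ : ℝ → G n) : Prop :=
  AbsolutelyContinuousOnInterval γ 0 1 ∧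
    ∀ᵐ t ∂(volume.restrict (Icc (0 : ℝ) 1)),
      DifferentiableAt ℝ γ t ∧ deriv γ t ∈ horizontalSpace (γ t)

/-- The length `ℓ(γ) = ∫₀¹ ‖γ'(t)‖_sf dt`. -/
def length {n : ℕ} (N : Seminorm ℝ (Fin n → ℝ)) (γ : ℝ → G n) : ENNReal :=
  ∫⁻ t in Icc (0 : ℝ) 1, ENNReal.ofReal (sfNorm N (γ t) (deriv γ t))

/-- The Carnot-Carathéodory distance: the infimum of the lengths of the horizontal curves whose
image contains the two points. It takes values in `[0, ∞]`, so that nothing is presupposed about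
the existence of such curves. -/
def ccDist {n : ℕ} (N : Seminorm ℝ (Fin n → ℝ)) (g h : G n) : ENNReal :=
  ⨅ (γ : ℝ → G n) (_ : IsHorizontal γ) (_ : g ∈ γ '' Icc 0 1) (_ : h ∈ γ '' Icc 0 1), length N γ

/-- The unit sphere of the Carnot-Carathéodory distance, centred at the identity element. -/
def ccSphere {n : ℕ} (N : Seminorm ℝ (Fin n → ℝ)) : Set (G n) := {g | ccDist N g 1 = 1}

end FreeCarnotStepTwo

/-! ### Euclidean rectifiability -/

/-- A subset `S` of a smooth manifold `M` is Euclidean `k`-rectifiable with respect to the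
(smooth) Riemannian metric `ρ`: the `k`-dimensional Hausdorff measure of `S` is finite, and `S` is
covered, up to a set of measure zero, by the images of countably many Lipschitz maps defined on
measurable subsets of the Euclidean space `ℝᵏ`. Hausdorff measures and Lipschitz maps refer to the
distance induced by `ρ`, the infimum of the lengths of `C¹` paths. -/
def IsEuclideanRectifiable {E : Type*} [NormedAddCommGroup E] [NormedSpace ℝ E]
    {H : Type*} [TopologicalSpace H] (I : ModelWithCorners ℝ E H)
    {M : Type*} [TopologicalSpace M] [ChartedSpace H M] [IsManifold I ∞ M]
    [T3Space M]
    (ρ : ContMDiffRiemannianMetric I ∞ E (fun x : M => TangentSpace I x)) (k : ℕ) (S : Set M) :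
    Prop :=
  letI : RiemannianBundle (fun x : M => TangentSpace I x) := ⟨ρ.toRiemannianMetric⟩
  haveI : IsContinuousRiemannianBundle E (fun x : M => TangentSpace I x) :=
    ⟨ρ.inner, ρ.contMDiff.continuous, fun _ _ _ => rfl⟩
  letI : EMetricSpace M := EMetricSpace.ofRiemannianMetric I M
  letI : MeasurableSpace M := borel M
  haveI : BorelSpace M := ⟨rfl⟩
  Measure.hausdorffMeasure (k : ℝ) S < (⊤ : ENNReal) ∧
    ∃ (A : ℕ → Set (EuclideanSpace ℝ (Fin k))) (f : ℕ → EuclideanSpace ℝ (Fin k) → M),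
      (∀ i, MeasurableSet (A i)) ∧
      (∀ i, ∃ K : ℝ≥0, LipschitzOnWith K (f i) (A i)) ∧
      Measure.hausdorffMeasure (k : ℝ) (S \ ⋃ i, f i '' A i) = 0

end

/-! Let `F = ccNorm N` be the distance from the identity. It is homogeneous of degree one under the
dilations, so where `F` is locally Lipschitz its level set is a Lipschitz graph over a hyperplane
transverse to them. The proof quantifies how the Lipschitz property degenerates, and shows that it
does so only near a set too small to matter.

Follow a nearly shortest horizontal curve from the identity to `g`, with first layer `x`. Inserting
a step `v` at time `s` and undoing it at the end costs `2 N(v)` and moves the endpoint vertically by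
`v ∧ (x(1) - x(s))` (`ccDist_insertion`). If sums of such moves miss a small bivector, Hahn-Banach
yields a nonzero skew form nearly annihilating all the vectors `x(1) - x(s)`. By skewness two of its
rows are independent covectors (`exists_normals_of_notMem_closure`), so the curve almost lies in a
subspace of codimension two and `g` almost satisfies the equations of the subgroup which that
subspace generates. The defect in these equations, minimized over the subspaces, is `abnDist g`, and
the argument gives `abnDist g * |F g - F h| ≤ C ‖g - h‖` on bounded sets (`exists_abnDist_mul_le`).

The subspaces depend on `2(n-2)` parameters, while a subgroup is cut out by at least `2(n-2) + 2`
equations. Hence `{abnDist ≤ ε}` has volume `O(ε²)` on bounded sets (`exists_measure_abnDist_le`)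
and `1 / abnDist` is locally integrable. The `s`-neighbourhood of the sphere lies in the shell
`abnDist * |F - 1| ≤ C s`; averaging over dilations and integrating `1 / abnDist` bounds its volume
by `O(s)` (`exists_measure_shell_le`). A Minkowski bound controls the Hausdorff measure
(`hausdorffMeasure_le_of_measure_thickening_le`), so the sphere has finite measure. The part where
`abnDist = 0` has neighbourhoods of volume `O(s²)` and is null.

At the other points the sphere is a Lipschitz graph along the generator of the dilations
(`exists_lipschitz_parametrization`), and countably many such pieces suffice. Finally, on a compact
convex set any Riemannian distance is bounded by a multiple of the norm distance, and both
conclusions pass to Lipschitz images. -/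

noncomputable section

/-! ### Absolutely continuous functions -/

theorem uIoc_image_disjoint_of_monotone {φ : ℝ → ℝ} (hφ : Monotone φ) {a b c d : ℝ}
    (h : Disjoint (uIoc a b) (uIoc c d)) : Disjoint (uIoc (φ a) (φ b)) (uIoc (φ c) (φ d)) := by
  simp only [uIoc, Ioc_disjoint_Ioc, ← hφ.map_max, ← hφ.map_min] at h ⊢
  exact hφ h

theorem uIoc_image_disjoint_of_antitone {φ : ℝ → ℝ} (hφ : Antitone φ) {a b c d : ℝ}
    (h : Disjoint (uIoc a b) (uIoc c d)) : Disjoint (uIoc (φ a) (φ b)) (uIoc (φ c) (φ d)) := by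
  simp only [uIoc, Ioc_disjoint_Ioc, ← hφ.map_max, ← hφ.map_min] at h ⊢
  apply hφ
  rcases le_total a b with h1 | h1 <;> rcases le_total c d with h2 | h2 <;>
  simp_all

/-- Monotonicity keeps disjoint intervals disjoint and the Lipschitz bound keeps their total length
small. The antitone case serves to run curves backwards. -/
theorem AbsolutelyContinuousOnInterval.comp_lipschitz {X : Type*} [PseudoMetricSpace X]
    {f : ℝ → X} {φ : ℝ → ℝ} {K : ℝ≥0} {a b c d : ℝ}
    (hf : AbsolutelyContinuousOnInterval f c d) (hφ : LipschitzWith K φ)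
    (hmono : Monotone φ ∨ Antitone φ) (hmaps : MapsTo φ (uIcc a b) (uIcc c d)) :
    AbsolutelyContinuousOnInterval (f ∘ φ) a b := by
  rw [absolutelyContinuousOnInterval_iff] at hf ⊢
  intro ε hε
  obtain ⟨δ, hδ, H⟩ := hf ε hε
  -- Dividing by `K + 1` rather than `K` covers `K = 0`.
  refine ⟨δ / (K + 1), by positivity, fun E hE hlen => ?_⟩
  refine H (E.1, fun i => (φ (E.2 i).1, φ (E.2 i).2)) ⟨fun i hi => ?_, ?_⟩ ?_
  · exact ⟨hmaps (hE.1 i hi).1, hmaps (hE.1 i hi).2⟩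
  · intro i hi j hj hij
    have := hE.2 hi hj hij
    rcases hmono with h | h
    · exact uIoc_image_disjoint_of_monotone h this
    · exact uIoc_image_disjoint_of_antitone h this
  · calc ∑ i ∈ Finset.range E.1, dist (φ (E.2 i).1) (φ (E.2 i).2)
        ≤ ∑ i ∈ Finset.range E.1, (K + 1) * dist (E.2 i).1 (E.2 i).2 := by
          refine Finset.sum_le_sum fun i _ => (hφ.dist_le_mul _ _).trans ?_
          gcongr
          linarith
      _ = (K + 1) * ∑ i ∈ Finset.range E.1, dist (E.2 i).1 (E.2 i).2 := by rw [Finset.mul_sum]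
      _ < (K + 1) * (δ / (K + 1)) := by gcongr
      _ = δ := by field_simp

theorem LipschitzWith.comp_absolutelyContinuousOnInterval {X Y : Type*} [PseudoMetricSpace X]
    [PseudoMetricSpace Y] {f : ℝ → X} {g : X → Y} {K : ℝ≥0} {a b : ℝ}
    (hg : LipschitzWith K g) (hf : AbsolutelyContinuousOnInterval f a b) :
    AbsolutelyContinuousOnInterval (g ∘ f) a b := by
  rw [absolutelyContinuousOnInterval_iff] at hf ⊢
  intro ε hε
  obtain ⟨δ, hδ, H⟩ := hf (ε / (K + 1)) (by positivity)
  refine ⟨δ, hδ, fun E hE hlen => ?_⟩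
  calc ∑ i ∈ Finset.range E.1, dist (g (f (E.2 i).1)) (g (f (E.2 i).2))
      ≤ ∑ i ∈ Finset.range E.1, (K + 1) * dist (f (E.2 i).1) (f (E.2 i).2) := by
        refine Finset.sum_le_sum fun i _ => (hg.dist_le_mul _ _).trans ?_
        gcongr
        linarith
    _ = (K + 1) * ∑ i ∈ Finset.range E.1, dist (f (E.2 i).1) (f (E.2 i).2) := by
        rw [Finset.mul_sum]
    _ < (K + 1) * (ε / (K + 1)) := by
        gcongr
        exact H E hE hlen
    _ = ε := by field_simp

theorem ae_restrict_comp_affine {P : ℝ → Prop} {p q a b : ℝ} (hpq : p ≠ q)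
    (h : ∀ᵐ t ∂(volume.restrict (Icc a b)), P t) (hp : p ∈ Icc a b) (hq : q ∈ Icc a b) :
    ∀ᵐ t ∂(volume.restrict (Icc (0 : ℝ) 1)), P (p + (q - p) * t) := by
  have hc : q - p ≠ 0 := sub_ne_zero.2 hpq.symm
  rw [ae_restrict_iff' measurableSet_Icc] at h ⊢
  have h1 : ∀ᵐ t : ℝ, (q - p) * t + p ∈ Icc a b → P ((q - p) * t + p) := by
    have hm : Measure.QuasiMeasurePreserving (fun t : ℝ => (q - p) * t + p) volume volume := by
      refine ⟨by fun_prop, ?_⟩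
      have : (fun t : ℝ => (q - p) * t + p) = (fun t => t + p) ∘ fun t => (q - p) * t := rfl
      rw [this, ← Measure.map_map (by fun_prop) (by fun_prop),
        Real.map_volume_mul_left hc, Measure.map_smul,
        (measurePreserving_add_right volume p).map_eq]
      exact Measure.smul_absolutelyContinuous
    exact hm.ae h
  filter_upwards [h1] with t ht ht01
  rw [add_comm]
  refine ht ?_
  have : Convex ℝ (Icc a b) := convex_Icc a b
  have := this hp hq (a := 1 - t) (b := t) (by linarith [ht01.2]) ht01.1 (by ring)
  simp only [smul_eq_mul] at this
  convert this using 1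
  ring

namespace FreeCarnotStepTwo

variable {n : ℕ}

/-! ### Algebra of the group -/

@[simp] theorem mul_fst (g h : G n) : (g * h).1 = g.1 + h.1 := rfl

theorem mul_snd (g h : G n) : (g * h).2 = g.2 + h.2 + (1 / 2 : ℝ) • wedge g.1 h.1 := rfl

@[simp] theorem one_fst : (1 : G n).1 = 0 := rfl

@[simp] theorem one_snd : (1 : G n).2 = 0 := rfl

@[simp] theorem inv_fst (g : G n) : g⁻¹.1 = -g.1 := rfl

@[simp] theorem inv_snd (g : G n) : g⁻¹.2 = -g.2 := rfl

@[simp] theorem dL_fst (g w : G n) : (dL g w).1 = w.1 := rfl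

theorem dL_snd (g w : G n) : (dL g w).2 = w.2 + (1 / 2 : ℝ) • wedge g.1 w.1 := rfl

theorem wedge_apply (v w : Fin n → ℝ) (i j : Fin n) :
    (wedge v w).1 i j = v i * w j - w i * v j := rfl

theorem wedge_add_left (u v w : Fin n → ℝ) : wedge (u + v) w = wedge u w + wedge v w := by
  ext i j
  simp [wedge_apply]
  ring

theorem wedge_add_right (u v w : Fin n → ℝ) : wedge u (v + w) = wedge u v + wedge u w := by
  ext i j
  simp [wedge_apply]
  ring

theorem wedge_smul_left (c : ℝ) (v w : Fin n → ℝ) : wedge (c • v) w = c • wedge v w := by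
  ext i j
  simp [wedge_apply]
  ring

theorem wedge_smul_right (c : ℝ) (v w : Fin n → ℝ) : wedge v (c • w) = c • wedge v w := by
  ext i j
  simp [wedge_apply]
  ring

theorem wedge_comm (v w : Fin n → ℝ) : wedge v w = -wedge w v := by
  ext i j
  simp [wedge_apply]

@[simp] theorem wedge_self (v : Fin n → ℝ) : wedge v v = 0 := by
  ext i j
  simp [wedge_apply]

/-- The wedge product as a bilinear map. -/
def wedgeL (n : ℕ) : (Fin n → ℝ) →ₗ[ℝ] (Fin n → ℝ) →ₗ[ℝ] Bivector n :=
  LinearMap.mk₂ ℝ wedge wedge_add_left wedge_smul_left wedge_add_right wedge_smul_right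

theorem wedgeL_apply (v w : Fin n → ℝ) : wedgeL n v w = wedge v w := rfl

@[simp] theorem wedge_zero_left (w : Fin n → ℝ) : wedge 0 w = 0 := by
  simp [← wedgeL_apply]

@[simp] theorem wedge_zero_right (w : Fin n → ℝ) : wedge w 0 = 0 := by
  simp [← wedgeL_apply]

theorem wedge_neg_left (v w : Fin n → ℝ) : wedge (-v) w = -wedge v w := by
  simp [← wedgeL_apply]

theorem norm_apply_le (Y : Bivector n) (i j : Fin n) : |Y.1 i j| ≤ ‖Y‖ :=
  (norm_le_pi_norm (Y.1 i) j).trans (norm_le_pi_norm Y.1 i)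

theorem norm_wedge_le (v w : Fin n → ℝ) : ‖wedge v w‖ ≤ 2 * ‖v‖ * ‖w‖ := by
  refine (pi_norm_le_iff_of_nonneg (by positivity)).2 fun i =>
    (pi_norm_le_iff_of_nonneg (by positivity)).2 fun j => ?_
  change ‖v i * w j - w i * v j‖ ≤ _
  calc ‖v i * w j - w i * v j‖ ≤ ‖v i‖ * ‖w j‖ + ‖w i‖ * ‖v j‖ := by
        rw [← norm_mul, ← norm_mul]
        exact norm_sub_le _ _
    _ ≤ ‖v‖ * ‖w‖ + ‖w‖ * ‖v‖ := by
        gcongr <;> exact norm_le_pi_norm _ _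
    _ = 2 * ‖v‖ * ‖w‖ := by ring

theorem dL_mul (g h w : G n) : dL (g * h) w = dL g (dL h w) := by
  refine Prod.ext rfl ?_
  simp only [dL_snd, dL_fst, mul_fst, wedge_add_left, smul_add]
  abel

theorem dL_smul (g w : G n) (c : ℝ) : dL g (c • w) = c • dL g w := by
  refine Prod.ext rfl ?_
  simp [dL_snd, wedge_smul_right, smul_comm c]

theorem mem_horizontalSpace {g w : G n} :
    w ∈ horizontalSpace g ↔ w.2 = (1 / 2 : ℝ) • wedge g.1 w.1 := by
  constructor
  · rintro ⟨v, rfl⟩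
    simp [dL_snd]
  · intro h
    exact ⟨w.1, Prod.ext rfl (by simp [dL_snd, h])⟩

theorem smul_mem_horizontalSpace {g w : G n} (c : ℝ) (hw : w ∈ horizontalSpace g) :
    c • w ∈ horizontalSpace g := by
  rw [mem_horizontalSpace] at hw ⊢
  simp [hw, wedge_smul_right, smul_comm c]

theorem dL_mem_horizontalSpace {g w : G n} (k : G n) (hw : w ∈ horizontalSpace g) :
    dL k w ∈ horizontalSpace (k * g) := by
  obtain ⟨v, rfl⟩ := hw
  exact ⟨v, dL_mul k g (v, 0)⟩

/-- The differential of a left translation as a continuous linear map. -/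
def dLL (k : G n) : G n →L[ℝ] G n :=
  LinearMap.toContinuousLinearMap
    { toFun := dL k
      map_add' := fun v w => by
        refine Prod.ext rfl ?_
        simp only [dL_snd, Prod.fst_add, Prod.snd_add, wedge_add_right, smul_add]
        abel
      map_smul' := fun c w => dL_smul k w c }

theorem dLL_apply (k w : G n) : dLL k w = dL k w := rfl

/-- Left translations are affine maps with linear part `dLL k`, hence smooth and Lipschitz for the
norm. -/
theorem mul_eq (k g : G n) : k * g = k + dLL k g := by
  refine Prod.ext rfl ?_
  rw [mul_snd, dLL_apply, Prod.snd_add, dL_snd]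
  abel

/-- The intrinsic dilations of the group. -/
def dil (c : ℝ) : G n →L[ℝ] G n :=
  (c • ContinuousLinearMap.fst ℝ (Fin n → ℝ) (Bivector n)).prod
    ((c ^ 2) • ContinuousLinearMap.snd ℝ (Fin n → ℝ) (Bivector n))

@[simp] theorem dil_fst (c : ℝ) (g : G n) : (dil c g).1 = c • g.1 := rfl

@[simp] theorem dil_snd (c : ℝ) (g : G n) : (dil c g).2 = c ^ 2 • g.2 := rfl

theorem dil_dil (a b : ℝ) (g : G n) : dil a (dil b g) = dil (a * b) g := by
  refine Prod.ext ?_ ?_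
  · simp [smul_smul]
  · simp [smul_smul, mul_pow]

@[simp] theorem dil_one_left (g : G n) : dil 1 g = g := Prod.ext (by simp) (by simp)

@[simp] theorem dil_one_right (c : ℝ) : dil c (1 : G n) = 1 := Prod.ext (by simp) (by simp)

/-! ### Horizontal curves on intervals -/

/-- Horizontality of a curve on the interval `[a, b]`. -/
def IsHorizontalOn (γ : ℝ → G n) (a b : ℝ) : Prop :=
  AbsolutelyContinuousOnInterval γ a b ∧
    ∀ᵐ t ∂(volume.restrict (Icc a b)),
      DifferentiableAt ℝ γ t ∧ deriv γ t ∈ horizontalSpace (γ t)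

/-- The length of the restriction of a curve to the interval `[a, b]`. -/
def lengthOn (N : Seminorm ℝ (Fin n → ℝ)) (γ : ℝ → G n) (a b : ℝ) : ENNReal :=
  ∫⁻ t in Icc a b, ENNReal.ofReal (N (deriv γ t).1)

/-- Translating a tangent vector back to the identity leaves its first layer unchanged, so the speed
is `N` of the first layer of the derivative. -/
theorem length_eq (N : Seminorm ℝ (Fin n → ℝ)) (γ : ℝ → G n) : length N γ = lengthOn N γ 0 1 := rfl

theorem IsHorizontalOn.mono {γ : ℝ → G n} {a b c d : ℝ} (h : IsHorizontalOn γ a b)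
    (hab : a ≤ b) (hcd : c ≤ d) (hac : a ≤ c) (hdb : d ≤ b) : IsHorizontalOn γ c d := by
  refine ⟨h.1.mono ?_, ae_restrict_of_ae_restrict_of_subset (Icc_subset_Icc hac hdb) h.2⟩
  rw [uIcc_of_le hab, uIcc_of_le hcd]
  exact Icc_subset_Icc hac hdb

theorem lengthOn_add (N : Seminorm ℝ (Fin n → ℝ)) (γ : ℝ → G n) {a b c : ℝ} (h : a ≤ b)
    (h' : b ≤ c) : lengthOn N γ a b + lengthOn N γ b c = lengthOn N γ a c := by
  symm
  have : Icc a c = Icc a b ∪ Ioc b c := (Icc_union_Ioc_eq_Icc h h').symm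
  rw [lengthOn, this, lintegral_union measurableSet_Ioc]; swap
  · exact disjoint_iff_forall_ne.mpr (fun a ha b hb ↦ (ha.2.trans_lt hb.1).ne)
  simp [restrict_Ioc_eq_restrict_Icc, lengthOn]

theorem lengthOn_mono (N : Seminorm ℝ (Fin n → ℝ)) (γ : ℝ → G n) {a b c d : ℝ}
    (hac : a ≤ c) (hdb : d ≤ b) : lengthOn N γ c d ≤ lengthOn N γ a b :=
  lintegral_mono_set (Icc_subset_Icc hac hdb)

/-- The case `q < p` reverses the curve. It is needed because `ccDist` only asks the curve to
contain both points, in any order and at any times. -/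
theorem isHorizontal_comp_affine {γ : ℝ → G n} {a b p q : ℝ} (h : IsHorizontalOn γ a b)
    (hp : p ∈ Icc a b) (hq : q ∈ Icc a b) (hpq : p ≠ q) :
    IsHorizontal fun t => γ (p + (q - p) * t) := by
  have hab : a ≤ b := hp.1.trans hp.2
  constructor
  · have hL : LipschitzWith ‖q - p‖₊ fun t : ℝ => p + (q - p) * t := by
      refine LipschitzWith.of_dist_le_mul fun x y => le_of_eq ?_
      rw [Real.dist_eq, Real.dist_eq, coe_nnnorm, Real.norm_eq_abs, ← abs_mul]
      congr 1
      ring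
    refine h.1.comp_lipschitz hL ?_ ?_
    · rcases le_total p q with h1 | h1
      · left
        intro x y hxy
        have := mul_le_mul_of_nonneg_left hxy (sub_nonneg.2 h1)
        simpa using this
      · right
        intro x y hxy
        have := mul_le_mul_of_nonpos_left hxy (sub_nonpos.2 h1)
        simpa using this
    · rw [uIcc_of_le zero_le_one, uIcc_of_le hab]
      intro t ht
      have := convex_Icc a b hp hq (a := 1 - t) (b := t) (by linarith [ht.2]) ht.1 (by ring)
      simp only [smul_eq_mul] at this
      convert! this using 1
      ring
  · filter_upwards [ae_restrict_comp_affine hpq h.2 hp hq] with t ht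
    have h1 : HasDerivAt (fun t : ℝ => p + (q - p) * t) (q - p) t := by
      simpa using ((hasDerivAt_id t).const_mul (q - p)).const_add p
    have h2 := HasDerivAt.scomp t ht.1.hasDerivAt h1
    refine ⟨h2.differentiableAt, ?_⟩
    have h3 : deriv (fun t => γ (p + (q - p) * t)) t = (q - p) • deriv γ (p + (q - p) * t) :=
      h2.deriv
    rw [h3]
    exact smul_mem_horizontalSpace _ ht.2

theorem length_comp_affine (N : Seminorm ℝ (Fin n → ℝ)) {γ : ℝ → G n} {p q : ℝ} (hpq : p ≠ q) :
    length N (fun t => γ (p + (q - p) * t)) = lengthOn N γ (min p q) (max p q) := by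
  have hd : ∀ t, deriv (fun t => γ (p + (q - p) * t)) t = (q - p) • deriv γ (p + (q - p) * t) := by
    intro t
    have h1 := deriv_comp_mul_left (q - p) (fun s => γ (p + s)) t
    rw [h1, deriv_comp_const_add]
  have himg : (fun t : ℝ => p + (q - p) * t) '' Icc 0 1 = Icc (min p q) (max p q) := by
    have h1 : (fun t : ℝ => p + (q - p) * t) = fun t => AffineMap.lineMap p q t := by
      funext t
      simp [AffineMap.lineMap_apply]
      ring
    rw [h1, ← segment_eq_image_lineMap, segment_eq_uIcc, uIcc]
  rw [length_eq, lengthOn, lengthOn, ← himg,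
    lintegral_image_eq_lintegral_abs_deriv_mul measurableSet_Icc (f' := fun _ => q - p)]
  · refine lintegral_congr fun t => ?_
    rw [hd, Prod.smul_fst, map_smul_eq_mul, ENNReal.ofReal_mul (norm_nonneg _), Real.norm_eq_abs]
  · intro t _
    simpa using (((hasDerivAt_id t).const_mul (q - p)).const_add p).hasDerivWithinAt
  · intro x _ y _ hxy
    have := sub_ne_zero.2 hpq.symm
    simpa [this] using hxy

theorem ccDist_comm (N : Seminorm ℝ (Fin n → ℝ)) (g h : G n) : ccDist N g h = ccDist N h g := by
  have key : ∀ g h : G n, ccDist N g h ≤ ccDist N h g := fun g h =>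
    le_iInf₂ fun γ hγ => le_iInf₂ fun h1 h2 => iInf₂_le_of_le γ hγ (iInf₂_le_of_le h2 h1 le_rfl)
  exact le_antisymm (key g h) (key h g)

theorem ccDist_le_length (N : Seminorm ℝ (Fin n → ℝ)) {γ : ℝ → G n} (hγ : IsHorizontal γ)
    {s t : ℝ} (hs : s ∈ Icc (0 : ℝ) 1) (ht : t ∈ Icc (0 : ℝ) 1) :
    ccDist N (γ s) (γ t) ≤ length N γ :=
  iInf₂_le_of_le γ hγ (iInf₂_le_of_le ⟨s, hs, rfl⟩ ⟨t, ht, rfl⟩ le_rfl)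

theorem isHorizontal_const (g : G n) : IsHorizontal fun _ => g := by
  refine ⟨(LipschitzWith.const g).lipschitzOnWith.absolutelyContinuousOnInterval, ?_⟩
  refine Filter.Eventually.of_forall fun t => ⟨differentiableAt_const _, ?_⟩
  simp [mem_horizontalSpace]

theorem length_const (N : Seminorm ℝ (Fin n → ℝ)) (g : G n) : length N (fun _ => g) = 0 := by
  simp [length_eq, lengthOn]

@[simp] theorem ccDist_self (N : Seminorm ℝ (Fin n → ℝ)) (g : G n) : ccDist N g g = 0 := by
  have := ccDist_le_length N (isHorizontal_const g) (left_mem_Icc.2 zero_le_one)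
    (left_mem_Icc.2 zero_le_one)
  simpa [length_const] using this

theorem ccDist_le_lengthOn (N : Seminorm ℝ (Fin n → ℝ)) {γ : ℝ → G n} {a b : ℝ} (hab : a ≤ b)
    (h : IsHorizontalOn γ a b) : ccDist N (γ a) (γ b) ≤ lengthOn N γ a b := by
  rcases hab.eq_or_lt with rfl | hlt
  · simp
  have h1 := ccDist_le_length N (isHorizontal_comp_affine h (left_mem_Icc.2 hab)
    (right_mem_Icc.2 hab) hlt.ne) (left_mem_Icc.2 zero_le_one) (right_mem_Icc.2 zero_le_one)
  rw [length_comp_affine N hlt.ne, min_eq_left hab, max_eq_right hab] at h1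
  simpa using h1

/-- A curve realizing the distance up to an error may be assumed to start and end at the points. -/
theorem exists_curve (N : Seminorm ℝ (Fin n → ℝ)) {g h : G n} {r : ENNReal}
    (hr : ccDist N g h < r) : ∃ γ, IsHorizontal γ ∧ γ 0 = g ∧ γ 1 = h ∧ length N γ < r := by
  simp only [ccDist, iInf_lt_iff] at hr
  obtain ⟨γ, hγ, ⟨s, hs, rfl⟩, ⟨t, ht, rfl⟩, hlt⟩ := hr
  by_cases hst : s = t
  · subst hst
    exact ⟨fun _ => γ s, isHorizontal_const _, rfl, rfl, by
      rw [length_const]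
      exact bot_le.trans_lt hlt⟩
  · refine ⟨_, isHorizontal_comp_affine hγ hs ht hst, by simp, by simp, ?_⟩
    rw [length_comp_affine N hst]
    exact (lengthOn_mono N γ (le_min hs.1 ht.1) (max_le hs.2 ht.2)).trans_lt hlt

theorem ccDist_triangle (N : Seminorm ℝ (Fin n → ℝ)) (g h k : G n) :
    ccDist N g k ≤ ccDist N g h + ccDist N h k := by
  refine ENNReal.le_of_forall_pos_le_add fun ε hε hfin => ?_
  have hfin' := ENNReal.add_lt_top.1 hfin
  have hε2 : (ε / 2 : ENNReal) ≠ 0 := by simpa using hε.ne'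
  obtain ⟨γ₁, H₁, hg, hh, hl₁⟩ := exists_curve N (ENNReal.lt_add_right hfin'.1.ne hε2)
  obtain ⟨γ₂, H₂, hh', hk, hl₂⟩ := exists_curve N (ENNReal.lt_add_right hfin'.2.ne hε2)
  -- The concatenation, written as a sum of two curves each frozen outside its own interval:
  -- absolute continuity then follows from that of the summands, without a gluing argument.
  set γ : ℝ → G n := fun t => γ₁ (min t 1) + (γ₂ (max (t - 1) 0) - h) with hγ
  have e₁ : EqOn γ γ₁ (Iic 1) := fun t ht => by
    simp [hγ, min_eq_left (show t ≤ 1 from ht), max_eq_right (sub_nonpos.2 (show t ≤ 1 from ht)),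
      hh']
  have e₂ : EqOn γ (fun t => γ₂ (t - 1)) (Ici 1) := fun t ht => by
    simp [hγ, min_eq_right (show 1 ≤ t from ht), max_eq_left (sub_nonneg.2 (show 1 ≤ t from ht)),
      hh]
  have v₁ : ∀ t ∈ Iio (1 : ℝ), γ =ᶠ[nhds t] γ₁ := fun t ht =>
    Filter.eventuallyEq_of_mem (Iio_mem_nhds ht) fun s hs => e₁ (le_of_lt (show s < 1 from hs))
  have v₂ : ∀ t ∈ Ioi (1 : ℝ), γ =ᶠ[nhds t] fun t => γ₂ (t - 1) := fun t ht =>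
    Filter.eventuallyEq_of_mem (Ioi_mem_nhds ht) fun s hs => e₂ (le_of_lt (show 1 < s from hs))
  have H₂' : IsHorizontalOn (fun t => γ₂ (t - 1)) 1 2 := by
    constructor
    · refine H₂.1.comp_lipschitz (φ := fun t => t - 1) (K := 1)
        (LipschitzWith.of_dist_le_mul fun x y => by simp) (Or.inl fun x y hxy => by simpa) ?_
      rw [uIcc_of_le one_le_two, uIcc_of_le zero_le_one]
      intro t ht
      constructor <;> linarith [ht.1, ht.2]
    · have h1 := H₂.2
      rw [ae_restrict_iff' measurableSet_Icc] at h1 ⊢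
      have h2 := (measurePreserving_sub_right volume (1 : ℝ)).quasiMeasurePreserving.ae h1
      filter_upwards [h2] with t ht htI
      have h3 := ht ⟨by linarith [htI.1], by linarith [htI.2]⟩
      rw [deriv_comp_sub_const]
      exact ⟨differentiableAt_comp_sub_const.2 h3.1, h3.2⟩
  have hl₂' : lengthOn N (fun t => γ₂ (t - 1)) 1 2 = length N γ₂ := by
    have := (measurePreserving_sub_right volume (1 : ℝ)).setLIntegral_comp_preimage_emb
      (Homeomorph.subRight (1 : ℝ)).measurableEmbedding
      (fun t => ENNReal.ofReal (N (deriv γ₂ t).1)) (Icc 0 1)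
    rw [length_eq, lengthOn, lengthOn, ← this]
    simp only [deriv_comp_sub_const, preimage_sub_const_Icc, zero_add, one_add_one_eq_two]
  have hmid : ∀ᵐ t : ℝ, t ≠ 1 := by
    simp [ae_iff, measure_singleton]
  have A₁ : IsHorizontalOn γ 0 2 := by
    constructor
    · refine AbsolutelyContinuousOnInterval.add (f := fun t => γ₁ (min t 1))
        (g := fun t => γ₂ (max (t - 1) 0) - h) ?_ (.sub (g := fun _ => h) ?_ ?_)
      · refine H₁.1.comp_lipschitz (φ := fun t => min t 1) (K := 1) ?_ (Or.inl ?_) ?_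
        · exact LipschitzWith.id.min_const 1
        · exact fun x y hxy => min_le_min_right 1 hxy
        · rw [uIcc_of_le zero_le_two, uIcc_of_le zero_le_one]
          exact fun t ht => ⟨le_min ht.1 zero_le_one, min_le_right _ _⟩
      · refine H₂.1.comp_lipschitz (φ := fun t => max (t - 1) 0) (K := 1) ?_ (Or.inl ?_) ?_
        · exact LipschitzWith.max_const (LipschitzWith.of_dist_le_mul fun x y => by simp) 0
        · exact fun x y hxy => max_le_max_right 0 (by simpa)
        · rw [uIcc_of_le zero_le_two, uIcc_of_le zero_le_one]
          exact fun t ht => ⟨le_max_right _ _, max_le (by linarith [ht.2]) zero_le_one⟩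
      · exact (LipschitzWith.const h).lipschitzOnWith.absolutelyContinuousOnInterval
    · have h1 := H₁.2
      have h2 := H₂'.2
      rw [ae_restrict_iff' measurableSet_Icc] at h1 h2 ⊢
      filter_upwards [h1, h2, hmid] with t ht1 ht2 hne ht
      rcases lt_or_gt_of_ne hne with hlt | hgt
      · have h3 := ht1 ⟨ht.1, hlt.le⟩
        rw [(v₁ t hlt).deriv_eq, (v₁ t hlt).eq_of_nhds]
        exact ⟨(v₁ t hlt).differentiableAt_iff.2 h3.1, h3.2⟩
      · have h3 := ht2 ⟨hgt.le, ht.2⟩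
        rw [(v₂ t hgt).deriv_eq, (v₂ t hgt).eq_of_nhds]
        exact ⟨(v₂ t hgt).differentiableAt_iff.2 h3.1, h3.2⟩
  have L₁ : lengthOn N γ 0 1 = length N γ₁ := by
    rw [length_eq, lengthOn, lengthOn, ← restrict_Ioo_eq_restrict_Icc]
    exact setLIntegral_congr_fun measurableSet_Ioo fun t ht => by rw [(v₁ t ht.2).deriv_eq]
  have L₂ : lengthOn N γ 1 2 = length N γ₂ := by
    rw [← hl₂', lengthOn, lengthOn, ← restrict_Ioo_eq_restrict_Icc]
    exact setLIntegral_congr_fun measurableSet_Ioo fun t ht => by rw [(v₂ t ht.1).deriv_eq]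
  have key := ccDist_le_lengthOn N zero_le_two A₁
  rw [← lengthOn_add N γ zero_le_one one_le_two, L₁, L₂, e₁ (show (0 : ℝ) ≤ 1 by simp),
    e₂ (show (1 : ℝ) ≤ 2 by simp), hg] at key
  simp only [show (2 : ℝ) - 1 = 1 by norm_num, hk] at key
  calc ccDist N g k ≤ length N γ₁ + length N γ₂ := key
    _ ≤ (ccDist N g h + ε / 2) + (ccDist N h k + ε / 2) := add_le_add hl₁.le hl₂.le
    _ = ccDist N g h + ccDist N h k + ε := by
        rw [add_add_add_comm, ENNReal.add_halves]

/-- Common source of left invariance and homogeneity: an affine map that preserves the distribution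
and scales `N` on the first layer by `c` scales lengths by `c`. Applying the bound to the inverse
map as well gives the equalities that follow. -/
theorem ccDist_map_le (N : Seminorm ℝ (Fin n → ℝ)) {Φ : G n → G n} {Φ' : G n →L[ℝ] G n} {c : ℝ}
    (hc : 0 < c) (hΦ : ∀ g h, Φ g - Φ h = Φ' (g - h))
    (hhor : ∀ g w, w ∈ horizontalSpace g → Φ' w ∈ horizontalSpace (Φ g))
    (hN : ∀ w, N (Φ' w).1 = c * N w.1) (g h : G n) :
    ccDist N (Φ g) (Φ h) ≤ ENNReal.ofReal c * ccDist N g h := by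
  have hder : ∀ g, HasFDerivAt Φ Φ' g := fun g => by
    have : Φ = fun x => Φ' x + (Φ 0 - Φ' 0) := by
      funext x
      have := hΦ x 0
      rw [sub_zero] at this
      rw [← this, map_zero]
      abel
    rw [this]
    exact Φ'.hasFDerivAt.add_const _
  have hLip : LipschitzWith ‖Φ'‖₊ Φ := LipschitzWith.of_dist_le_mul fun x y => by
    rw [dist_eq_norm, dist_eq_norm, hΦ]
    exact Φ'.le_opNorm _
  have hc0 : ENNReal.ofReal c ≠ 0 := by simpa using hc
  rw [mul_comm, ← ENNReal.div_le_iff hc0 ENNReal.ofReal_ne_top]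
  refine le_of_forall_gt_imp_ge_of_dense fun r hr => ?_
  obtain ⟨γ, hγ, rfl, rfl, hlt⟩ := exists_curve N hr
  have hd : ∀ t, DifferentiableAt ℝ γ t → HasDerivAt (Φ ∘ γ) (Φ' (deriv γ t)) t := fun t ht =>
    (hder (γ t)).comp_hasDerivAt t ht.hasDerivAt
  have H : IsHorizontal (Φ ∘ γ) := by
    refine ⟨hLip.comp_absolutelyContinuousOnInterval hγ.1, ?_⟩
    filter_upwards [hγ.2] with t ht
    refine ⟨(hd t ht.1).differentiableAt, ?_⟩
    rw [(hd t ht.1).deriv]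
    exact hhor _ _ ht.2
  have hlen : length N (Φ ∘ γ) = ENNReal.ofReal c * length N γ := by
    rw [length_eq, length_eq, lengthOn, lengthOn, ← lintegral_const_mul' _ _ ENNReal.ofReal_ne_top]
    refine lintegral_congr_ae ?_
    filter_upwards [hγ.2] with t ht
    rw [(hd t ht.1).deriv, hN, ENNReal.ofReal_mul hc.le]
  rw [ENNReal.div_le_iff hc0 ENNReal.ofReal_ne_top, mul_comm]
  calc ccDist N (Φ (γ 0)) (Φ (γ 1)) ≤ length N (Φ ∘ γ) :=
        ccDist_le_length N H (left_mem_Icc.2 zero_le_one) (right_mem_Icc.2 zero_le_one)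
    _ ≤ ENNReal.ofReal c * r := by
        rw [hlen]
        gcongr

theorem ccDist_mul_left (N : Seminorm ℝ (Fin n → ℝ)) (k g h : G n) :
    ccDist N (k * g) (k * h) = ccDist N g h := by
  have key : ∀ k g h : G n, ccDist N (k * g) (k * h) ≤ ccDist N g h := fun k g h => by
    have := ccDist_map_le N (Φ := fun x => k * x) (Φ' := dLL k) (c := 1) one_pos
      (fun x y => by simp [mul_eq]) (fun x w hw => dL_mem_horizontalSpace k hw)
      (fun w => by simp [dLL_apply]) g h
    simpa using this
  refine le_antisymm (key k g h) ?_
  simpa using key k⁻¹ (k * g) (k * h)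

theorem ccDist_dil (N : Seminorm ℝ (Fin n → ℝ)) {c : ℝ} (hc : 0 < c) (g h : G n) :
    ccDist N (dil c g) (dil c h) = ENNReal.ofReal c * ccDist N g h := by
  have key : ∀ c : ℝ, 0 < c → ∀ g h : G n,
      ccDist N (dil c g) (dil c h) ≤ ENNReal.ofReal c * ccDist N g h := fun c hc g h => by
    refine ccDist_map_le N (Φ := dil c) (Φ' := dil c) hc (fun x y => by simp) ?_ ?_ g h
    · intro x w hw
      rw [mem_horizontalSpace] at hw ⊢
      rw [dil_snd, hw, dil_fst, dil_fst, wedge_smul_left, wedge_smul_right, smul_comm, smul_smul c,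
        sq]
    · intro w
      rw [dil_fst, map_smul_eq_mul, Real.norm_eq_abs, abs_of_pos hc]
  refine le_antisymm (key c hc g h) ?_
  have h1 := key c⁻¹ (inv_pos.2 hc) (dil c g) (dil c h)
  rw [dil_dil, dil_dil, inv_mul_cancel₀ hc.ne', dil_one_left, dil_one_left] at h1
  calc ENNReal.ofReal c * ccDist N g h
      ≤ ENNReal.ofReal c * (ENNReal.ofReal c⁻¹ * ccDist N (dil c g) (dil c h)) := by gcongr
    _ = ccDist N (dil c g) (dil c h) := by
        rw [← mul_assoc, ← ENNReal.ofReal_mul hc.le, mul_inv_cancel₀ hc.ne', ENNReal.ofReal_one,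
          one_mul]

/-- The line `t ↦ (t v, 0)` is horizontal because `v ∧ v = 0`. -/
theorem ccDist_one_horizontal_le (N : Seminorm ℝ (Fin n → ℝ)) (v : Fin n → ℝ) :
    ccDist N 1 ((v, 0) : G n) ≤ ENNReal.ofReal (N v) := by
  have hd : ∀ t : ℝ, HasDerivAt (fun t : ℝ => t • ((v, 0) : G n)) ((v, 0) : G n) t := fun t => by
    simpa using (hasDerivAt_id t).smul_const ((v, 0) : G n)
  have H : IsHorizontal fun t : ℝ => t • ((v, 0) : G n) := by
    constructor
    · refine LipschitzOnWith.absolutelyContinuousOnInterval (K := ‖((v, 0) : G n)‖₊)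
        (LipschitzWith.lipschitzOnWith (LipschitzWith.of_dist_le_mul fun x y => ?_))
      rw [dist_eq_norm, ← sub_smul x y ((v, 0) : G n), norm_smul, mul_comm]
      rfl
    · refine Filter.Eventually.of_forall fun t => ⟨(hd t).differentiableAt, ?_⟩
      rw [(hd t).deriv, mem_horizontalSpace]
      simp [wedge_smul_left]
  have h1 := ccDist_le_length N H (left_mem_Icc.2 zero_le_one) (right_mem_Icc.2 zero_le_one)
  rw [zero_smul, one_smul, length_eq, lengthOn] at h1
  simp only [(hd _).deriv] at h1
  rw [show (1 : G n) = 0 from rfl]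
  simpa using h1

theorem ccDist_mul_horizontal_le (N : Seminorm ℝ (Fin n → ℝ)) (g : G n) (v : Fin n → ℝ) :
    ccDist N g (g * ((v, 0) : G n)) ≤ ENNReal.ofReal (N v) := by
  have := ccDist_mul_left N g 1 ((v, 0) : G n)
  rw [mul_one] at this
  rw [this]
  exact ccDist_one_horizontal_le N v

/-! ### Comparison of norms -/

theorem exists_seminorm_le (N : Seminorm ℝ (Fin n → ℝ)) : ∃ c > 0, ∀ v, N v ≤ c * ‖v‖ := by
  refine ⟨∑ i, N (Pi.single i 1) + 1, ?_, fun v => ?_⟩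
  · have : 0 ≤ ∑ i, N (Pi.single i 1 : Fin n → ℝ) := Finset.sum_nonneg fun i _ => apply_nonneg _ _
    linarith
  · have hv : v = ∑ i, v i • (Pi.single i 1 : Fin n → ℝ) := pi_eq_sum_univ' v
    calc N v = N (∑ i, v i • (Pi.single i 1 : Fin n → ℝ)) := by rw [← hv]
      _ ≤ ∑ i, N (v i • (Pi.single i 1 : Fin n → ℝ)) :=
        Finset.le_sum_of_subadditive N (map_zero N).le (map_add_le_add N) _ _
      _ ≤ ∑ i, N (Pi.single i 1 : Fin n → ℝ) * ‖v‖ := by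
          refine Finset.sum_le_sum fun i _ => ?_
          rw [map_smul_eq_mul, mul_comm]
          gcongr
          exact norm_le_pi_norm v i
      _ = (∑ i, N (Pi.single i 1 : Fin n → ℝ)) * ‖v‖ := by rw [Finset.sum_mul]
      _ ≤ _ := by
          gcongr
          linarith

theorem seminorm_continuous (N : Seminorm ℝ (Fin n → ℝ)) : Continuous N := by
  obtain ⟨c, hc, h⟩ := exists_seminorm_le N
  refine (LipschitzWith.of_dist_le_mul (K := ⟨c, hc.le⟩) fun x y => ?_).continuous
  rw [Real.dist_eq, dist_eq_norm]
  exact (abs_sub_map_le_sub N x y).trans (h _)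

theorem exists_norm_le {N : Seminorm ℝ (Fin n → ℝ)} (hN : ∀ v, N v = 0 → v = 0) :
    ∃ c > 0, ∀ v, ‖v‖ ≤ c * N v := by
  -- The unit sphere is empty when `n = 0`; otherwise `N` attains a positive minimum on it.
  rcases (Metric.sphere (0 : Fin n → ℝ) 1).eq_empty_or_nonempty with he | hne
  · refine ⟨1, one_pos, fun v => ?_⟩
    by_cases hv : v = 0
    · simp [hv]
    · have : ‖v‖⁻¹ • v ∈ Metric.sphere (0 : Fin n → ℝ) 1 := by
        simp [norm_smul, inv_mul_cancel₀ (norm_ne_zero_iff.2 hv)]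
      simp [he] at this
  · obtain ⟨x, hx, hmin⟩ := (isCompact_sphere (0 : Fin n → ℝ) 1).exists_isMinOn hne
      (seminorm_continuous N).continuousOn
    have hx1 : ‖x‖ = 1 := by simpa using hx
    have hpos : 0 < N x := lt_of_le_of_ne (apply_nonneg _ _) fun h => by
      rw [hN x h.symm] at hx1
      simp at hx1
    refine ⟨(N x)⁻¹, inv_pos.2 hpos, fun v => ?_⟩
    by_cases hv : v = 0
    · simp [hv]
    · have hv' : 0 < ‖v‖ := norm_pos_iff.2 hv
      have h1 : ‖v‖⁻¹ • v ∈ Metric.sphere (0 : Fin n → ℝ) 1 := by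
        simp [norm_smul, inv_mul_cancel₀ hv'.ne']
      have h2 : N x ≤ N (‖v‖⁻¹ • v) := hmin h1
      rw [map_smul_eq_mul, norm_inv, norm_norm, inv_mul_eq_div, le_div_iff₀ hv'] at h2
      rw [inv_mul_eq_div, le_div_iff₀ hpos, mul_comm]
      exact h2

/-! ### Estimates along horizontal curves -/

/-- The fundamental theorem of calculus for absolutely continuous functions: a derivative bounded by
the speed integrates to a bound by the length. -/
theorem abs_le_of_abs_deriv_le {N : Seminorm ℝ (Fin n → ℝ)} {γ : ℝ → G n} {h : ℝ → ℝ} {A M : ℝ}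
    (hA : 0 ≤ A) (hM : 0 ≤ M) (hlen : length N γ ≤ ENNReal.ofReal M)
    (hac : AbsolutelyContinuousOnInterval h 0 1) (h0 : h 0 = 0)
    (hd : ∀ᵐ t ∂(volume.restrict (Icc (0 : ℝ) 1)), |deriv h t| ≤ A * N (deriv γ t).1)
    {t : ℝ} (ht : t ∈ Icc (0 : ℝ) 1) : |h t| ≤ A * M := by
  have hac' : AbsolutelyContinuousOnInterval h 0 t := by
    refine hac.mono ?_
    rw [uIcc_of_le ht.1, uIcc_of_le zero_le_one]
    exact Icc_subset_Icc_right ht.2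
  have h1 := hac'.integral_deriv_eq_sub
  rw [h0, sub_zero, intervalIntegral.integral_of_le ht.1] at h1
  have h2 : ENNReal.ofReal |h t| ≤ ENNReal.ofReal (A * M) := by
    calc ENNReal.ofReal |h t| = ‖∫ s in Ioc 0 t, deriv h s‖ₑ := by
          rw [h1, ← Real.enorm_eq_ofReal_abs]
      _ ≤ ∫⁻ s in Ioc 0 t, ‖deriv h s‖ₑ := enorm_integral_le_lintegral_enorm _
      _ ≤ ∫⁻ s in Icc 0 1, ‖deriv h s‖ₑ := lintegral_mono_set
          (Ioc_subset_Icc_self.trans (Icc_subset_Icc_right ht.2))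
      _ ≤ ∫⁻ s in Icc 0 1, ENNReal.ofReal A * ENNReal.ofReal (N (deriv γ s).1) := by
          refine lintegral_mono_ae ?_
          filter_upwards [hd] with s hs
          rw [Real.enorm_eq_ofReal_abs, ← ENNReal.ofReal_mul hA]
          exact ENNReal.ofReal_le_ofReal hs
      _ = ENNReal.ofReal A * length N γ := lintegral_const_mul' _ _ ENNReal.ofReal_ne_top
      _ ≤ ENNReal.ofReal A * ENNReal.ofReal M := by gcongr
      _ = ENNReal.ofReal (A * M) := (ENNReal.ofReal_mul hA).symm
  exact (ENNReal.ofReal_le_ofReal_iff (by positivity)).1 h2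

/-- The coordinates of the first layer. -/
def coordX (i : Fin n) : G n →L[ℝ] ℝ :=
  (ContinuousLinearMap.proj i).comp (ContinuousLinearMap.fst ℝ (Fin n → ℝ) (Bivector n))

/-- The coordinates of the second layer. -/
def coordY (i j : Fin n) : G n →L[ℝ] ℝ :=
  ((ContinuousLinearMap.proj j).comp ((ContinuousLinearMap.proj (R := ℝ)
    (φ := fun _ : Fin n => Fin n → ℝ) i).comp
    (Bivector n).subtypeL)).comp (ContinuousLinearMap.snd ℝ (Fin n → ℝ) (Bivector n))

theorem coordX_apply (i : Fin n) (g : G n) : coordX i g = g.1 i := rfl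

theorem coordY_apply (i j : Fin n) (g : G n) : coordY i j g = g.2.1 i j := rfl

theorem IsHorizontal.ac {γ : ℝ → G n} (hγ : IsHorizontal γ) (L : G n →L[ℝ] ℝ) :
    AbsolutelyContinuousOnInterval (fun t => L (γ t)) 0 1 :=
  L.lipschitz.comp_absolutelyContinuousOnInterval hγ.1

theorem hasDerivAt_coord {γ : ℝ → G n} {t : ℝ} (h : DifferentiableAt ℝ γ t) (L : G n →L[ℝ] ℝ) :
    HasDerivAt (fun t => L (γ t)) (L (deriv γ t)) t :=
  L.hasFDerivAt.comp_hasDerivAt t h.hasDerivAt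

theorem coordY_of_mem_horizontalSpace {g w : G n} (h : w ∈ horizontalSpace g) (i j : Fin n) :
    coordY i j w = (1 / 2) * (g.1 i * w.1 j - w.1 i * g.1 j) := by
  rw [mem_horizontalSpace] at h
  rw [coordY_apply, h]
  rfl

section Estimates

variable {N : Seminorm ℝ (Fin n → ℝ)} {γ : ℝ → G n} {c M : ℝ}

theorem norm_curve_fst_le (hc : 0 < c) (hcN : ∀ v, ‖v‖ ≤ c * N v) (hM : 0 ≤ M) (hγ : IsHorizontal γ)
    (h0 : γ 0 = 1) (hlen : length N γ ≤ ENNReal.ofReal M) {t : ℝ} (ht : t ∈ Icc (0 : ℝ) 1) :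
    ‖(γ t).1‖ ≤ c * M := by
  refine (pi_norm_le_iff_of_nonneg (by positivity)).2 fun i => ?_
  refine abs_le_of_abs_deriv_le (h := fun t => coordX i (γ t)) hc.le hM hlen (hγ.ac _)
    (by simp [h0, coordX_apply]) ?_ ht
  filter_upwards [hγ.2] with s hs
  rw [(hasDerivAt_coord hs.1 _).deriv]
  exact (norm_le_pi_norm (deriv γ s).1 i).trans (hcN _)

theorem norm_curve_snd_le (hc : 0 < c) (hcN : ∀ v, ‖v‖ ≤ c * N v) (hM : 0 ≤ M) (hγ : IsHorizontal γ)
    (h0 : γ 0 = 1) (hlen : length N γ ≤ ENNReal.ofReal M) {t : ℝ} (ht : t ∈ Icc (0 : ℝ) 1) :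
    ‖(γ t).2‖ ≤ c * M * c * M := by
  refine (pi_norm_le_iff_of_nonneg (by positivity)).2 fun i =>
    (pi_norm_le_iff_of_nonneg (by positivity)).2 fun j => ?_
  refine abs_le_of_abs_deriv_le (h := fun t => coordY i j (γ t)) (by positivity) hM hlen (hγ.ac _)
    (by simp [h0, coordY_apply]) ?_ ht
  filter_upwards [hγ.2, ae_restrict_mem measurableSet_Icc] with s hs hsI
  rw [(hasDerivAt_coord hs.1 _).deriv, coordY_of_mem_horizontalSpace hs.2]
  have hx := norm_curve_fst_le hc hcN hM hγ h0 hlen hsI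
  have hu := hcN (deriv γ s).1
  have hxi := (norm_le_pi_norm (γ s).1 i).trans hx
  have hxj := (norm_le_pi_norm (γ s).1 j).trans hx
  have hui := (norm_le_pi_norm (deriv γ s).1 i).trans hu
  have huj := (norm_le_pi_norm (deriv γ s).1 j).trans hu
  have hN0 : 0 ≤ N (deriv γ s).1 := apply_nonneg _ _
  rw [abs_mul, abs_of_pos (by norm_num : (0 : ℝ) < 1 / 2)]
  calc 1 / 2 * |(γ s).1 i * (deriv γ s).1 j - (deriv γ s).1 i * (γ s).1 j|
      ≤ 1 / 2 * (|(γ s).1 i| * |(deriv γ s).1 j| + |(deriv γ s).1 i| * |(γ s).1 j|) := by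
        rw [← abs_mul, ← abs_mul]
        gcongr
        exact abs_sub _ _
    _ ≤ 1 / 2 * ((c * M) * (c * N (deriv γ s).1) + (c * N (deriv γ s).1) * (c * M)) := by
        gcongr <;> assumption
    _ = c * M * c * N (deriv γ s).1 := by ring

/-- If the first layer of a horizontal curve stays in a thin slab around a hyperplane, then the
contraction of the second layer of its endpoint with the normal of the hyperplane is small. -/
theorem abs_contraction_le (hc : 0 < c) (hcN : ∀ v, ‖v‖ ≤ c * N v) (hM : 0 ≤ M)
    (hγ : IsHorizontal γ) (h0 : γ 0 = 1) (hlen : length N γ ≤ ENNReal.ofReal M)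
    {f : Fin n → ℝ} {δ : ℝ} (hf : ∀ t ∈ Icc (0 : ℝ) 1, |∑ m, f m * (γ t).1 m| ≤ δ) (k : Fin n) :
    |∑ m, f m * (γ 1).2.1 k m| ≤ 2 * c * M * δ := by
  have hδ : 0 ≤ δ := (abs_nonneg _).trans (hf 0 (left_mem_Icc.2 zero_le_one))
  set X : G n →L[ℝ] ℝ := ∑ m, f m • coordX m with hX
  set Y : G n →L[ℝ] ℝ := ∑ m, f m • coordY k m with hY
  have hXa : ∀ g, X g = ∑ m, f m * g.1 m := fun g => by simp [hX, coordX_apply]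
  have hYa : ∀ g, Y g = ∑ m, f m * g.2.1 k m := fun g => by simp [hY, coordY_apply]
  have h1 : (1 : ℝ) ∈ Icc (0 : ℝ) 1 := right_mem_Icc.2 zero_le_one
  -- With `X = f · x`, the derivative of the contraction of the second layer is `½ (x_k X' - x_k'
  -- X)`. Subtracting `½ x_k X` cancels the uncontrolled term in `X'` and leaves `-x_k' X`, where
  -- `|X| ≤ δ`.
  have key : |Y (γ 1) - 1 / 2 * (coordX k (γ 1) * X (γ 1))| ≤ c * δ * M := by
    refine abs_le_of_abs_deriv_le (h := fun t => Y (γ t) - 1 / 2 * (coordX k (γ t) * X (γ t)))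
      (by positivity) hM hlen ((hγ.ac _).fun_sub (((hγ.ac _).fun_mul (hγ.ac _)).const_mul _))
      (by simp [h0, hXa, hYa]) ?_ h1
    filter_upwards [hγ.2, ae_restrict_mem measurableSet_Icc] with s hs hsI
    have hd := (hasDerivAt_coord hs.1 Y).sub
      (((hasDerivAt_coord hs.1 (coordX k)).mul (hasDerivAt_coord hs.1 X)).const_mul (1 / 2))
    have hYd : Y (deriv γ s) = 1 / 2 * ((γ s).1 k * X (deriv γ s) - (deriv γ s).1 k * X (γ s)) := by
      have : Y (deriv γ s) = ∑ m, f m * coordY k m (deriv γ s) := hYa _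
      simp only [this, coordY_of_mem_horizontalSpace hs.2, hXa, Finset.mul_sum,
        ← Finset.sum_sub_distrib]
      exact Finset.sum_congr rfl fun m _ => by ring
    have hval : Y (deriv γ s) - 1 / 2 * (coordX k (deriv γ s) * X (γ s) +
        coordX k (γ s) * X (deriv γ s)) = -((deriv γ s).1 k * X (γ s)) := by
      rw [hYd, coordX_apply, coordX_apply]
      ring
    have hd' := hd.deriv
    rw [hval] at hd'
    change |deriv (fun t => Y (γ t) - 1 / 2 * (coordX k (γ t) * X (γ t))) s| ≤ _
    refine (congrArg abs hd').le.trans ?_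
    rw [abs_neg, abs_mul, hXa]
    calc |(deriv γ s).1 k| * |∑ m, f m * (γ s).1 m| ≤ (c * N (deriv γ s).1) * δ := by
          gcongr
          · exact (norm_le_pi_norm (deriv γ s).1 k).trans (hcN _)
          · exact hf s hsI
      _ = c * δ * N (deriv γ s).1 := by ring
  have hx : |coordX k (γ 1)| ≤ c * M :=
    (norm_le_pi_norm (γ 1).1 k).trans (norm_curve_fst_le hc hcN hM hγ h0 hlen h1)
  have hX1 : |X (γ 1)| ≤ δ := by
    rw [hXa]
    exact hf 1 h1
  rw [← hYa]
  calc |Y (γ 1)| = |(Y (γ 1) - 1 / 2 * (coordX k (γ 1) * X (γ 1))) +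
        1 / 2 * (coordX k (γ 1) * X (γ 1))| := by congr 1; ring
    _ ≤ c * δ * M + 1 / 2 * (c * M * δ) := by
        refine (abs_add_le _ _).trans (add_le_add key ?_)
        rw [abs_mul, abs_mul, abs_of_pos (by norm_num : (0 : ℝ) < 1 / 2)]
        gcongr
    _ ≤ 2 * c * M * δ := by nlinarith [mul_nonneg (mul_nonneg hc.le hM) hδ]

end Estimates

/-! ### Finiteness and continuity of the distance from the identity -/

theorem vertical_mul (g : G n) (Z : Bivector n) : g * ((0, Z) : G n) = (g.1, g.2 + Z) :=
  Prod.ext (by simp) (by simp [mul_snd])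

theorem vertical_mul_horizontal (v : Fin n → ℝ) (Z : Bivector n) :
    ((0, Z) : G n) * ((v, 0) : G n) = (v, Z) :=
  Prod.ext (by simp) (by simp [mul_snd])

theorem ccDist_vertical_add_le (N : Seminorm ℝ (Fin n → ℝ)) (Z Z' : Bivector n) :
    ccDist N 1 ((0, Z + Z') : G n) ≤ ccDist N 1 ((0, Z) : G n) + ccDist N 1 ((0, Z') : G n) := by
  have h1 : ((0, Z + Z') : G n) = (0, Z) * (0, Z') :=
    (vertical_mul ((0, Z) : G n) Z').symm
  have h2 := ccDist_mul_left N ((0, Z) : G n) 1 ((0, Z') : G n)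
  rw [mul_one] at h2
  rw [← h2, h1]
  exact ccDist_triangle _ _ _ _

theorem ccDist_vertical_sum_le (N : Seminorm ℝ (Fin n → ℝ)) {ι : Type*} (s : Finset ι)
    (Z : ι → Bivector n) :
    ccDist N 1 ((0, ∑ i ∈ s, Z i) : G n) ≤ ∑ i ∈ s, ccDist N 1 ((0, Z i) : G n) := by
  classical
  induction s using Finset.induction_on with
  | empty =>
    exact (ccDist_self N (1 : G n)).le
  | insert a s ha ih =>
    rw [Finset.sum_insert ha, Finset.sum_insert ha]
    exact (ccDist_vertical_add_le _ _ _).trans (by gcongr)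

/-- The element `(0, v ∧ w)` is the commutator of `(v, 0)` and `(w, 0)`, so four horizontal segments
reach it. -/
theorem ccDist_wedge_le (N : Seminorm ℝ (Fin n → ℝ)) (v w : Fin n → ℝ) :
    ccDist N 1 ((0, wedge v w) : G n) ≤ ENNReal.ofReal (2 * N v + 2 * N w) := by
  have h1 : ((0, wedge v w) : G n) = ((v, 0) : G n) * ((w, 0) : G n) * ((-v, 0) : G n) *
      ((-w, 0) : G n) := by
    refine Prod.ext (by simp) ?_
    ext i j
    simp [mul_snd, wedge_apply]
    ring
  have s1 := ccDist_one_horizontal_le N v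
  have s2 := ccDist_mul_horizontal_le N ((v, 0) : G n) w
  have s3 := ccDist_mul_horizontal_le N (((v, 0) : G n) * ((w, 0) : G n)) (-v)
  have s4 := ccDist_mul_horizontal_le N (((v, 0) : G n) * ((w, 0) : G n) * ((-v, 0) : G n)) (-w)
  rw [map_neg_eq_map] at s3 s4
  have hv : 0 ≤ N v := apply_nonneg _ _
  have hw : 0 ≤ N w := apply_nonneg _ _
  rw [h1, show 2 * N v + 2 * N w = N v + N w + N v + N w by ring,
    ENNReal.ofReal_add (by positivity) hw, ENNReal.ofReal_add (by positivity) hv,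
    ENNReal.ofReal_add hv hw]
  refine (ccDist_triangle _ _ _ _).trans (add_le_add ?_ s4)
  refine (ccDist_triangle _ _ _ _).trans (add_le_add ?_ s3)
  exact (ccDist_triangle _ _ _ _).trans (add_le_add s1 s2)

theorem bivector_eq_sum (Z : Bivector n) :
    Z = ∑ i, ∑ j, (Z.1 i j / 2) • wedge (Pi.single i 1) (Pi.single j 1) := by
  ext k l
  have hZ := Z.2 k l
  have : ∀ A : Fin n → Fin n → Bivector n,
      ((∑ i, ∑ j, A i j : Bivector n) : Fin n → Fin n → ℝ) k l = ∑ i, ∑ j, (A i j).1 k l := by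
    intro A
    simp [Finset.sum_apply]
  rw [this]
  simp only [Submodule.coe_smul, Pi.smul_apply, wedge_apply, smul_eq_mul, mul_sub,
    Finset.sum_sub_distrib, Pi.single_apply]
  simp only [mul_ite, mul_one, mul_zero, Finset.sum_ite_eq, Finset.mem_univ, if_true]
  simp [Finset.sum_ite_eq]
  linarith

/-- The square root comes from bilinearity: a coefficient `r` of an elementary bivector is split as
a product of two factors of size `√|r|`, one for each leg of the commutator. -/
theorem exists_ccDist_vertical_le (N : Seminorm ℝ (Fin n → ℝ)) :
    ∃ C > 0, ∀ Z : Bivector n, ccDist N 1 ((0, Z) : G n) ≤ ENNReal.ofReal (C * √‖Z‖) := by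
  obtain ⟨c, hc, hcN⟩ := exists_seminorm_le N
  refine ⟨n * n * (4 * c) + 1, by positivity, fun Z => ?_⟩
  have h1 : ∀ i j, ccDist N 1 ((0, (Z.1 i j / 2) • wedge (Pi.single i 1) (Pi.single j 1)) : G n) ≤
      ENNReal.ofReal (4 * c * √‖Z‖) := by
    intro i j
    set r := Z.1 i j / 2 with hr
    have hr1 : |r| ≤ ‖Z‖ := by
      rw [hr, abs_div, abs_two]
      linarith [norm_apply_le Z i j, abs_nonneg (Z.1 i j)]
    have hw : r • wedge (Pi.single i 1) (Pi.single j 1) =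
        wedge (√(|r|) • Pi.single i 1) ((SignType.sign r * √(|r|) : ℝ) • Pi.single j 1) := by
      rw [wedge_smul_left, wedge_smul_right, smul_smul]
      congr 1
      rw [mul_left_comm, Real.mul_self_sqrt (abs_nonneg r), sign_mul_abs]
    have hN1 : ∀ (s : ℝ) (k : Fin n), |s| ≤ √‖Z‖ → N (s • Pi.single k 1) ≤ c * √‖Z‖ := by
      intro s k hs
      refine (hcN _).trans ?_
      gcongr
      rw [norm_smul, Pi.norm_single, norm_one, mul_one]
      exact hs
    have hs1 : |(√(|r|))| ≤ √‖Z‖ := by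
      rw [abs_of_nonneg (Real.sqrt_nonneg _)]
      exact Real.sqrt_le_sqrt hr1
    have hs2 : |(SignType.sign r * √(|r|) : ℝ)| ≤ √‖Z‖ := by
      rw [abs_mul]
      refine le_trans (mul_le_of_le_one_left (abs_nonneg _) ?_) hs1
      rcases SignType.sign r with _ | _ | _ <;> simp
    rw [hw]
    refine (ccDist_wedge_le N _ _).trans (ENNReal.ofReal_le_ofReal ?_)
    linarith [hN1 _ i hs1, hN1 _ j hs2]
  calc ccDist N 1 ((0, Z) : G n)
      = ccDist N 1
          ((0, ∑ i, ∑ j, (Z.1 i j / 2) • wedge (Pi.single i 1) (Pi.single j 1)) : G n) := by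
        rw [← bivector_eq_sum]
    _ ≤ ∑ i : Fin n, ∑ j : Fin n, ENNReal.ofReal (4 * c * √‖Z‖) := by
        refine (ccDist_vertical_sum_le N _ _).trans (Finset.sum_le_sum fun i _ => ?_)
        exact (ccDist_vertical_sum_le N _ _).trans (Finset.sum_le_sum fun j _ => h1 i j)
    _ = ENNReal.ofReal (n * n * (4 * c * √‖Z‖)) := by
        rw [Finset.sum_const, Finset.sum_const, Finset.card_univ, Fintype.card_fin, smul_smul,
          nsmul_eq_mul, ← ENNReal.ofReal_natCast, ← ENNReal.ofReal_mul (by positivity),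
          Nat.cast_mul]
    _ ≤ _ := by
        refine ENNReal.ofReal_le_ofReal ?_
        have := Real.sqrt_nonneg ‖Z‖
        nlinarith

theorem ccDist_lt_top (N : Seminorm ℝ (Fin n → ℝ)) (g : G n) : ccDist N 1 g < ⊤ := by
  obtain ⟨C, hC, h⟩ := exists_ccDist_vertical_le N
  have h1 := ccDist_mul_horizontal_le N ((0, g.2) : G n) g.1
  rw [vertical_mul_horizontal] at h1
  refine ((ccDist_triangle N 1 ((0, g.2) : G n) g).trans (add_le_add (h _) h1)).trans_lt ?_
  exact ENNReal.add_lt_top.2 ⟨ENNReal.ofReal_lt_top, ENNReal.ofReal_lt_top⟩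

/-- The distance from the identity element, as a real number. -/
def ccNorm (N : Seminorm ℝ (Fin n → ℝ)) (g : G n) : ℝ := (ccDist N 1 g).toReal

theorem ofReal_ccNorm (N : Seminorm ℝ (Fin n → ℝ)) (g : G n) :
    ENNReal.ofReal (ccNorm N g) = ccDist N 1 g :=
  ENNReal.ofReal_toReal (ccDist_lt_top N g).ne

theorem ccNorm_le_iff {N : Seminorm ℝ (Fin n → ℝ)} {g : G n} {r : ℝ} (hr : 0 ≤ r) :
    ccNorm N g ≤ r ↔ ccDist N 1 g ≤ ENNReal.ofReal r := by
  rw [← ofReal_ccNorm, ENNReal.ofReal_le_ofReal_iff hr]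

theorem ccNorm_nonneg (N : Seminorm ℝ (Fin n → ℝ)) (g : G n) : 0 ≤ ccNorm N g :=
  ENNReal.toReal_nonneg

theorem mem_ccSphere_iff {N : Seminorm ℝ (Fin n → ℝ)} {g : G n} :
    g ∈ ccSphere N ↔ ccNorm N g = 1 := by
  rw [ccSphere, mem_ofPred_eq, ccDist_comm, ccNorm, ENNReal.toReal_eq_one_iff]

theorem ccNorm_mul_le (N : Seminorm ℝ (Fin n → ℝ)) (g h : G n) :
    ccNorm N (g * h) ≤ ccNorm N g + ccNorm N h := by
  have h2 := ccDist_mul_left N g 1 h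
  rw [mul_one] at h2
  rw [ccNorm_le_iff (add_nonneg (ccNorm_nonneg _ _) (ccNorm_nonneg _ _)),
    ENNReal.ofReal_add (ccNorm_nonneg _ _) (ccNorm_nonneg _ _), ofReal_ccNorm, ofReal_ccNorm, ← h2]
  exact ccDist_triangle _ _ _ _

theorem ccNorm_inv (N : Seminorm ℝ (Fin n → ℝ)) (g : G n) : ccNorm N g⁻¹ = ccNorm N g := by
  have := ccDist_mul_left N g 1 g⁻¹
  rw [mul_one, mul_inv_cancel, ccDist_comm] at this
  rw [ccNorm, ccNorm, this]

theorem ccNorm_horizontal_le (N : Seminorm ℝ (Fin n → ℝ)) (v : Fin n → ℝ) :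
    ccNorm N ((v, 0) : G n) ≤ N v :=
  (ccNorm_le_iff (apply_nonneg _ _)).2 (ccDist_one_horizontal_le N v)

theorem ccNorm_dil (N : Seminorm ℝ (Fin n → ℝ)) {c : ℝ} (hc : 0 < c) (g : G n) :
    ccNorm N (dil c g) = c * ccNorm N g := by
  have := ccDist_dil N hc 1 g
  rw [dil_one_right] at this
  rw [ccNorm, ccNorm, this, ENNReal.toReal_mul, ENNReal.toReal_ofReal hc.le]

theorem exists_ccNorm_le (N : Seminorm ℝ (Fin n → ℝ)) :
    ∃ C > 0, ∀ g : G n, ccNorm N g ≤ C * ‖g.1‖ + C * √‖g.2‖ := by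
  obtain ⟨c, hc, hcN⟩ := exists_seminorm_le N
  obtain ⟨C, hC, h⟩ := exists_ccDist_vertical_le N
  refine ⟨c + C, by positivity, fun g => ?_⟩
  have h1 : g = ((0, g.2) : G n) * ((g.1, 0) : G n) := (vertical_mul_horizontal _ _).symm
  have h2 : ccNorm N ((0, g.2) : G n) ≤ C * √‖g.2‖ := (ccNorm_le_iff (by positivity)).2 (h _)
  have h3 := (ccNorm_horizontal_le N g.1).trans (hcN _)
  have h4 := ccNorm_mul_le N ((0, g.2) : G n) ((g.1, 0) : G n)
  rw [← h1] at h4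
  nlinarith [Real.sqrt_nonneg ‖g.2‖, norm_nonneg g.1]

theorem continuous_wedge {X : Type*} [TopologicalSpace X] {f h : X → Fin n → ℝ} (hf : Continuous f)
    (hh : Continuous h) : Continuous fun x => wedge (f x) (h x) := by
  refine Continuous.subtype_mk (continuous_pi fun i => continuous_pi fun j => ?_) _
  fun_prop

/-- By left invariance `|F x - F g| ≤ F (g⁻¹ x)`, and the right side tends to `0` by the explicit
upper bound for `F`. -/
theorem ccNorm_continuous (N : Seminorm ℝ (Fin n → ℝ)) : Continuous (ccNorm N) := by
  obtain ⟨C, hC, h⟩ := exists_ccNorm_le N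
  rw [continuous_iff_continuousAt]
  intro g
  have hb : ∀ x, |ccNorm N x - ccNorm N g| ≤ ccNorm N (g⁻¹ * x) := fun x => by
    have h1 := ccNorm_mul_le N g (g⁻¹ * x)
    have h2 := ccNorm_mul_le N x (g⁻¹ * x)⁻¹
    rw [ccNorm_inv] at h2
    simp only [mul_inv_rev, inv_inv, mul_inv_cancel_left] at h1 h2
    rw [abs_le]
    constructor <;> linarith
  have hmul : Continuous fun x : G n => g⁻¹ * x := by
    have : (fun x : G n => g⁻¹ * x) = fun x => g⁻¹ + dLL g⁻¹ x := funext fun x => mul_eq _ _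
    rw [this]
    fun_prop
  have hlim : Filter.Tendsto (fun x => C * ‖(g⁻¹ * x).1‖ + C * √‖(g⁻¹ * x).2‖) (nhds g)
      (nhds 0) := by
    have hcont : Continuous fun x => C * ‖(g⁻¹ * x).1‖ + C * √‖(g⁻¹ * x).2‖ := by
      have h1 := continuous_fst.comp hmul
      have h2 := continuous_snd.comp hmul
      exact (continuous_const.mul h1.norm).add
        (continuous_const.mul (Real.continuous_sqrt.comp h2.norm))
    have := hcont.tendsto g
    simpa only [inv_mul_cancel, one_fst, one_snd, norm_zero, Real.sqrt_zero, mul_zero,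
      add_zero] using this
  rw [ContinuousAt, tendsto_iff_dist_tendsto_zero]
  exact squeeze_zero (fun _ => dist_nonneg) (fun x => (hb x).trans (h _)) hlim

/-! ### Insertion of loops into a horizontal curve -/

/-- Here `k` is a point of a curve and `g` its endpoint. Making the step `v` at `k`, following the
translated remainder of the curve and then making the step `-v` changes the endpoint by the vertical
element `v ∧ (g.1 - k.1)`. A vertical correction `Z` already present is simply added. -/
theorem conj_insertion (k g : G n) (v : Fin n → ℝ) (Z : Bivector n) :
    k * ((v, 0) : G n) * k⁻¹ * (g * ((0, Z) : G n)) * ((-v, 0) : G n) =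
      g * ((0, wedge v (g.1 - k.1) + Z) : G n) := by
  ext i j
  · simp
  · simp [mul_snd, wedge_apply]
    ring

/-- The times are inserted from the last to the first: when `a` precedes all times already treated,
the modified curve from `γ a` onwards is known, and one more insertion costs `2 N(v a)`. Starting
from an arbitrary `t` before all the times makes the induction close. -/
theorem ccDist_insertion (N : Seminorm ℝ (Fin n → ℝ)) {γ : ℝ → G n} (hγ : IsHorizontal γ)
    (v : ℝ → Fin n → ℝ) (T : Finset ℝ) (hT : ∀ s ∈ T, s ∈ Icc (0 : ℝ) 1) :
    ∀ t ∈ Icc (0 : ℝ) 1, (∀ s ∈ T, t ≤ s) →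
      ccDist N (γ t) (γ 1 * ((0, ∑ s ∈ T, wedge (v s) ((γ 1).1 - (γ s).1)) : G n)) ≤
        lengthOn N γ t 1 + ∑ s ∈ T, ENNReal.ofReal (2 * N (v s)) := by
  induction T using Finset.induction_on_min with
  | empty =>
    intro t ht _
    have h1 : ((0, ∑ s ∈ (∅ : Finset ℝ), wedge (v s) ((γ 1).1 - (γ s).1)) : G n) = 1 := rfl
    rw [h1, mul_one, Finset.sum_empty, add_zero]
    exact ccDist_le_lengthOn N ht.2
      (IsHorizontalOn.mono (a := 0) (b := 1) hγ zero_le_one ht.2 ht.1 le_rfl)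
  | insert a T haT ih =>
    intro t ht hle
    have ha : a ∈ Icc (0 : ℝ) 1 := hT a (Finset.mem_insert_self _ _)
    have hta : t ≤ a := hle a (Finset.mem_insert_self _ _)
    have hnot : a ∉ T := fun h => lt_irrefl _ (haT a h)
    have h1 := ih (fun s hs => hT s (Finset.mem_insert_of_mem hs)) a ha fun s hs => (haT s hs).le
    rw [Finset.sum_insert hnot, Finset.sum_insert hnot, ← conj_insertion]
    set h := γ 1 * ((0, ∑ s ∈ T, wedge (v s) ((γ 1).1 - (γ s).1)) : G n) with hh
    have s0 := ccDist_le_lengthOn N hta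
      (IsHorizontalOn.mono (a := 0) (b := 1) hγ zero_le_one hta ht.1 ha.2)
    have s1 := ccDist_mul_horizontal_le N (γ a) (v a)
    -- This left translation carries `γ a` to the point reached after the inserted step, so the
    -- remaining path keeps its length.
    have s2 := ccDist_mul_left N (γ a * ((v a, 0) : G n) * (γ a)⁻¹) (γ a) h
    have s3 := ccDist_mul_horizontal_le N (γ a * ((v a, 0) : G n) * (γ a)⁻¹ * h) (-v a)
    rw [inv_mul_cancel_right] at s2
    rw [map_neg_eq_map] at s3
    calc _ ≤ ccDist N (γ t) (γ a) + (ccDist N (γ a) (γ a * ((v a, 0) : G n)) +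
          (ccDist N (γ a * ((v a, 0) : G n)) (γ a * ((v a, 0) : G n) * (γ a)⁻¹ * h) +
          ccDist N (γ a * ((v a, 0) : G n) * (γ a)⁻¹ * h)
            (γ a * ((v a, 0) : G n) * (γ a)⁻¹ * h * ((-v a, 0) : G n)))) :=
          (ccDist_triangle _ _ _ _).trans (add_le_add le_rfl
            ((ccDist_triangle _ _ _ _).trans (add_le_add le_rfl (ccDist_triangle _ _ _ _))))
      _ ≤ lengthOn N γ t a + (ENNReal.ofReal (N (v a)) + ((lengthOn N γ a 1 +
          ∑ s ∈ T, ENNReal.ofReal (2 * N (v s))) + ENNReal.ofReal (N (v a)))) := by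
          rw [s2]
          gcongr
      _ = (lengthOn N γ t a + lengthOn N γ a 1) + ((ENNReal.ofReal (N (v a)) +
          ENNReal.ofReal (N (v a))) + ∑ s ∈ T, ENNReal.ofReal (2 * N (v s))) := by ring
      _ = _ := by
          rw [lengthOn_add N γ hta ha.2, ← ENNReal.ofReal_add (apply_nonneg _ _) (apply_nonneg _ _),
            two_mul]

/-! ### A separation alternative -/

/-- The bivectors `∑ v_s ∧ w_s` with `∑ N(v_s) ≤ 1`. -/
def wedgeHull {ι : Type*} (N : Seminorm ℝ (Fin n → ℝ)) (I : Set ι) (w : ι → Fin n → ℝ) :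
    Set (Bivector n) :=
  {Z | ∃ (T : Finset ι) (v : ι → Fin n → ℝ), (∀ s ∈ T, s ∈ I) ∧ ∑ s ∈ T, N (v s) ≤ 1 ∧
    Z = ∑ s ∈ T, wedge (v s) (w s)}

theorem convex_wedgeHull {ι : Type*} (N : Seminorm ℝ (Fin n → ℝ)) (I : Set ι)
    (w : ι → Fin n → ℝ) : Convex ℝ (wedgeHull N I w) := by
  classical
  rintro _ ⟨T, v, hT, hv, rfl⟩ _ ⟨T', v', hT', hv', rfl⟩ a b ha hb hab
  -- Extension by zero puts both families on the common index set `T ∪ T'`, where they can be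
  -- combined pointwise.
  set u : ι → Fin n → ℝ := fun s => if s ∈ T then v s else 0 with hu
  set u' : ι → Fin n → ℝ := fun s => if s ∈ T' then v' s else 0 with hu'
  have e1 : ∀ {β : Type} [AddCommMonoid β] (φ : ι → (Fin n → ℝ) → β), (∀ s, φ s 0 = 0) →
      ∑ s ∈ T ∪ T', φ s (u s) = ∑ s ∈ T, φ s (v s) := by
    intro β _ φ hφ
    rw [← Finset.sum_subset (Finset.subset_union_left (s₁ := T) (s₂ := T'))]
    · exact Finset.sum_congr rfl fun s hs => by simp [hu, hs]
    · intro s _ hs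
      simp [hu, hs, hφ]
  have e2 : ∀ {β : Type} [AddCommMonoid β] (φ : ι → (Fin n → ℝ) → β), (∀ s, φ s 0 = 0) →
      ∑ s ∈ T ∪ T', φ s (u' s) = ∑ s ∈ T', φ s (v' s) := by
    intro β _ φ hφ
    rw [← Finset.sum_subset (Finset.subset_union_right (s₁ := T) (s₂ := T'))]
    · exact Finset.sum_congr rfl fun s hs => by simp [hu', hs]
    · intro s _ hs
      simp [hu', hs, hφ]
  refine ⟨T ∪ T', fun s => a • u s + b • u' s, ?_, ?_, ?_⟩
  · intro s hs
    rcases Finset.mem_union.1 hs with h | h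
    · exact hT s h
    · exact hT' s h
  · calc ∑ s ∈ T ∪ T', N (a • u s + b • u' s)
        ≤ ∑ s ∈ T ∪ T', (a * N (u s) + b * N (u' s)) := by
          refine Finset.sum_le_sum fun s _ => (map_add_le_add N _ _).trans (le_of_eq ?_)
          rw [map_smul_eq_mul, map_smul_eq_mul, Real.norm_of_nonneg ha, Real.norm_of_nonneg hb]
      _ = a * ∑ s ∈ T, N (v s) + b * ∑ s ∈ T', N (v' s) := by
          rw [Finset.sum_add_distrib, ← Finset.mul_sum, ← Finset.mul_sum,
            e1 (fun _ x => N x) (fun _ => map_zero N), e2 (fun _ x => N x) (fun _ => map_zero N)]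
      _ ≤ a * 1 + b * 1 := by gcongr
      _ = 1 := by linarith
  · simp only [wedge_add_left, wedge_smul_left, Finset.sum_add_distrib, ← Finset.smul_sum]
    exact congrArg₂ (fun x y => a • x + b • y)
      (e1 (fun s x => wedge x (w s)) fun _ => wedge_zero_left _).symm
      (e2 (fun s x => wedge x (w s)) fun _ => wedge_zero_left _).symm

theorem wedge_eq_sum (v w : Fin n → ℝ) :
    wedge v w = ∑ l, w l • wedge v (Pi.single l 1) := by
  conv_lhs => rw [pi_eq_sum_univ' w]
  rw [← wedgeL_apply, map_sum]
  simp only [map_smul, wedgeL_apply]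

/-- If a small bivector is not a limit of the bivectors `∑ v_s ∧ w_s` with `∑ N(v_s) ≤ 1`, then the
vectors `w_s` are close to a subspace of codimension two. -/
theorem exists_normals_of_notMem_closure {ι : Type*} {N : Seminorm ℝ (Fin n → ℝ)} {c : ℝ}
    (hc : 0 < c) (hcN : ∀ v, N v ≤ c * ‖v‖) {I : Set ι} {w : ι → Fin n → ℝ} {Z : Bivector n}
    {τ : ℝ} (hτ : ‖Z‖ ≤ τ) (hZ : Z ∉ closure (wedgeHull N I w)) :
    ∃ i j, i ≠ j ∧ ∃ a b : Fin n → ℝ, a i = 0 ∧ a j = 1 ∧ b i = 1 ∧ b j = 0 ∧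
      (∀ k, |a k| ≤ 1) ∧ (∀ k, |b k| ≤ 1) ∧
      (∀ s ∈ I, |∑ m, a m * w s m| ≤ n * n * c * τ) ∧
      (∀ s ∈ I, |∑ m, b m * w s m| ≤ n * n * c * τ) := by
  obtain ⟨f, u, hfu, huZ⟩ := geometric_hahn_banach_closed_point (convex_wedgeHull N I w).closure
    isClosed_closure hZ
  have hmem : ∀ s ∈ I, ∀ v, N v ≤ 1 → f (wedge v (w s)) < u := fun s hs v hv =>
    hfu _ (subset_closure ⟨{s}, fun _ => v, by simpa using hs, by simpa using hv, by simp⟩)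
  have hu : 0 < u := by
    have := hfu 0 (subset_closure ⟨∅, fun _ => 0, by simp, by simp, by simp⟩)
    simpa using this
  -- The separating functional seen as a skew matrix. Since `u < f Z` and `Z` is small, its largest
  -- entry is at least `u / (n² τ)`.
  set B : Fin n → Fin n → ℝ := fun k l => f (wedge (Pi.single k 1) (Pi.single l 1)) with hB
  have hBskew : ∀ k l, B k l = -B l k := fun k l => by
    simp only [hB]
    rw [wedge_comm, map_neg]
  have hfZ : f Z = ∑ k, ∑ l, Z.1 k l / 2 * B k l := by
    conv_lhs => rw [bivector_eq_sum Z]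
    simp only [map_sum, map_smul, smul_eq_mul, hB]
  have hne : Nonempty (Fin n × Fin n) := by
    by_contra h
    have : IsEmpty (Fin n) := by
      rw [not_nonempty_iff] at h
      exact ⟨fun i => h.elim (i, i)⟩
    rw [hfZ] at huZ
    simp at huZ
    linarith
  obtain ⟨⟨i, j⟩, -, hmax⟩ := Finset.exists_max_image Finset.univ
    (fun p : Fin n × Fin n => |B p.1 p.2|) Finset.univ_nonempty
  have hmax' : ∀ k l, |B k l| ≤ |B i j| := fun k l => hmax (k, l) (Finset.mem_univ _)
  have huB : u ≤ n * n * τ * |B i j| := by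
    refine huZ.le.trans ?_
    rw [hfZ]
    calc ∑ k, ∑ l, Z.1 k l / 2 * B k l ≤ ∑ k : Fin n, ∑ l : Fin n, τ * |B i j| := by
          refine Finset.sum_le_sum fun k _ => Finset.sum_le_sum fun l _ => ?_
          refine (le_abs_self _).trans ?_
          rw [abs_mul]
          refine mul_le_mul ?_ (hmax' k l) (abs_nonneg _) ((norm_nonneg _).trans hτ)
          refine le_trans ?_ ((norm_apply_le Z k l).trans hτ)
          rw [abs_div, abs_two]
          linarith [abs_nonneg (Z.1 k l)]
      _ = n * n * τ * |B i j| := by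
          simp
          ring
  have hβ : 0 < |B i j| := by
    refine lt_of_le_of_ne (abs_nonneg _) fun h => ?_
    rw [← h] at huB
    linarith
  have hB0 : B i j ≠ 0 := abs_pos.1 hβ
  have hBji : |B j i| = |B i j| := by rw [hBskew, abs_neg]
  have hBdiag : ∀ k, B k k = 0 := fun k => by linarith [hBskew k k]
  have hij : i ≠ j := fun h => hB0 (by rw [h, hBdiag])
  have hB1 : B j i ≠ 0 := by rw [hBskew]; exact neg_ne_zero.2 hB0
  -- Both vectors `± c⁻¹ e_k` are in the unit ball of `N`, so separation bounds each row of `B`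
  -- against `w s` on both sides.
  have hrow : ∀ s ∈ I, ∀ k, |∑ m, B k m * w s m| ≤ u * c := fun s hs k => by
    have hsum : ∑ m, B k m * w s m = f (wedge (Pi.single k 1) (w s)) := by
      rw [wedge_eq_sum, map_sum]
      simp [hB, mul_comm]
    have hN : N (c⁻¹ • Pi.single k 1) ≤ 1 := by
      rw [map_smul_eq_mul, norm_inv, Real.norm_of_nonneg hc.le, inv_mul_le_iff₀ hc]
      simpa [Pi.norm_single] using hcN (Pi.single k 1)
    have h1 := hmem s hs _ hN
    have h2 := hmem s hs (-(c⁻¹ • Pi.single k 1)) (by rwa [map_neg_eq_map])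
    rw [wedge_neg_left, map_neg] at h2
    rw [wedge_smul_left, map_smul, smul_eq_mul, ← hsum] at h1 h2
    have h3 : c⁻¹ * |∑ m, B k m * w s m| ≤ u := by
      have h4 : |c⁻¹ * ∑ m, B k m * w s m| = c⁻¹ * |∑ m, B k m * w s m| := by
        rw [abs_mul, abs_of_pos (inv_pos.2 hc)]
      rw [← h4]
      exact abs_le.2 ⟨by linarith, h1.le⟩
    rw [inv_mul_le_iff₀ hc] at h3
    linarith
  have hfin : ∀ s ∈ I, ∀ k x, |x| = |B i j| → |∑ m, B k m / x * w s m| ≤ n * n * c * τ := by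
    intro s hs k x hx
    have : ∑ m, B k m / x * w s m = (∑ m, B k m * w s m) / x := by
      rw [Finset.sum_div]
      exact Finset.sum_congr rfl fun m _ => by ring
    rw [this, abs_div, hx, div_le_iff₀ hβ]
    calc _ ≤ u * c := hrow s hs k
      _ ≤ n * n * τ * |B i j| * c := by gcongr
      _ = _ := by ring
  -- The normals are the two rows through the largest entry, divided by `B i j` and `B j i`.
  -- Skewness gives the pattern of zeros and ones at `i, j`, hence independence; maximality bounds
  -- the other entries by one.
  refine ⟨i, j, hij, fun m => B i m / B i j, fun m => B j m / B j i, ?_, ?_, ?_, ?_, ?_, ?_,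
    fun s hs => hfin s hs i _ rfl, fun s hs => hfin s hs j _ hBji⟩
  · simp [hBdiag]
  · exact div_self hB0
  · exact div_self hB1
  · simp [hBdiag]
  · intro k
    rw [abs_div, div_le_one hβ]
    exact hmax' i k
  · intro k
    rw [abs_div, hBji, div_le_one hβ]
    exact hmax' j k

/-! ### The distance to the abnormal set -/

/-- The indices different from `i` and `j`. -/
abbrev Rest (i j : Fin n) : Type := {k : Fin n // k ≠ i ∧ k ≠ j}

/-- The parameters of the subspaces of codimension two transverse to the coordinate plane
`(i, j)`. -/
abbrev Param (i j : Fin n) : Type := (Rest i j → ℝ) × (Rest i j → ℝ)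

/-- The covector with coordinates `a` outside `{i, j}`, with `k`-th coordinate `1`
for `k ∈ {i, j}`, and with vanishing remaining coordinate. -/
def normalVec (i j k : Fin n) (a : Rest i j → ℝ) : Fin n → ℝ := fun m =>
  if h : m ≠ i ∧ m ≠ j then a ⟨m, h⟩ else if m = k then 1 else 0

/-- Contraction of the second layer with a covector. -/
def contract (i j : Fin n) (f : Fin n → ℝ) (g : G n) : Rest i j → ℝ :=
  fun k => ∑ m, f m * g.2.1 k m

/-- The equations of the subgroup generated by the subspace of codimension two of parameter `q`. -/
def slab (i j : Fin n) (q : Param i j) (g : G n) : (ℝ × ℝ) × Param i j :=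
  ((∑ m, normalVec i j j q.1 m * g.1 m, ∑ m, normalVec i j i q.2 m * g.1 m),
    (contract i j (normalVec i j j q.1) g, contract i j (normalVec i j i q.2) g))

/-- The values at `g` of the functions whose infimum is `abnDist g`. -/
def slabValues (g : G n) : Set ℝ :=
  {r | ∃ i j, i ≠ j ∧ ∃ q : Param i j, ‖q‖ ≤ 1 ∧ r = ‖slab i j q g‖}

/-- A substitute for the distance to the set of the endpoints of abnormal curves. -/
def abnDist (g : G n) : ℝ := sInf (slabValues g)

theorem abs_normalVec_le {i j k : Fin n} {a : Rest i j → ℝ} (ha : ‖a‖ ≤ 1) (m : Fin n) :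
    |normalVec i j k a m| ≤ 1 := by
  unfold normalVec
  split_ifs with h1 h2
  · exact (norm_le_pi_norm a _).trans ha
  · simp
  · simp

theorem abs_normalVec_sub_le {i j k : Fin n} (a b : Rest i j → ℝ) (m : Fin n) :
    |normalVec i j k a m - normalVec i j k b m| ≤ ‖a - b‖ := by
  unfold normalVec
  split_ifs with h1 h2
  · exact norm_le_pi_norm (a - b) _
  · simp
  · simp

theorem abs_sum_mul_le {f x : Fin n → ℝ} {A B : ℝ} (hA : 0 ≤ A) (hf : ∀ m, |f m| ≤ A)
    (hx : ∀ m, |x m| ≤ B) : |∑ m, f m * x m| ≤ n * A * B := by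
  calc |∑ m, f m * x m| ≤ ∑ m, |f m * x m| := Finset.abs_sum_le_sum_abs _ _
    _ ≤ ∑ _m : Fin n, A * B := by
        refine Finset.sum_le_sum fun m _ => ?_
        rw [abs_mul]
        exact mul_le_mul (hf m) (hx m) (abs_nonneg _) hA
    _ = n * A * B := by
        simp
        ring

theorem norm_slab_le_iff {i j : Fin n} {q : Param i j} {g : G n} {r : ℝ} (hr : 0 ≤ r) :
    ‖slab i j q g‖ ≤ r ↔
      (|∑ m, normalVec i j j q.1 m * g.1 m| ≤ r ∧ |∑ m, normalVec i j i q.2 m * g.1 m| ≤ r) ∧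
      (∀ k : Rest i j, |∑ m, normalVec i j j q.1 m * g.2.1 k m| ≤ r) ∧
      (∀ k : Rest i j, |∑ m, normalVec i j i q.2 m * g.2.1 k m| ≤ r) := by
  rw [slab, Prod.norm_mk, Prod.norm_mk, Prod.norm_mk]
  simp only [sup_le_iff, pi_norm_le_iff_of_nonneg hr, Real.norm_eq_abs, contract]

theorem norm_slab_le {i j : Fin n} {q : Param i j} (hq : ‖q‖ ≤ 1) (g : G n) :
    ‖slab i j q g‖ ≤ n * ‖g‖ := by
  have h1 := (norm_fst_le q).trans hq
  have h2 := (norm_snd_le q).trans hq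
  have hx : ∀ m, |g.1 m| ≤ ‖g‖ := fun m => (norm_le_pi_norm g.1 m).trans (norm_fst_le g)
  have hY : ∀ k m, |g.2.1 k m| ≤ ‖g‖ := fun k m => (norm_apply_le g.2 k m).trans (norm_snd_le g)
  rw [← mul_one (n : ℝ), norm_slab_le_iff (by positivity)]
  exact ⟨⟨abs_sum_mul_le zero_le_one (abs_normalVec_le h1) hx,
    abs_sum_mul_le zero_le_one (abs_normalVec_le h2) hx⟩,
    fun k => abs_sum_mul_le zero_le_one (abs_normalVec_le h1) (hY k),
    fun k => abs_sum_mul_le zero_le_one (abs_normalVec_le h2) (hY k)⟩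

theorem slab_sub (i j : Fin n) (q : Param i j) (g h : G n) :
    slab i j q (g - h) = slab i j q g - slab i j q h := by
  have key : ∀ f x y : Fin n → ℝ, ∑ m, f m * (x m - y m) = ∑ m, f m * x m - ∑ m, f m * y m := by
    intro f x y
    simp [mul_sub]
  exact Prod.ext (Prod.ext (key _ _ _) (key _ _ _))
    (Prod.ext (funext fun k => key _ _ _) (funext fun k => key _ _ _))

theorem norm_slab_sub_param_le {i j : Fin n} (q q' : Param i j) (g : G n) :
    ‖slab i j q g - slab i j q' g‖ ≤ n * ‖q - q'‖ * ‖g‖ := by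
  have h1 : ‖q.1 - q'.1‖ ≤ ‖q - q'‖ := norm_fst_le (q - q')
  have h2 : ‖q.2 - q'.2‖ ≤ ‖q - q'‖ := norm_snd_le (q - q')
  have hx : ∀ m, |g.1 m| ≤ ‖g‖ := fun m => (norm_le_pi_norm g.1 m).trans (norm_fst_le g)
  have hY : ∀ k m, |g.2.1 k m| ≤ ‖g‖ := fun k m => (norm_apply_le g.2 k m).trans (norm_snd_le g)
  have key : ∀ (k : Fin n) (a a' : Rest i j → ℝ) (x : Fin n → ℝ), ‖a - a'‖ ≤ ‖q - q'‖ →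
      (∀ m, |x m| ≤ ‖g‖) → |∑ m, normalVec i j k a m * x m - ∑ m, normalVec i j k a' m * x m| ≤
      n * ‖q - q'‖ * ‖g‖ := by
    intro k a a' x ha hx
    rw [← Finset.sum_sub_distrib]
    simp only [← sub_mul]
    exact abs_sum_mul_le (norm_nonneg _) (fun m => (abs_normalVec_sub_le a a' m).trans ha) hx
  rw [slab, slab, Prod.mk_sub_mk, Prod.mk_sub_mk, Prod.mk_sub_mk, Prod.norm_mk, Prod.norm_mk,
    Prod.norm_mk]
  simp only [sup_le_iff, pi_norm_le_iff_of_nonneg (show 0 ≤ n * ‖q - q'‖ * ‖g‖ by positivity),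
    Real.norm_eq_abs, contract, Pi.sub_apply]
  exact ⟨⟨key _ _ _ _ h1 hx, key _ _ _ _ h2 hx⟩, fun k => key _ _ _ _ h1 (hY k),
    fun k => key _ _ _ _ h2 (hY k)⟩

theorem slabValues_nonempty (hn : 2 ≤ n) (g : G n) : (slabValues g).Nonempty :=
  ⟨_, ⟨0, by omega⟩, ⟨1, by omega⟩, by simp, 0, by simp, rfl⟩

theorem slabValues_bddBelow (g : G n) : BddBelow (slabValues g) :=
  ⟨0, by
    rintro _ ⟨i, j, _, q, _, rfl⟩
    exact norm_nonneg _⟩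

theorem abnDist_le {i j : Fin n} (hij : i ≠ j) {q : Param i j} (hq : ‖q‖ ≤ 1) (g : G n) :
    abnDist g ≤ ‖slab i j q g‖ :=
  csInf_le (slabValues_bddBelow g) ⟨i, j, hij, q, hq, rfl⟩

theorem abnDist_nonneg (g : G n) : 0 ≤ abnDist g :=
  Real.sInf_nonneg (by
    rintro _ ⟨i, j, _, q, _, rfl⟩
    exact norm_nonneg _)

theorem exists_slab_lt (hn : 2 ≤ n) {g : G n} {r : ℝ} (h : abnDist g < r) :
    ∃ i j, i ≠ j ∧ ∃ q : Param i j, ‖q‖ ≤ 1 ∧ ‖slab i j q g‖ < r := by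
  obtain ⟨_, ⟨i, j, hij, q, hq, rfl⟩, hlt⟩ := exists_lt_of_csInf_lt (slabValues_nonempty hn g) h
  exact ⟨i, j, hij, q, hq, hlt⟩

/-- For each admissible parameter `‖slab i j q ·‖` is `n`-Lipschitz, hence so is the infimum. -/
theorem abnDist_le_add (hn : 2 ≤ n) (g h : G n) : abnDist g ≤ abnDist h + n * ‖g - h‖ := by
  refine le_of_forall_pos_le_add fun ε hε => ?_
  obtain ⟨i, j, hij, q, hq, hlt⟩ := exists_slab_lt hn (lt_add_of_pos_right (abnDist h) hε)
  have h1 := abnDist_le hij hq g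
  have h2 := norm_slab_le hq (g - h)
  rw [slab_sub] at h2
  have h3 := norm_le_norm_add_norm_sub' (slab i j q g) (slab i j q h)
  linarith

theorem abs_abnDist_sub_le (hn : 2 ≤ n) (g h : G n) :
    |abnDist g - abnDist h| ≤ n * ‖g - h‖ := by
  have h1 := abnDist_le_add hn g h
  have h2 := abnDist_le_add hn h g
  rw [norm_sub_rev] at h2
  exact abs_le.2 ⟨by linarith, by linarith⟩

theorem abnDist_continuous (hn : 2 ≤ n) : Continuous (abnDist (n := n)) :=
  (LipschitzWith.of_dist_le_mul (K := n) fun x y => by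
    rw [Real.dist_eq, dist_eq_norm]
    exact abs_abnDist_sub_le hn x y).continuous

theorem abnDist_le_norm (hn : 2 ≤ n) (g : G n) : abnDist g ≤ n * ‖g‖ :=
  (abnDist_le (i := ⟨0, by omega⟩) (j := ⟨1, by omega⟩) (by simp) (q := 0) (by simp) g).trans
    (norm_slab_le (by simp) g)

theorem abnDist_dil_le (hn : 2 ≤ n) {c : ℝ} (hc : 1 ≤ c) (hc2 : c ≤ 2) (g : G n) :
    abnDist (dil c g) ≤ 4 * abnDist g := by
  refine le_of_forall_pos_le_add fun ε hε => ?_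
  have hε4 : 0 < ε / 4 := by positivity
  obtain ⟨i, j, hij, q, hq, hlt⟩ := exists_slab_lt hn (lt_add_of_pos_right (abnDist g) hε4)
  have h1 := (norm_slab_le_iff (norm_nonneg _)).1 (le_refl ‖slab i j q g‖)
  have key : ‖slab i j q (dil c g)‖ ≤ 4 * ‖slab i j q g‖ := by
    have e1 : ∀ (f x : Fin n → ℝ) (r : ℝ), 0 ≤ r → r ≤ 4 → |∑ m, f m * x m| ≤ ‖slab i j q g‖ →
        |∑ m, f m * (r * x m)| ≤ 4 * ‖slab i j q g‖ := by
      intro f x r hr hr4 h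
      have : ∑ m, f m * (r * x m) = r * ∑ m, f m * x m := by
        rw [Finset.mul_sum]
        exact Finset.sum_congr rfl fun m _ => by ring
      rw [this, abs_mul, abs_of_nonneg hr]
      gcongr
    have hc0 : 0 ≤ c := by linarith
    have hc4 : c ^ 2 ≤ 4 := by nlinarith
    rw [norm_slab_le_iff (by positivity)]
    exact ⟨⟨e1 _ _ c hc0 (by linarith) h1.1.1, e1 _ _ c hc0 (by linarith) h1.1.2⟩,
      fun k => e1 _ _ _ (by positivity) hc4 (h1.2.1 k),
      fun k => e1 _ _ _ (by positivity) hc4 (h1.2.2 k)⟩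
  linarith [abnDist_le hij hq (dil c g)]

/-! ### Lipschitz estimate away from the abnormal set -/

theorem normalVec_restrict {i j k : Fin n} {a : Fin n → ℝ} (hij : i ≠ j)
    (hk : (k = i ∧ a i = 1 ∧ a j = 0) ∨ (k = j ∧ a i = 0 ∧ a j = 1)) :
    normalVec i j k (fun m => a m) = a := by
  funext m
  unfold normalVec
  split_ifs with h1 h2
  · rfl
  · rcases hk with ⟨rfl, h, -⟩ | ⟨rfl, -, h⟩ <;> rw [h2, h]
  · rw [not_and_or, not_not, not_not] at h1
    rcases hk with ⟨rfl, h, h'⟩ | ⟨rfl, h, h'⟩ <;> rcases h1 with rfl | rfl <;> simp_all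

/-- A vertical direction missed by all insertions forces the curve into a thin slab of codimension
two. The first layer of the endpoint is then almost in the subspace, and `abs_contraction_le`
handles the second layer. -/
theorem abnDist_le_of_notMem_closure {N : Seminorm ℝ (Fin n → ℝ)} {c c' M : ℝ}
    (hc : 0 < c) (hcN : ∀ v, N v ≤ c * ‖v‖) (hc' : 0 < c') (hcN' : ∀ v, ‖v‖ ≤ c' * N v)
    (hM : 0 ≤ M) {γ : ℝ → G n} (hγ : IsHorizontal γ) (h0 : γ 0 = 1)
    (hlen : length N γ ≤ ENNReal.ofReal M) {Z : Bivector n} {τ : ℝ} (hτ : ‖Z‖ ≤ τ)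
    (hZ : Z ∉ closure (wedgeHull N (Icc (0 : ℝ) 1) fun s => (γ 1).1 - (γ s).1)) :
    abnDist (γ 1) ≤ (1 + 4 * c' * M) * (n * n * c) * τ := by
  obtain ⟨i, j, hij, a, b, hai, haj, hbi, hbj, ha, hb, hwa, hwb⟩ :=
    exists_normals_of_notMem_closure hc hcN hτ hZ
  have hτ0 : 0 ≤ τ := (norm_nonneg _).trans hτ
  set δ := n * n * c * τ with hδ
  have hδ0 : 0 ≤ δ := by positivity
  set q : Param i j := (fun m => a m, fun m => b m) with hq
  have hna : normalVec i j j q.1 = a := normalVec_restrict hij (Or.inr ⟨rfl, hai, haj⟩)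
  have hnb : normalVec i j i q.2 = b := normalVec_restrict hij (Or.inl ⟨rfl, hbi, hbj⟩)
  have hq1 : ‖q‖ ≤ 1 := by
    rw [hq, Prod.norm_mk, sup_le_iff, pi_norm_le_iff_of_nonneg zero_le_one,
      pi_norm_le_iff_of_nonneg zero_le_one]
    exact ⟨fun k => ha k, fun k => hb k⟩
  have key : ∀ f : Fin n → ℝ, (∀ s ∈ Icc (0 : ℝ) 1, |∑ m, f m * ((γ 1).1 - (γ s).1) m| ≤ δ) →
      |∑ m, f m * (γ 1).1 m| ≤ (1 + 4 * c' * M) * δ ∧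
      ∀ k, |∑ m, f m * (γ 1).2.1 k m| ≤ (1 + 4 * c' * M) * δ := by
    intro f hf
    have h1 : |∑ m, f m * (γ 1).1 m| ≤ δ := by
      have := hf 0 (left_mem_Icc.2 zero_le_one)
      simpa [h0] using this
    -- The hypothesis controls `x(1) - x(s)`, and `x(1)` itself through `s = 0`; together they give
    -- the width `2 δ`, which produces the constant `4 c' M`.
    have h2 : ∀ s ∈ Icc (0 : ℝ) 1, |∑ m, f m * (γ s).1 m| ≤ 2 * δ := by
      intro s hs
      have h3 := hf s hs
      simp only [Pi.sub_apply, mul_sub, Finset.sum_sub_distrib] at h3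
      rw [abs_le] at h1 h3 ⊢
      constructor <;> linarith [h1.1, h1.2, h3.1, h3.2]
    have hpos : 0 ≤ 4 * c' * M * δ := by positivity
    refine ⟨by linarith, fun k => ?_⟩
    have := abs_contraction_le hc' hcN' hM hγ h0 hlen h2 k
    linarith
  refine (abnDist_le hij hq1 _).trans ?_
  rw [mul_assoc, ← hδ, norm_slab_le_iff (by positivity), hna, hnb]
  exact ⟨⟨(key a hwa).1, (key b hwb).1⟩, fun k => (key a hwa).2 k, fun k => (key b hwb).2 k⟩

/-- An extra length `2 r` reaches every vertical shift `r Z'` with `Z'` in the closed hull of the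
insertions. The vector `Z / r` is in this hull as soon as its norm is below a fixed multiple of
`abnDist g`, so `r` of order `‖Z‖ / abnDist g` suffices. -/
theorem exists_vertical_estimate (hn : 2 ≤ n) {N : Seminorm ℝ (Fin n → ℝ)}
    (hN : ∀ v, N v = 0 → v = 0) {M : ℝ} (hM : 0 < M) :
    ∃ C > 0, ∀ g : G n, ccNorm N g < M → ∀ Z : Bivector n,
      abnDist g * (ccNorm N ((g.1, g.2 + Z) : G n) - ccNorm N g) ≤ C * ‖Z‖ := by
  obtain ⟨c, hc, hcN⟩ := exists_seminorm_le N
  obtain ⟨c', hc', hcN'⟩ := exists_norm_le hN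
  have hn0 : (0 : ℝ) < n := by
    have : 0 < n := by omega
    exact_mod_cast this
  set C₀ := (1 + 4 * c' * M) * (n * n * c) with hC₀
  have hC₀pos : 0 < C₀ := by positivity
  refine ⟨4 * C₀, by positivity, fun g hg Z => ?_⟩
  rcases (abnDist_nonneg g).eq_or_lt with h0 | hpos
  · rw [← h0, zero_mul]
    positivity
  rcases eq_or_ne Z 0 with rfl | hZ
  · simp
  -- With this choice, missing the closure would imply `abnDist g ≤ C₀ τ = abnDist g / 2`.
  set τ := abnDist g / (2 * C₀) with hτ
  have hτpos : 0 < τ := by positivity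
  have hZpos : 0 < ‖Z‖ := norm_pos_iff.2 hZ
  set r := ‖Z‖ / τ with hr
  have hrpos : 0 < r := by positivity
  have key : ccNorm N ((g.1, g.2 + Z) : G n) ≤ ccNorm N g + 2 * r := by
    refine le_of_forall_pos_le_add fun η hη => ?_
    -- Truncating at `M` makes `C₀` independent of `g` and of `η`.
    set ℓ := min M (ccNorm N g + η) with hℓ
    have hℓpos : 0 < ℓ := lt_min hM (by linarith [ccNorm_nonneg N g])
    have hgℓ : ccNorm N g < ℓ := lt_min hg (by linarith)
    have hlt : ccDist N 1 g < ENNReal.ofReal ℓ := by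
      rw [← ofReal_ccNorm]
      exact (ENNReal.ofReal_lt_ofReal_iff hℓpos).2 hgℓ
    obtain ⟨γ, hγ, hγ0, rfl, hlen⟩ := exists_curve N hlt
    have hcl : r⁻¹ • Z ∈ closure (wedgeHull N (Icc (0 : ℝ) 1) fun s => (γ 1).1 - (γ s).1) := by
      by_contra hnot
      have hnorm : ‖r⁻¹ • Z‖ ≤ τ := by
        rw [norm_smul, norm_inv, Real.norm_of_nonneg hrpos.le, hr, inv_div, div_mul_cancel₀]
        exact hZpos.ne'
      have := abnDist_le_of_notMem_closure hc hcN hc' hcN' hM.le hγ hγ0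
        (hlen.le.trans (ENNReal.ofReal_le_ofReal (min_le_left _ _))) hnorm hnot
      rw [← hC₀, hτ] at this
      have h2 : C₀ * (abnDist (γ 1) / (2 * C₀)) = abnDist (γ 1) / 2 := by
        field_simp
      linarith
    have hsub : closure (wedgeHull N (Icc (0 : ℝ) 1) fun s => (γ 1).1 - (γ s).1) ⊆
        {Z' | ccNorm N (((γ 1).1, (γ 1).2 + r • Z') : G n) ≤ ℓ + 2 * r} := by
      refine closure_minimal ?_ ?_
      · rintro _ ⟨T, v, hT, hv, rfl⟩
        have h1 := ccDist_insertion N hγ (fun s => r • v s) T hT 0 (left_mem_Icc.2 zero_le_one)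
          fun s hs => (hT s hs).1
        simp only [wedge_smul_left, ← Finset.smul_sum] at h1
        rw [vertical_mul, hγ0, ← ENNReal.ofReal_sum_of_nonneg
          fun s _ => mul_nonneg zero_le_two (apply_nonneg _ _), ← length_eq] at h1
        rw [mem_ofPred_eq, ccNorm_le_iff (by positivity), ENNReal.ofReal_add hℓpos.le
          (by positivity)]
        refine h1.trans (add_le_add hlen.le (ENNReal.ofReal_le_ofReal ?_))
        rw [← Finset.mul_sum]
        simp only [map_smul_eq_mul, ← Finset.mul_sum, Real.norm_of_nonneg hrpos.le]
        nlinarith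
      · refine isClosed_le ((ccNorm_continuous N).comp ?_) continuous_const
        exact continuous_const.prodMk (continuous_const.add (continuous_id.const_smul r))
    have h3 := hsub hcl
    rw [mem_ofPred_eq, smul_smul, mul_inv_cancel₀ hrpos.ne', one_smul] at h3
    have h4 : ℓ ≤ ccNorm N (γ 1) + η := min_le_right _ _
    linarith
  have h5 : abnDist g * (2 * r) = 4 * C₀ * ‖Z‖ := by
    rw [hr, hτ]
    field_simp
    ring
  rw [← h5]
  gcongr
  linarith

/-- From `g` one reaches `h` by a vertical displacement and then a horizontal segment, both `O(‖g -
h‖)`. This bounds `F h - F g` with weight `abnDist g`; the opposite difference comes with weight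
`abnDist h`, which is exchanged for `abnDist g` by the Lipschitz bound on `abnDist`. -/
theorem exists_abnDist_mul_le (hn : 2 ≤ n) {N : Seminorm ℝ (Fin n → ℝ)}
    (hN : ∀ v, N v = 0 → v = 0) {R : ℝ} (hR : 0 < R) :
    ∃ C > 0, ∀ g h : G n, ‖g‖ ≤ R → ‖h‖ ≤ R →
      abnDist g * |ccNorm N g - ccNorm N h| ≤ C * ‖g - h‖ := by
  obtain ⟨c, hc, hcN⟩ := exists_seminorm_le N
  obtain ⟨A, hA, hAN⟩ := exists_ccNorm_le N
  set M := A * R + A * √R + 1 with hM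
  have hMpos : 0 < M := by positivity
  have hbound : ∀ g : G n, ‖g‖ ≤ R → ccNorm N g < M := fun g hg => by
    have h1 := (norm_fst_le g).trans hg
    have h2 := Real.sqrt_le_sqrt ((norm_snd_le g).trans hg)
    have := hAN g
    have h3 : A * ‖g.1‖ ≤ A * R := by gcongr
    have h4 : A * √‖g.2‖ ≤ A * √R := by gcongr
    linarith
  obtain ⟨C, hC, hest⟩ := exists_vertical_estimate hn hN hMpos
  set C₁ := C * (1 + R) + n * R * c with hC₁
  have hC₁pos : 0 < C₁ := by positivity
  have one_side : ∀ g h : G n, ‖g‖ ≤ R → ‖h‖ ≤ R →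
      abnDist g * (ccNorm N h - ccNorm N g) ≤ C₁ * ‖g - h‖ := by
    intro g h hg hh
    set v := h.1 - g.1 with hv
    set Z := h.2 - g.2 - (1 / 2 : ℝ) • wedge g.1 v with hZ
    have hv1 : ‖v‖ ≤ ‖g - h‖ := by
      rw [norm_sub_rev g]
      exact norm_fst_le (h - g)
    have hY1 : ‖h.2 - g.2‖ ≤ ‖g - h‖ := by
      rw [norm_sub_rev g]
      exact norm_snd_le (h - g)
    have hZ1 : ‖Z‖ ≤ (1 + R) * ‖g - h‖ := by
      calc ‖Z‖ ≤ ‖h.2 - g.2‖ + ‖(1 / 2 : ℝ) • wedge g.1 v‖ := norm_sub_le _ _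
        _ ≤ ‖g - h‖ + 1 / 2 * (2 * ‖g.1‖ * ‖v‖) := by
            rw [norm_smul, Real.norm_of_nonneg (by norm_num)]
            gcongr
            exact norm_wedge_le _ _
        _ ≤ ‖g - h‖ + 1 / 2 * (2 * R * ‖g - h‖) := by
            gcongr
            exact (norm_fst_le g).trans hg
        _ = _ := by ring
    have hh' : h = ((g.1, g.2 + Z) : G n) * ((v, 0) : G n) := by
      refine Prod.ext (by simp [hv]) ?_
      simp only [mul_snd, hZ]
      module
    have h1 := ccNorm_mul_le N ((g.1, g.2 + Z) : G n) ((v, 0) : G n)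
    rw [← hh'] at h1
    have h2 := hest g (hbound g hg) Z
    have h3 : N v ≤ c * ‖g - h‖ := (hcN v).trans (by gcongr)
    have h4 := ccNorm_horizontal_le N v
    have h5 : abnDist g ≤ n * R := (abnDist_le_norm hn g).trans (by gcongr)
    have h6 := abnDist_nonneg g
    calc abnDist g * (ccNorm N h - ccNorm N g)
        ≤ abnDist g * ((ccNorm N ((g.1, g.2 + Z) : G n) - ccNorm N g) + c * ‖g - h‖) := by
          gcongr
          linarith
      _ ≤ C * ((1 + R) * ‖g - h‖) + n * R * (c * ‖g - h‖) := by
          rw [mul_add]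
          exact add_le_add (h2.trans (by gcongr)) (by gcongr)
      _ = C₁ * ‖g - h‖ := by rw [hC₁]; ring
  refine ⟨C₁ + n * M, by positivity, fun g h hg hh => ?_⟩
  have h1 := one_side g h hg hh
  have h2 := one_side h g hh hg
  rw [norm_sub_rev] at h2
  have h3 := (abs_le.1 (abs_abnDist_sub_le hn g h)).2
  have hbg := hbound g hg
  have h0g := ccNorm_nonneg N g
  have h0h := ccNorm_nonneg N h
  have hnM : 0 ≤ n * M * ‖g - h‖ := by positivity
  rcases le_total (ccNorm N g) (ccNorm N h) with hle | hle
  · rw [abs_of_nonpos (by linarith), neg_sub]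
    linarith
  · rw [abs_of_nonneg (by linarith)]
    have h4 : (abnDist g - abnDist h) * (ccNorm N g - ccNorm N h) ≤ n * ‖g - h‖ * M := by
      refine (mul_le_mul_of_nonneg_right h3 (by linarith)).trans ?_
      gcongr
      linarith
    linarith

end FreeCarnotStepTwo

/-! ### Hausdorff measure and Minkowski content -/

section Minkowski

variable {E : Type*} [NormedAddCommGroup E] [NormedSpace ℝ E] [FiniteDimensional ℝ E]
  [MeasurableSpace E] [BorelSpace E] (μ : Measure E) [μ.IsAddHaarMeasure]

theorem card_mul_le_measure_thickening {X : Set E} {s : ℝ≥0} (hs : 0 < s) {T : Finset E}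
    (hT : ↑T ⊆ X) (hsep : Metric.IsSeparated (s : ENNReal) (T : Set E)) :
    T.card * (ENNReal.ofReal ((s / 2 : ℝ) ^ Module.finrank ℝ E) * μ (Metric.ball 0 1)) ≤
      μ (Metric.thickening s X) := by
  have hs2 : (0 : ℝ) < s / 2 := half_pos hs
  calc (T.card : ENNReal) * (ENNReal.ofReal ((s / 2 : ℝ) ^ Module.finrank ℝ E) *
        μ (Metric.ball 0 1)) = ∑ x ∈ T, μ (Metric.ball x (s / 2 : ℝ)) := by
        simp only [Measure.addHaar_ball_of_pos μ _ hs2, Finset.sum_const, nsmul_eq_mul]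
    _ = μ (⋃ x ∈ T, Metric.ball x (s / 2 : ℝ)) := by
        refine (measure_biUnion_finset ?_ fun _ _ => Metric.isOpen_ball.measurableSet).symm
        intro x hx y hy hxy
        refine Metric.ball_disjoint_ball ?_
        have : (s : ENNReal) < edist x y := hsep hx hy hxy
        rw [edist_dist, ← ENNReal.ofReal_coe_nnreal] at this
        have := (ENNReal.ofReal_lt_ofReal_iff_of_nonneg s.2).1 this
        rw [add_halves]
        exact this.le
    _ ≤ μ (Metric.thickening s X) := by
        refine measure_mono (iUnion₂_subset fun x hx y hy => ?_)
        rw [Metric.mem_thickening_iff]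
        exact ⟨x, hT hx, (Metric.mem_ball.1 hy).trans (half_lt_self (NNReal.coe_pos.2 hs))⟩

theorem exists_finite_cover {X : Set E} {s : ℝ≥0} (hs : 0 < s)
    (hfin : μ (Metric.thickening s X) ≠ ⊤) :
    ∃ T : Finset E, X ⊆ ⋃ x ∈ T, Metric.closedBall x (s : ℝ) ∧
      T.card * (ENNReal.ofReal ((s / 2 : ℝ) ^ Module.finrank ℝ E) * μ (Metric.ball 0 1)) ≤
      μ (Metric.thickening s X) := by
  have hs2 : (0 : ℝ) < s / 2 := half_pos hs
  set b := ENNReal.ofReal ((s / 2 : ℝ) ^ Module.finrank ℝ E) * μ (Metric.ball 0 1) with hb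
  have hb0 : b ≠ 0 := mul_ne_zero (by simpa using pow_pos hs2 _)
    (Metric.measure_ball_pos μ 0 one_pos).ne'
  have hbt : b ≠ ⊤ := ENNReal.mul_ne_top ENNReal.ofReal_ne_top measure_ball_lt_top.ne
  obtain ⟨N, hN⟩ := ENNReal.exists_nat_gt (ENNReal.div_ne_top hfin hb0)
  have hpack : Metric.packingNumber s X ≤ N := by
    refine iSup_le fun C => iSup_le fun hCX => iSup_le fun hC => ?_
    by_contra! hlt
    obtain ⟨t, htC, ht⟩ := Set.exists_subset_encard_eq hlt.le
    have htfin : t.Finite := Set.finite_of_encard_eq_coe ht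
    have h1 := card_mul_le_measure_thickening μ hs (T := htfin.toFinset)
      (by simpa using htC.trans hCX) (by simpa using hC.subset htC)
    have hcard : htfin.toFinset.card = N := by
      rw [htfin.encard_eq_coe_toFinset_card] at ht
      exact_mod_cast ht
    rw [hcard, ← hb, ← ENNReal.le_div_iff_mul_le (Or.inl hb0) (Or.inl hbt)] at h1
    exact absurd hN (not_lt.2 h1)
  have hne : Metric.packingNumber s X ≠ ⊤ := ne_top_of_le_ne_top (ENat.natCast_ne_top N) hpack
  have hfinset : (Metric.maximalSeparatedSet s X).Finite := by
    rw [← Set.encard_ne_top_iff, Metric.encard_maximalSeparatedSet hne]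
    exact hne
  refine ⟨hfinset.toFinset, ?_, card_mul_le_measure_thickening μ hs
    (by simpa using Metric.maximalSeparatedSet_subset)
    (by simpa using Metric.isSeparated_maximalSeparatedSet)⟩
  intro x hx
  obtain ⟨y, hy, hxy⟩ := Metric.isCover_maximalSeparatedSet hne hx
  refine mem_iUnion₂.2 ⟨y, by simpa using hy, ?_⟩
  have hxy' : edist x y ≤ s := hxy
  rw [edist_dist, ← ENNReal.ofReal_coe_nnreal] at hxy'
  exact (ENNReal.ofReal_le_ofReal_iff s.2).1 hxy'

/-- The Hausdorff measure of codimension one is bounded by the Minkowski content. -/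
theorem hausdorffMeasure_le_of_measure_thickening_le (hd : 1 ≤ Module.finrank ℝ E) {X : Set E}
    {C s₀ : ℝ} (hs₀ : 0 < s₀)
    (h : ∀ s, 0 < s → s ≤ s₀ → μ (Metric.thickening s X) ≤ ENNReal.ofReal (C * s)) :
    Measure.hausdorffMeasure ((Module.finrank ℝ E - 1 : ℕ) : ℝ) X ≤
      ENNReal.ofReal (C * (2 * 4 ^ (Module.finrank ℝ E - 1))) / μ (Metric.ball 0 1) := by
  obtain ⟨d, hd'⟩ : ∃ d, Module.finrank ℝ E = d + 1 := ⟨_, (Nat.sub_add_cancel hd).symm⟩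
  rw [hd', Nat.add_sub_cancel]
  set m := μ (Metric.ball (0 : E) 1) with hm
  have hm0 : m ≠ 0 := (Metric.measure_ball_pos μ 0 one_pos).ne'
  have hmt : m ≠ ⊤ := measure_ball_lt_top.ne
  -- At scale `s` a cover has at most `C s / ((s/2)^(d+1) m)` balls, each contributing at most `(2
  -- s)^d`. The powers of `s` cancel, so any sequence of scales tending to zero will do.
  set s : ℕ → ℝ≥0 := fun k => ⟨s₀ / (k + 1), by positivity⟩ with hs
  have hspos : ∀ k, 0 < s k := fun k => by
    rw [← NNReal.coe_pos]
    change 0 < s₀ / (k + 1)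
    positivity
  have hsle : ∀ k, (s k : ℝ) ≤ s₀ := fun k => by
    change s₀ / (k + 1) ≤ s₀
    exact div_le_self hs₀.le (by linarith [Nat.cast_nonneg (α := ℝ) k])
  have hlim : Filter.Tendsto (fun k => (s k : ℝ)) Filter.atTop (nhds 0) := by
    have := tendsto_one_div_add_atTop_nhds_zero_nat.const_mul s₀
    rw [mul_zero] at this
    refine this.congr fun k => ?_
    change _ = s₀ / (k + 1)
    ring
  have hmeas : ∀ k, μ (Metric.thickening (s k) X) ≤ ENNReal.ofReal (C * s k) := fun k =>
    h _ (hspos k) (hsle k)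
  choose T hTcov hTcard using fun k => exists_finite_cover μ (hspos k)
    (ne_top_of_le_ne_top ENNReal.ofReal_ne_top (hmeas k))
  have hdiam : ∀ (k : ℕ) (x : E), Metric.ediam (Metric.closedBall x (s k : ℝ)) ≤
      ENNReal.ofReal (2 * s k) := by
    intro k x
    refine Metric.ediam_le fun y hy z hz => ?_
    rw [edist_dist, two_mul]
    exact ENNReal.ofReal_le_ofReal ((dist_triangle_right y z x).trans (add_le_add hy hz))
  refine (Measure.hausdorffMeasure_le_liminf_sum (d : ℝ) X (l := Filter.atTop)
    (ι := fun k => T k) (r := fun k => ENNReal.ofReal (2 * s k))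
    ?_ (t := fun k x => Metric.closedBall (x : E) (s k : ℝ)) ?_ ?_).trans ?_
  · have := ENNReal.tendsto_ofReal (hlim.const_mul 2)
    simpa using this
  · exact Filter.Eventually.of_forall fun k x => hdiam k x
  · refine Filter.Eventually.of_forall fun k x hx => ?_
    obtain ⟨y, hy, hxy⟩ := mem_iUnion₂.1 (hTcov k hx)
    exact mem_iUnion.2 ⟨⟨y, hy⟩, hxy⟩
  · refine Filter.liminf_le_of_le (by isBoundedDefault) fun b hb => ?_
    obtain ⟨k, hk⟩ := hb.exists
    refine hk.trans ?_
    have hsk : (0 : ℝ) < s k := hspos k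
    calc ∑ x : T k, Metric.ediam (Metric.closedBall x.1 (s k : ℝ)) ^ (d : ℝ)
        ≤ ∑ _x : T k, ENNReal.ofReal (2 * s k) ^ (d : ℝ) := by
          refine Finset.sum_le_sum fun x _ => ?_
          exact ENNReal.rpow_le_rpow (hdiam k x) (Nat.cast_nonneg d)
      _ = (T k).card * ENNReal.ofReal ((2 * s k) ^ d) := by
          simp [ENNReal.ofReal_pow]
      _ ≤ _ := by
          have h1 := (hTcard k).trans (hmeas k)
          rw [hd', ← hm] at h1
          rw [ENNReal.le_div_iff_mul_le (Or.inl hm0) (Or.inl hmt)]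
          have e1 : (2 * (s k : ℝ)) ^ d = 2 * 4 ^ d / s k * ((s k : ℝ) / 2) ^ (d + 1) := by
            rw [show (4 : ℝ) = 2 * 2 by norm_num, mul_pow, mul_pow, div_pow]
            field_simp
            ring
          calc (T k).card * ENNReal.ofReal ((2 * s k) ^ d) * m
              = ENNReal.ofReal (2 * 4 ^ d / s k) *
                ((T k).card * (ENNReal.ofReal ((s k / 2 : ℝ) ^ (d + 1)) * m)) := by
                rw [e1, ENNReal.ofReal_mul (by positivity)]
                ring
            _ ≤ ENNReal.ofReal (2 * 4 ^ d / s k) * ENNReal.ofReal (C * s k) := by gcongr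
            _ = ENNReal.ofReal (C * (2 * 4 ^ d)) := by
                rw [← ENNReal.ofReal_mul (by positivity)]
                congr 1
                field_simp

end Minkowski

/-! ### Comparison of the slices of a set -/

/-- Markov's inequality and Tonelli: both sides are compared with the product measure of `H`. The
set `A` may be non-measurable. -/
theorem mul_measure_le_lintegral_of_slices {α β : Type*} [MeasurableSpace α] [MeasurableSpace β]
    {μ : Measure α} {ν : Measure β} [SFinite μ] [SFinite ν] {H : Set (α × β)}
    (hH : MeasurableSet H) {A : Set α} {c : ENNReal} {b : β → ENNReal}
    (hA : ∀ x ∈ A, c ≤ ν {y | (x, y) ∈ H}) (hb : ∀ y, μ {x | (x, y) ∈ H} ≤ b y) :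
    c * μ A ≤ ∫⁻ y, b y ∂ν := by
  calc c * μ A ≤ c * μ {x | c ≤ ν (Prod.mk x ⁻¹' H)} := by
        gcongr
        exact fun x hx => hA x hx
    _ ≤ ∫⁻ x, ν (Prod.mk x ⁻¹' H) ∂μ :=
        mul_meas_ge_le_lintegral (measurable_measure_prodMk_left hH) c
    _ = μ.prod ν H := (Measure.prod_apply hH).symm
    _ = ∫⁻ y, μ ((fun x => (x, y)) ⁻¹' H) ∂ν := Measure.prod_apply_symm hH
    _ ≤ ∫⁻ y, b y ∂ν := lintegral_mono hb

/-- Dyadic decomposition: `1 / D ≤ 2^(k+1)` where `2^(-k-1) < D ≤ 2^(-k)`, a region of measure at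
most `C 4^(-k)`, and the series converges. -/
theorem lintegral_inv_lt_top_of_measure_le_le {α : Type*} [MeasurableSpace α] {μ : Measure α}
    [IsFiniteMeasure μ] {D : α → ℝ} (hD : Measurable D) (hD0 : ∀ x, 0 ≤ D x) {C : ℝ} (hC : 0 ≤ C)
    (h : ∀ ε, 0 < ε → ε ≤ 1 → μ {x | D x ≤ ε} ≤ ENNReal.ofReal (C * ε ^ 2)) :
    ∫⁻ x, (ENNReal.ofReal (D x))⁻¹ ∂μ < ⊤ := by
  set A : ℕ → Set α := fun k => {x | D x ≤ (1 / 2) ^ k} with hA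
  have hAm : ∀ k, MeasurableSet (A k) := fun k => measurableSet_le hD measurable_const
  have hpt : ∀ x, (ENNReal.ofReal (D x))⁻¹ ≤
      1 + ∑' k, (A k).indicator (fun _ => ENNReal.ofReal (2 ^ (k + 1))) x := by
    intro x
    rcases lt_or_ge (D x) 1 with h1 | h1
    · refine le_trans ?_ le_add_self
      -- At a zero of `D` the left side is `⊤`, and so is the series because `x` belongs to every `A
      -- k`.
      rcases (hD0 x).eq_or_lt with h0 | h0
      · have : (∑' k, (A k).indicator (fun _ => ENNReal.ofReal (2 ^ (k + 1))) x) = ⊤ := by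
          rw [eq_top_iff, ← ENNReal.tsum_const_eq_top_of_ne_zero (α := ℕ) one_ne_zero]
          refine ENNReal.tsum_le_tsum fun k => ?_
          have hx : x ∈ A k := by
            rw [hA, mem_ofPred_eq, ← h0]
            positivity
          rw [indicator_of_mem hx, ENNReal.one_le_ofReal]
          exact one_le_pow₀ one_le_two
        rw [this]
        exact le_top
      · obtain ⟨k, hk1, hk2⟩ := exists_nat_pow_near_of_lt_one h0 h1.le
          (by norm_num : (0 : ℝ) < 1 / 2) (by norm_num)
        refine le_trans ?_ (ENNReal.le_tsum k)
        rw [indicator_of_mem (show x ∈ A k from hk2), ← ENNReal.ofReal_inv_of_pos h0]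
        refine ENNReal.ofReal_le_ofReal ?_
        rw [inv_le_comm₀ h0 (by positivity), ← inv_pow, ← one_div]
        exact hk1.le
    · refine le_trans ?_ le_self_add
      rw [ENNReal.inv_le_one, ENNReal.one_le_ofReal]
      exact h1
  refine (lintegral_mono hpt).trans_lt ?_
  rw [lintegral_add_left measurable_const, lintegral_one,
    lintegral_tsum fun k => (measurable_const.indicator (hAm k)).aemeasurable]
  refine ENNReal.add_lt_top.2 ⟨measure_lt_top _ _, ?_⟩
  have hterm : ∀ k, ∫⁻ x, (A k).indicator (fun _ => ENNReal.ofReal (2 ^ (k + 1))) x ∂μ ≤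
      ENNReal.ofReal (2 * C) * (2⁻¹) ^ k := by
    intro k
    rw [lintegral_indicator_const (hAm k)]
    have h1 := h ((1 / 2) ^ k) (by positivity) (pow_le_one₀ (by norm_num) (by norm_num))
    have h2 : (2⁻¹ : ENNReal) ^ k = ENNReal.ofReal ((1 / 2) ^ k) := by
      rw [ENNReal.ofReal_pow (by norm_num), one_div, ENNReal.ofReal_inv_of_pos two_pos]
      simp
    refine (mul_le_mul_right h1 _).trans ?_
    rw [h2, ← ENNReal.ofReal_mul (by positivity), ← ENNReal.ofReal_mul (by positivity)]
    refine ENNReal.ofReal_le_ofReal (le_of_eq ?_)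
    rw [one_div, inv_pow]
    field_simp
    ring
  refine (ENNReal.tsum_le_tsum hterm).trans_lt ?_
  rw [ENNReal.tsum_mul_left, ENNReal.tsum_geometric]
  refine ENNReal.mul_lt_top ENNReal.ofReal_lt_top ?_
  simp

namespace FreeCarnotStepTwo

variable {n : ℕ}

/-! ### Volume of the neighbourhoods of the abnormal set -/

theorem continuous_normalVec (i j k m : Fin n) :
    Continuous fun a : Rest i j → ℝ => normalVec i j k a m := by
  unfold normalVec
  split_ifs <;> fun_prop

theorem continuous_coord_snd (k m : Fin n) : Continuous fun g : G n => g.2.1 k m :=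
  (coordY k m).continuous

theorem continuous_slab (i j : Fin n) :
    Continuous fun p : Param i j × G n => slab i j p.1 p.2 := by
  have h1 : ∀ m, Continuous fun p : Param i j × G n => normalVec i j j p.1.1 m := fun m =>
    (continuous_normalVec i j j m).comp (continuous_fst.comp continuous_fst)
  have h2 : ∀ m, Continuous fun p : Param i j × G n => normalVec i j i p.1.2 m := fun m =>
    (continuous_normalVec i j i m).comp (continuous_snd.comp continuous_fst)
  have hx : ∀ m, Continuous fun p : Param i j × G n => p.2.1 m := fun m => by fun_prop
  have hY : ∀ k m, Continuous fun p : Param i j × G n => p.2.2.1 k m := fun k m =>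
    (continuous_coord_snd k m).comp continuous_snd
  refine ((continuous_finsetSum _ fun m _ => (h1 m).mul (hx m)).prodMk
    (continuous_finsetSum _ fun m _ => (h2 m).mul (hx m))).prodMk
    ((continuous_pi fun k => ?_).prodMk (continuous_pi fun k => ?_))
  · exact continuous_finsetSum _ fun m _ => (h1 m).mul (hY k m)
  · exact continuous_finsetSum _ fun m _ => (h2 m).mul (hY k m)

/-- Extension by zero of a vector indexed by the complement of `{i, j}`. -/
def extendZero (i j : Fin n) (a : Rest i j → ℝ) : Fin n → ℝ := fun m =>
  if h : m ≠ i ∧ m ≠ j then a ⟨m, h⟩ else 0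

/-- A common right inverse of all the maps `slab i j q`. -/
def slabSection (i j : Fin n) (y : (ℝ × ℝ) × Param i j) : G n :=
  (Pi.single j y.1.1 + Pi.single i y.1.2,
    wedge (extendZero i j y.2.1) (Pi.single j 1) + wedge (extendZero i j y.2.2) (Pi.single i 1))

/-- The section only involves the entries `i` and `j` of the covectors, which are `0` or `1`
whatever `q` is. -/
theorem slab_slabSection {i j : Fin n} (hij : i ≠ j) (q : Param i j) (y : (ℝ × ℝ) × Param i j) :
    slab i j q (slabSection i j y) = y := by
  have nj : ∀ (k : Fin n) (a : Rest i j → ℝ), normalVec i j k a j = if j = k then 1 else 0 :=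
    fun k a => by simp [normalVec]
  have ni : ∀ (k : Fin n) (a : Rest i j → ℝ), normalVec i j k a i = if i = k then 1 else 0 :=
    fun k a => by simp [normalVec]
  have hY : ∀ (k : Rest i j) (m : Fin n), (slabSection i j y).2.1 k m =
      y.2.1 k * (Pi.single j 1 : Fin n → ℝ) m + y.2.2 k * (Pi.single i 1 : Fin n → ℝ) m := by
    intro k m
    have hki : (k : Fin n) ≠ i := k.2.1
    have hkj : (k : Fin n) ≠ j := k.2.2
    have he : ∀ a : Rest i j → ℝ, extendZero i j a k = a k := fun a => by
      simp [extendZero, k.2]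
    change extendZero i j y.2.1 k * (Pi.single j 1 : Fin n → ℝ) m -
        (Pi.single j 1 : Fin n → ℝ) k * extendZero i j y.2.1 m +
      (extendZero i j y.2.2 k * (Pi.single i 1 : Fin n → ℝ) m -
        (Pi.single i 1 : Fin n → ℝ) k * extendZero i j y.2.2 m) = _
    rw [he, he, Pi.single_eq_of_ne hki, Pi.single_eq_of_ne hkj]
    ring
  have hx : ∀ f : Fin n → ℝ, ∑ m, f m * (slabSection i j y).1 m = f j * y.1.1 + f i * y.1.2 := by
    intro f
    simp [slabSection, mul_add, Finset.sum_add_distrib, Pi.single_apply]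
  have hc : ∀ (f : Fin n → ℝ) (k : Rest i j), ∑ m, f m * (slabSection i j y).2.1 k m =
      f j * y.2.1 k + f i * y.2.2 k := by
    intro f k
    simp only [hY]
    simp [mul_add, Finset.sum_add_distrib, Pi.single_apply]
  refine Prod.ext (Prod.ext ?_ ?_) (Prod.ext (funext fun k => ?_) (funext fun k => ?_))
  · exact (hx _).trans (by simp [nj, ni, hij])
  · exact (hx _).trans (by simp [nj, ni, hij.symm])
  · exact (hc _ k).trans (by simp [nj, ni, hij])
  · exact (hc _ k).trans (by simp [nj, ni, hij.symm])

theorem continuous_extendZero (i j : Fin n) : Continuous (extendZero i j) := by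
  refine continuous_pi fun m => ?_
  unfold extendZero
  split_ifs <;> fun_prop

theorem norm_extendZero_le (i j : Fin n) (a : Rest i j → ℝ) : ‖extendZero i j a‖ ≤ ‖a‖ := by
  refine (pi_norm_le_iff_of_nonneg (norm_nonneg _)).2 fun m => ?_
  unfold extendZero
  split_ifs
  · exact norm_le_pi_norm a _
  · simp

theorem continuous_slabSection (i j : Fin n) : Continuous (slabSection i j) := by
  refine Continuous.prodMk ?_ ?_
  · exact ((continuous_single (A := fun _ : Fin n => ℝ) j).comp
      (continuous_fst.comp continuous_fst)).add
      ((continuous_single (A := fun _ : Fin n => ℝ) i).comp (continuous_snd.comp continuous_fst))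
  · exact (continuous_wedge ((continuous_extendZero i j).comp (continuous_fst.comp continuous_snd))
      continuous_const).add (continuous_wedge ((continuous_extendZero i j).comp
      (continuous_snd.comp continuous_snd)) continuous_const)

theorem norm_slabSection_le {i j : Fin n} {y : (ℝ × ℝ) × Param i j} (hy : ‖y‖ ≤ 1) :
    ‖slabSection i j y‖ ≤ 4 := by
  have h1 := (norm_fst_le y).trans hy
  have h2 := (norm_snd_le y).trans hy
  have hw : ∀ (a : Rest i j → ℝ) (k : Fin n), ‖a‖ ≤ 1 →
      ‖wedge (extendZero i j a) (Pi.single k 1)‖ ≤ 2 := by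
    intro a k ha
    refine (norm_wedge_le _ _).trans ?_
    rw [Pi.norm_single, norm_one, mul_one]
    linarith [norm_extendZero_le i j a]
  rw [slabSection, Prod.norm_mk, sup_le_iff]
  constructor
  · refine (norm_add_le _ _).trans ?_
    rw [Pi.norm_single, Pi.norm_single]
    linarith [(norm_fst_le y.1).trans h1, (norm_snd_le y.1).trans h1]
  · refine (norm_add_le _ _).trans ?_
    linarith [hw y.2.1 j ((norm_fst_le y.2).trans h2), hw y.2.2 i ((norm_snd_le y.2).trans h2)]

section Volume

variable (μ : Measure (G n)) [μ.IsAddHaarMeasure]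

/-- Translates of the slab by `slabSection y`, `‖y‖ ≤ 1`, stay in a ball of radius `R + 4`, and a
given point is in such a translate only for `y` in a ball of radius `ε`. Slicing gives the power of
`ε` equal to the number of equations, uniformly in `q`. -/
theorem measure_slab_le {i j : Fin n} (hij : i ≠ j) (q : Param i j) (R : ℝ) {ε : ℝ} (hε : 0 < ε) :
    μ {g | ‖g‖ ≤ R ∧ ‖slab i j q g‖ ≤ ε} ≤
      ENNReal.ofReal (ε ^ Module.finrank ℝ ((ℝ × ℝ) × Param i j)) *
        μ (Metric.closedBall 0 (R + 4)) := by
  set ν : Measure ((ℝ × ℝ) × Param i j) := Measure.addHaar with hν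
  set X : Set (G n) := {g | ‖g‖ ≤ R ∧ ‖slab i j q g‖ ≤ ε} with hX
  have hslab : Continuous fun g : G n => slab i j q g :=
    (continuous_slab i j).comp (continuous_const.prodMk continuous_id)
  have hXc : IsClosed X := (isClosed_le continuous_norm continuous_const).inter
    (isClosed_le hslab.norm continuous_const)
  set H : Set (((ℝ × ℝ) × Param i j) × G n) :=
    {p | p.1 ∈ Metric.closedBall 0 1 ∧ p.2 - slabSection i j p.1 ∈ X}
    with hH
  have : OpensMeasurableSpace (((ℝ × ℝ) × Param i j) × G n) := Prod.opensMeasurableSpace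
  have hHm : MeasurableSet H := by
    refine IsClosed.measurableSet ((Metric.isClosed_closedBall.preimage continuous_fst).inter
      (hXc.preimage (continuous_snd.sub ((continuous_slabSection i j).comp continuous_fst))))
  have key := mul_measure_le_lintegral_of_slices (μ := ν) (ν := μ) hHm
    (A := Metric.closedBall 0 1) (c := μ X)
    (b := (Metric.closedBall 0 (R + 4)).indicator fun _ =>
      ENNReal.ofReal (ε ^ Module.finrank ℝ ((ℝ × ℝ) × Param i j)) * ν (Metric.ball 0 1)) ?_ ?_
  · rw [lintegral_indicator_const Metric.isClosed_closedBall.measurableSet] at key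
    have hb0 : ν (Metric.ball 0 1) ≠ 0 := (Metric.measure_ball_pos ν 0 one_pos).ne'
    have hbt : ν (Metric.ball 0 1) ≠ ⊤ := measure_ball_lt_top.ne
    rw [← ENNReal.mul_le_mul_iff_left hb0 hbt]
    calc μ X * ν (Metric.ball 0 1) ≤ μ X * ν (Metric.closedBall 0 1) := by
          gcongr
          exact Metric.ball_subset_closedBall
      _ ≤ _ := key
      _ = _ := by ring
  · intro y hy
    have h1 : {g | (y, g) ∈ H} = (fun g => g + -slabSection i j y) ⁻¹' X := by
      ext g
      simp only [hH, mem_ofPred_eq, mem_preimage, ← sub_eq_add_neg]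
      exact and_iff_right hy
    rw [h1, measure_preimage_add_right]
  · intro g
    by_cases hg : g ∈ Metric.closedBall (0 : G n) (R + 4)
    · rw [indicator_of_mem hg, ← Measure.addHaar_closedBall ν (slab i j q g) hε.le]
      refine measure_mono fun y hy => ?_
      have h1 := hy.2.2
      rw [slab_sub, slab_slabSection hij] at h1
      rw [Metric.mem_closedBall, dist_eq_norm, norm_sub_rev]
      exact h1
    · rw [indicator_of_notMem hg]
      refine le_of_eq (measure_mono_null (t := ∅) (fun y hy => hg ?_) measure_empty)
      have h1 := hy.2.1
      have h2 := norm_slabSection_le (mem_closedBall_zero_iff.1 hy.1)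
      rw [mem_closedBall_zero_iff]
      have h3 := norm_le_norm_add_norm_sub' g (slabSection i j y)
      linarith

/-- If `q` is good for `g` at scale `ε`, every parameter within `ε` of `q` is good at scale `(1 + n
R) ε`. Slicing over the parameters costs `ε^d`, while each slab has volume `O(ε^(d+2))`; the
quotient is `O(ε²)`. -/
theorem measure_exists_slab_le {i j : Fin n} (hij : i ≠ j) {R : ℝ} (hR : 0 < R) :
    ∃ C : ℝ, 0 ≤ C ∧ ∀ ε, 0 < ε → ε ≤ 2 →
      μ {g | ‖g‖ ≤ R ∧ ∃ q : Param i j, ‖q‖ ≤ 1 ∧ ‖slab i j q g‖ ≤ ε} ≤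
        ENNReal.ofReal (C * ε ^ 2) := by
  set ρ : Measure (Param i j) := Measure.addHaar with hρ
  set d := Module.finrank ℝ (Param i j) with hd
  set V := μ (Metric.closedBall 0 (R + 4)) with hV
  have hVt : V ≠ ⊤ := (isCompact_closedBall _ _).measure_lt_top.ne
  have hdim : Module.finrank ℝ ((ℝ × ℝ) × Param i j) = d + 2 := by
    rw [Module.finrank_prod, Module.finrank_prod, Module.finrank_self, add_comm]
  refine ⟨(1 + n * R) ^ (d + 2) * 3 ^ d * V.toReal, by positivity, fun ε hε hε2 => ?_⟩
  set A : Set (G n) := {g | ‖g‖ ≤ R ∧ ∃ q : Param i j, ‖q‖ ≤ 1 ∧ ‖slab i j q g‖ ≤ ε} with hA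
  set ε' := (1 + n * R) * ε with hε'
  have hε'pos : 0 < ε' := by positivity
  set H : Set (G n × Param i j) :=
    {p | p.2 ∈ Metric.closedBall 0 3 ∧ ‖p.1‖ ≤ R ∧ ‖slab i j p.2 p.1‖ ≤ ε'} with hH
  have hHm : MeasurableSet H := by
    have h1 : Continuous fun p : G n × Param i j => slab i j p.2 p.1 :=
      (continuous_slab i j).comp continuous_swap
    refine IsClosed.measurableSet ((Metric.isClosed_closedBall.preimage continuous_snd).inter
      ((isClosed_le continuous_fst.norm continuous_const).inter
      (isClosed_le h1.norm continuous_const)))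
  have key := mul_measure_le_lintegral_of_slices (μ := μ) (ν := ρ) hHm
    (A := A) (c := ENNReal.ofReal (ε ^ d) * ρ (Metric.ball 0 1))
    (b := (Metric.closedBall 0 3).indicator fun _ => ENNReal.ofReal (ε' ^ (d + 2)) * V) ?_ ?_
  · rw [lintegral_indicator_const Metric.isClosed_closedBall.measurableSet,
      Measure.addHaar_closedBall ρ 0 (by norm_num : (0 : ℝ) ≤ 3), ← hd] at key
    have hb0 : ρ (Metric.ball 0 1) ≠ 0 := (Metric.measure_ball_pos ρ 0 one_pos).ne'
    have hbt : ρ (Metric.ball 0 1) ≠ ⊤ := measure_ball_lt_top.ne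
    have he0 : ENNReal.ofReal (ε ^ d) ≠ 0 := by simpa using pow_pos hε d
    rw [← ENNReal.mul_le_mul_iff_right he0 ENNReal.ofReal_ne_top,
      ← ENNReal.mul_le_mul_iff_left hb0 hbt]
    calc ENNReal.ofReal (ε ^ d) * μ A * ρ (Metric.ball 0 1)
        = ENNReal.ofReal (ε ^ d) * ρ (Metric.ball 0 1) * μ A := by ring
      _ ≤ _ := key
      _ = ENNReal.ofReal (ε' ^ (d + 2)) * ENNReal.ofReal V.toReal *
          (ENNReal.ofReal (3 ^ d) * ρ (Metric.ball 0 1)) := by rw [ENNReal.ofReal_toReal hVt]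
      _ = ENNReal.ofReal (ε' ^ (d + 2) * V.toReal * 3 ^ d) * ρ (Metric.ball 0 1) := by
          rw [ENNReal.ofReal_mul (by positivity), ENNReal.ofReal_mul (by positivity)]
          ring
      _ = _ := by
          rw [← ENNReal.ofReal_mul (by positivity), hε', mul_pow]
          congr 2
          ring
  · rintro g ⟨hgR, q, hq, hqg⟩
    rw [← Measure.addHaar_closedBall ρ q hε.le]
    refine measure_mono fun q' hq' => ?_
    rw [Metric.mem_closedBall, dist_eq_norm] at hq'
    refine ⟨?_, hgR, ?_⟩
    · rw [mem_closedBall_zero_iff]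
      linarith [norm_le_norm_add_norm_sub' q' q]
    · have h1 := norm_slab_sub_param_le q' q g
      have h2 := norm_le_norm_add_norm_sub' (slab i j q' g) (slab i j q g)
      have h3 : n * ‖q' - q‖ * ‖g‖ ≤ n * ε * R := by gcongr
      rw [hε']
      linarith
  · intro q
    by_cases hq : q ∈ Metric.closedBall (0 : Param i j) 3
    · rw [indicator_of_mem hq, ← hdim]
      exact (measure_mono fun g hg => hg.2).trans (measure_slab_le μ hij q R hε'pos)
    · rw [indicator_of_notMem hq]
      exact le_of_eq (measure_mono_null (t := ∅) (fun g hg => hq hg.1) measure_empty)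

theorem exists_measure_abnDist_le (hn : 2 ≤ n) {R : ℝ} (hR : 0 < R) :
    ∃ C : ℝ, 0 ≤ C ∧ ∀ ε, 0 < ε → ε ≤ 1 →
      μ {g | ‖g‖ ≤ R ∧ abnDist g ≤ ε} ≤ ENNReal.ofReal (C * ε ^ 2) := by
  have h : ∀ i j : Fin n, ∃ C : ℝ, 0 ≤ C ∧ ∀ ε, 0 < ε → ε ≤ 2 →
      μ {g | i ≠ j ∧ ‖g‖ ≤ R ∧ ∃ q : Param i j, ‖q‖ ≤ 1 ∧ ‖slab i j q g‖ ≤ ε} ≤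
        ENNReal.ofReal (C * ε ^ 2) := by
    intro i j
    by_cases hij : i = j
    · exact ⟨0, le_rfl, fun ε _ _ => by simp [hij]⟩
    · simp only [ne_eq, hij, not_false_eq_true, true_and]
      exact measure_exists_slab_le μ hij hR
  choose C hC0 hC using h
  refine ⟨(∑ i, ∑ j, C i j) * 4, mul_nonneg (Finset.sum_nonneg fun i _ =>
    Finset.sum_nonneg fun j _ => hC0 i j) (by norm_num), fun ε hε hε1 => ?_⟩
  calc μ {g | ‖g‖ ≤ R ∧ abnDist g ≤ ε}
      ≤ μ (⋃ i, ⋃ j, {g | i ≠ j ∧ ‖g‖ ≤ R ∧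
          ∃ q : Param i j, ‖q‖ ≤ 1 ∧ ‖slab i j q g‖ ≤ 2 * ε}) := by
        refine measure_mono fun g hg => ?_
        -- The strict bound `2 ε` avoids asking whether the infimum is attained, and explains the
        -- range `ε ≤ 2` in the previous estimate.
        obtain ⟨i, j, hij, q, hq, hlt⟩ := exists_slab_lt hn
          (show abnDist g < 2 * ε by linarith [hg.2])
        exact mem_iUnion₂.2 ⟨i, j, hij, hg.1, q, hq, hlt.le⟩
    _ ≤ ∑ i, ∑ j, ENNReal.ofReal (C i j * (2 * ε) ^ 2) := by
        refine (measure_iUnion_fintype_le _ _).trans (Finset.sum_le_sum fun i _ => ?_)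
        refine (measure_iUnion_fintype_le _ _).trans (Finset.sum_le_sum fun j _ => ?_)
        exact hC i j _ (by positivity) (by linarith)
    _ = ENNReal.ofReal ((∑ i, ∑ j, C i j) * 4 * ε ^ 2) := by
        have h1 : ∀ i j, 0 ≤ C i j * (2 * ε) ^ 2 := fun i j =>
          mul_nonneg (hC0 i j) (by positivity)
        simp_rw [← ENNReal.ofReal_sum_of_nonneg fun j _ => h1 _ j]
        rw [← ENNReal.ofReal_sum_of_nonneg fun i _ => Finset.sum_nonneg fun j _ => h1 i j]
        congr 1
        simp_rw [← Finset.sum_mul]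
        ring

theorem lintegral_inv_abnDist_lt_top (hn : 2 ≤ n) {R : ℝ} (hR : 0 < R) :
    ∫⁻ g in Metric.closedBall 0 R, (ENNReal.ofReal (abnDist g))⁻¹ ∂μ < ⊤ := by
  obtain ⟨C, hC0, hC⟩ := exists_measure_abnDist_le μ hn hR
  have : IsFiniteMeasure (μ.restrict (Metric.closedBall (0 : G n) R)) :=
    ⟨by simpa using (isCompact_closedBall (0 : G n) R).measure_lt_top⟩
  refine lintegral_inv_lt_top_of_measure_le_le (abnDist_continuous hn).measurable abnDist_nonneg
    hC0 fun ε hε hε1 => ?_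
  rw [Measure.restrict_apply' Metric.isClosed_closedBall.measurableSet]
  refine (measure_mono fun g hg => ?_).trans (hC ε hε hε1)
  exact ⟨mem_closedBall_zero_iff.1 hg.2, hg.1⟩

/-! ### Volume of the neighbourhoods of the sphere -/

theorem norm_dil_le {c : ℝ} (hc : 0 ≤ c) (hc2 : c ≤ 2) (g : G n) : ‖dil c g‖ ≤ 4 * ‖g‖ := by
  have h1 := norm_fst_le g
  have h2 := norm_snd_le g
  have h3 : c ^ 2 ≤ 4 := by nlinarith
  refine max_le ?_ ?_
  · rw [dil_fst, norm_smul, Real.norm_of_nonneg hc]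
    nlinarith [norm_nonneg g.1, norm_nonneg g]
  · rw [dil_snd, norm_smul, Real.norm_of_nonneg (by positivity)]
    nlinarith [norm_nonneg g.2, norm_nonneg g]

theorem norm_dil_le_of_le_one {c : ℝ} (hc : 0 ≤ c) (hc1 : c ≤ 1) (g : G n) : ‖dil c g‖ ≤ ‖g‖ := by
  have h1 := norm_fst_le g
  have h2 := norm_snd_le g
  have h3 : c ^ 2 ≤ 1 := by nlinarith
  refine max_le ?_ ?_
  · rw [dil_fst, norm_smul, Real.norm_of_nonneg hc]
    nlinarith [norm_nonneg g.1, norm_nonneg g]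
  · rw [dil_snd, norm_smul, Real.norm_of_nonneg (by positivity)]
    nlinarith [norm_nonneg g.2, norm_nonneg g]

/-- A dilation with `c ≥ 1` does not decrease volume: the image of the unit ball contains the unit
ball, so the determinant has absolute value at least one. -/
theorem measure_le_measure_preimage_dil {c : ℝ} (hc : 1 ≤ c) (X : Set (G n)) :
    μ X ≤ μ {g | dil c⁻¹ g ∈ X} := by
  have hc0 : 0 < c := by linarith
  have himg : ∀ Y : Set (G n), dil c '' Y = {g | dil c⁻¹ g ∈ Y} := by
    intro Y
    ext g
    constructor
    · rintro ⟨h, hh, rfl⟩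
      rw [mem_ofPred_eq, dil_dil, inv_mul_cancel₀ hc0.ne', dil_one_left]
      exact hh
    · intro hg
      exact ⟨_, hg, by rw [dil_dil, mul_inv_cancel₀ hc0.ne', dil_one_left]⟩
  have hball : Metric.ball (0 : G n) 1 ⊆ dil c '' Metric.ball 0 1 := by
    rw [himg]
    intro g hg
    rw [mem_ofPred_eq, mem_ball_zero_iff] at *
    exact (norm_dil_le_of_le_one (inv_nonneg.2 hc0.le) (inv_le_one_of_one_le₀ hc) g).trans_lt hg
  have h1 := measure_mono (μ := μ) hball
  rw [Measure.addHaar_image_continuousLinearMap] at h1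
  have hb0 : μ (Metric.ball 0 1) ≠ 0 := (Metric.measure_ball_pos μ 0 one_pos).ne'
  have hbt : μ (Metric.ball 0 1) ≠ ⊤ := measure_ball_lt_top.ne
  have h2 : 1 ≤ ENNReal.ofReal |(dil c : G n →L[ℝ] G n).det| := by
    rw [← ENNReal.mul_le_mul_iff_left hb0 hbt, one_mul]
    exact h1
  rw [← himg, Measure.addHaar_image_continuousLinearMap]
  exact le_mul_of_one_le_left' h2

/-- The shell is averaged over its dilates by `c ∈ [1, 2]`. By homogeneity, a point `g` is in the
dilate by `c` only if `c` is within `8 C s / abnDist g` of `F g`, an interval of length `16 C s /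
abnDist g`. Integrating in `g` leaves the finite integral of `1 / abnDist`. -/
theorem exists_measure_shell_le (hn : 2 ≤ n) (N : Seminorm ℝ (Fin n → ℝ)) {R C : ℝ} (hR : 0 < R)
    (hC : 0 < C) : ∃ C' : ℝ, 0 ≤ C' ∧ ∀ s, 0 < s →
      μ {g | ‖g‖ ≤ R ∧ abnDist g * |ccNorm N g - 1| ≤ C * s} ≤ ENNReal.ofReal (C' * s) := by
  have hI := lintegral_inv_abnDist_lt_top μ hn (show 0 < 4 * R by positivity)
  set I := ∫⁻ g in Metric.closedBall 0 (4 * R), (ENNReal.ofReal (abnDist g))⁻¹ ∂μ with hIdef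
  refine ⟨16 * C * I.toReal, by positivity, fun s hs => ?_⟩
  set X : Set (G n) := {g | ‖g‖ ≤ R ∧ abnDist g * |ccNorm N g - 1| ≤ C * s} with hX
  have hXm : MeasurableSet X := by
    refine IsClosed.measurableSet ((isClosed_le continuous_norm continuous_const).inter
      (isClosed_le ((abnDist_continuous hn).mul ?_) continuous_const))
    exact ((ccNorm_continuous N).sub continuous_const).abs
  set H : Set (ℝ × G n) := {p | p.1 ∈ Icc (1 : ℝ) 2 ∧ dil p.1⁻¹ p.2 ∈ X} with hH
  have hHm : MeasurableSet H := by
    have h1 : Measurable fun p : ℝ × G n => dil p.1⁻¹ p.2 := by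
      have : (fun p : ℝ × G n => dil p.1⁻¹ p.2) =
          fun p => (p.1⁻¹ • p.2.1, (p.1⁻¹) ^ 2 • p.2.2) := rfl
      rw [this]
      fun_prop
    exact (measurable_fst measurableSet_Icc).inter (h1 hXm)
  have key := mul_measure_le_lintegral_of_slices (μ := (volume : Measure ℝ)) (ν := μ) hHm
    (A := Icc (1 : ℝ) 2) (c := μ X)
    (b := (Metric.closedBall 0 (4 * R)).indicator fun g =>
      ENNReal.ofReal (16 * C * s) * (ENNReal.ofReal (abnDist g))⁻¹) ?_ ?_
  · rw [lintegral_indicator Metric.isClosed_closedBall.measurableSet,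
      lintegral_const_mul' _ _ ENNReal.ofReal_ne_top, ← hIdef, Real.volume_Icc] at key
    norm_num at key
    refine key.trans (le_of_eq ?_)
    rw [← ENNReal.ofReal_toReal hI.ne, ← ENNReal.ofReal_mul (by positivity),
      ENNReal.toReal_ofReal ENNReal.toReal_nonneg]
    congr 1
    ring
  · intro c hc
    refine (measure_le_measure_preimage_dil μ hc.1 X).trans (measure_mono fun g hg => ?_)
    exact ⟨hc, hg⟩
  · intro g
    have hslice : ∀ c, (c, g) ∈ H → g ∈ Metric.closedBall (0 : G n) (4 * R) ∧
        abnDist g * |c - ccNorm N g| ≤ 8 * (C * s) := by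
      rintro c ⟨hc, hcR, hcX⟩
      simp only at hc hcR hcX
      have hc0 : 0 < c := by linarith [hc.1]
      have hg : dil c (dil c⁻¹ g) = g := by
        rw [dil_dil, mul_inv_cancel₀ hc0.ne', dil_one_left]
      set h := dil c⁻¹ g with hh
      have h1 := norm_dil_le hc0.le hc.2 h
      have h2 := abnDist_dil_le hn hc.1 hc.2 h
      have h3 := ccNorm_dil N hc0 h
      rw [hg] at h1 h2 h3
      refine ⟨?_, ?_⟩
      · rw [mem_closedBall_zero_iff]
        linarith
      · have h4 : |c - ccNorm N g| = c * |ccNorm N h - 1| := by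
          rw [h3, ← abs_of_pos hc0, ← abs_mul, abs_of_pos hc0, abs_sub_comm]
          congr 1
          ring
        rw [h4]
        calc abnDist g * (c * |ccNorm N h - 1|)
            ≤ (4 * abnDist h) * (2 * |ccNorm N h - 1|) := by
              gcongr
              · exact mul_nonneg (by norm_num) (abnDist_nonneg h)
              · exact hc.2
          _ = 8 * (abnDist h * |ccNorm N h - 1|) := by ring
          _ ≤ 8 * (C * s) := by gcongr
    by_cases hg : g ∈ Metric.closedBall (0 : G n) (4 * R)
    · rw [indicator_of_mem hg]
      rcases (abnDist_nonneg g).eq_or_lt with h0 | h0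
      · rw [← h0, ENNReal.ofReal_zero, ENNReal.inv_zero, ENNReal.mul_top]
        · exact le_top
        · simpa using by positivity
      · calc volume {c | (c, g) ∈ H}
            ≤ volume (Metric.closedBall (ccNorm N g) (8 * (C * s) / abnDist g)) := by
              refine measure_mono fun c hc => ?_
              rw [Metric.mem_closedBall, Real.dist_eq, le_div_iff₀ h0, mul_comm]
              exact (hslice c hc).2
          _ = ENNReal.ofReal (16 * C * s) * (ENNReal.ofReal (abnDist g))⁻¹ := by
              rw [Real.volume_closedBall, ← ENNReal.ofReal_inv_of_pos h0,
                ← ENNReal.ofReal_mul (by positivity)]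
              congr 1
              ring
    · rw [indicator_of_notMem hg]
      exact le_of_eq (measure_mono_null (t := ∅) (fun c hc => hg (hslice c hc).1) measure_empty)

end Volume

end FreeCarnotStepTwo

/-- A linear map that is bi-Lipschitz on a compact set has a Lipschitz inverse on its image. -/
theorem exists_lipschitz_inverse {E F : Type*} [NormedAddCommGroup E] [NormedSpace ℝ E]
    [NormedAddCommGroup F] [NormedSpace ℝ F] [MeasurableSpace F] [BorelSpace F] {X : Set E}
    (hX : IsCompact X) (p : E →L[ℝ] F) {K : ℝ} (hK : 0 ≤ K)
    (h : ∀ x ∈ X, ∀ y ∈ X, ‖x - y‖ ≤ K * ‖p (x - y)‖) :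
    ∃ (A : Set F) (f : F → E), MeasurableSet A ∧ LipschitzOnWith K.toNNReal f A ∧ f '' A = X := by
  have hleft : ∀ x ∈ X, Function.invFunOn p X (p x) = x := fun x hx => by
    have hmem : p x ∈ p '' X := mem_image_of_mem _ hx
    have h1 := h _ (Function.invFunOn_mem hmem) _ hx
    rw [map_sub, Function.invFunOn_eq hmem, sub_self, norm_zero, mul_zero] at h1
    exact sub_eq_zero.1 (norm_le_zero_iff.1 h1)
  refine ⟨p '' X, Function.invFunOn p X, (hX.image p.continuous).isClosed.measurableSet, ?_, ?_⟩
  · refine LipschitzOnWith.of_dist_le_mul ?_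
    rintro _ ⟨x, hx, rfl⟩ _ ⟨y, hy, rfl⟩
    rw [hleft x hx, hleft y hy, dist_eq_norm, dist_eq_norm, ← map_sub, Real.coe_toNNReal _ hK]
    exact h x hx y hy
  · ext x
    constructor
    · rintro ⟨_, ⟨y, hy, rfl⟩, rfl⟩
      rwa [hleft y hy]
    · intro hx
      exact ⟨p x, mem_image_of_mem _ hx, hleft x hx⟩

/-- The projection along `e` onto the kernel of `ψ`, in Euclidean coordinates. -/
theorem exists_norm_sub_smul_le {E : Type*} [NormedAddCommGroup E] [NormedSpace ℝ E]
    [FiniteDimensional ℝ E] (ψ : E →L[ℝ] ℝ) {e : E} (he : ψ e = 1) :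
    ∃ (p : E →L[ℝ] EuclideanSpace ℝ (Fin (Module.finrank ℝ E - 1))) (K : ℝ), 0 ≤ K ∧
      ∀ v, ‖v - ψ v • e‖ ≤ K * ‖p v‖ := by
  obtain ⟨W, hfin, hW⟩ : ∃ W : Submodule ℝ E, Module.finrank ℝ W = Module.finrank ℝ E - 1 ∧
      ∀ v, (ContinuousLinearMap.id ℝ E - ψ.smulRight e) v ∈ W := by
    refine ⟨LinearMap.ker (ψ : E →ₗ[ℝ] ℝ), ?_, fun v => ?_⟩
    · have h1 := LinearMap.finrank_range_add_finrank_ker (ψ : E →ₗ[ℝ] ℝ)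
      have h2 : LinearMap.range (ψ : E →ₗ[ℝ] ℝ) = ⊤ :=
        LinearMap.range_eq_top.2 fun t => ⟨t • e, by simp [he]⟩
      rw [h2, finrank_top, Module.finrank_self] at h1
      omega
    · simp [he]
  let q : E →L[ℝ] W := (ContinuousLinearMap.id ℝ E - ψ.smulRight e).codRestrict W hW
  let c : W ≃L[ℝ] EuclideanSpace ℝ (Fin (Module.finrank ℝ E - 1)) :=
    ContinuousLinearEquiv.ofFinrankEq (by rw [hfin, finrank_euclideanSpace_fin])
  let b : EuclideanSpace ℝ (Fin (Module.finrank ℝ E - 1)) →L[ℝ] W := c.symm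
  refine ⟨c.toContinuousLinearMap.comp q, ‖b‖, b.opNorm_nonneg, fun v => ?_⟩
  have h1 : ‖b (c (q v))‖ ≤ _ := b.le_opNorm _
  rw [show b (c (q v)) = q v from c.symm_apply_apply _] at h1
  exact h1

/-! ### The unit sphere: finite measure, negligible abnormal part, Lipschitz charts. -/

namespace FreeCarnotStepTwo

variable {n : ℕ} {N : Seminorm ℝ (Fin n → ℝ)}

theorem isBounded_ccSphere (hN : ∀ v, N v = 0 → v = 0) :
    ∃ R > 0, ∀ g ∈ ccSphere N, ‖g‖ ≤ R := by
  obtain ⟨c, hc, hcN⟩ := exists_norm_le hN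
  refine ⟨c * 2 + c * 2 * c * 2, by positivity, fun g hg => ?_⟩
  have h1 : ccDist N 1 g < ENNReal.ofReal 2 := by
    rw [ccDist_comm, show ccDist N g 1 = 1 from hg]
    norm_num
  obtain ⟨γ, hγ, h0, rfl, hlen⟩ := exists_curve N h1
  have h2 := norm_curve_fst_le hc hcN zero_le_two hγ h0 hlen.le (right_mem_Icc.2 zero_le_one)
  have h3 := norm_curve_snd_le hc hcN zero_le_two hγ h0 hlen.le (right_mem_Icc.2 zero_le_one)
  refine max_le (h2.trans ?_) (h3.trans ?_)
  · exact le_add_of_nonneg_right (by positivity)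
  · exact le_add_of_nonneg_left (by positivity)

theorem isClosed_ccSphere : IsClosed (ccSphere N) := by
  have : ccSphere N = {g | ccNorm N g = 1} := ext fun g => mem_ccSphere_iff
  rw [this]
  exact isClosed_eq (ccNorm_continuous N) continuous_const

theorem isCompact_ccSphere (hN : ∀ v, N v = 0 → v = 0) : IsCompact (ccSphere N) := by
  obtain ⟨R, -, hR⟩ := isBounded_ccSphere hN
  exact Metric.isCompact_of_isClosed_isBounded isClosed_ccSphere
    (isBounded_iff_forall_norm_le.2 ⟨R, hR⟩)

theorem one_le_finrank (hn : 2 ≤ n) : 1 ≤ Module.finrank ℝ (G n) := by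
  rw [Module.finrank_prod, Module.finrank_fin_fun]
  omega

theorem norm_le_of_mem_thickening {X : Set (G n)} {R s : ℝ} (hR : ∀ g ∈ X, ‖g‖ ≤ R) (hs : s ≤ 1)
    {g : G n} (hg : g ∈ Metric.thickening s X) : ∃ h ∈ X, ‖g - h‖ ≤ s ∧ ‖g‖ ≤ R + 1 := by
  obtain ⟨h, hh, hd⟩ := Metric.mem_thickening_iff.1 hg
  rw [dist_eq_norm] at hd
  refine ⟨h, hh, hd.le, ?_⟩
  linarith [norm_sub_norm_le g h, hR h hh]

/-- The weighted Lipschitz estimate, with the weight at the neighbouring point and not at the point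
of the sphere, puts the `s`-neighbourhood of the sphere inside the shell. -/
theorem hausdorffMeasure_ccSphere_lt_top (hn : 2 ≤ n) (hN : ∀ v, N v = 0 → v = 0) :
    Measure.hausdorffMeasure ((Module.finrank ℝ (G n) - 1 : ℕ) : ℝ) (ccSphere N) < ⊤ := by
  obtain ⟨R, hR, hRS⟩ := isBounded_ccSphere hN
  have hR1 : 0 < R + 1 := by linarith
  obtain ⟨C, hC, hCN⟩ := exists_abnDist_mul_le hn hN hR1
  set μ : Measure (G n) := Measure.addHaar
  obtain ⟨C', hC', hshell⟩ := exists_measure_shell_le μ hn N hR1 hC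
  refine (hausdorffMeasure_le_of_measure_thickening_le μ (one_le_finrank hn) (C := C')
    one_pos fun s hs hs1 => ?_).trans_lt ?_
  · refine (measure_mono fun g hg => ?_).trans (hshell s hs)
    obtain ⟨h, hh, hgh, hg1⟩ := norm_le_of_mem_thickening hRS hs1 hg
    refine ⟨hg1, ?_⟩
    rw [← mem_ccSphere_iff.1 hh]
    exact (hCN g h hg1 (by linarith [hRS h hh])).trans (by gcongr)
  · exact ENNReal.div_lt_top ENNReal.ofReal_ne_top (Metric.measure_ball_pos μ 0 one_pos).ne'

/-- The `s`-neighbourhood has volume `O(s²)`, which for `s ≤ s₀` is a Minkowski bound with constant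
proportional to `s₀`; then `s₀` tends to zero. -/
theorem hausdorffMeasure_abnDist_eq_zero (hn : 2 ≤ n) {X : Set (G n)} {R : ℝ} (hR : 0 < R)
    (hX : ∀ g ∈ X, ‖g‖ ≤ R) (h0 : ∀ g ∈ X, abnDist g = 0) :
    Measure.hausdorffMeasure ((Module.finrank ℝ (G n) - 1 : ℕ) : ℝ) X = 0 := by
  have hn0 : (0 : ℝ) < n := by exact_mod_cast (by omega : 0 < n)
  set μ : Measure (G n) := Measure.addHaar
  obtain ⟨C, hC, hCμ⟩ := exists_measure_abnDist_le μ hn (show 0 < R + 1 by linarith)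
  set b := μ (Metric.ball 0 1)
  have hb : b ≠ 0 := (Metric.measure_ball_pos μ 0 one_pos).ne'
  set d := Module.finrank ℝ (G n) - 1
  have key : ∀ᶠ s₀ : ℝ in nhdsWithin 0 (Ioi 0), Measure.hausdorffMeasure (d : ℝ) X ≤
      ENNReal.ofReal (C * n ^ 2 * s₀ * (2 * 4 ^ d)) / b := by
    have h1 : ∀ᶠ s₀ : ℝ in nhdsWithin 0 (Ioi 0), s₀ < min 1 (1 / (n : ℝ)) :=
      nhdsWithin_le_nhds (Iio_mem_nhds (lt_min one_pos (one_div_pos.2 hn0)))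
    filter_upwards [h1, self_mem_nhdsWithin] with s₀ hs₀ hpos
    refine hausdorffMeasure_le_of_measure_thickening_le μ (one_le_finrank hn) hpos
      fun s hs hss => ?_
    have hs1 : s ≤ 1 := hss.trans (hs₀.le.trans (min_le_left _ _))
    have hs2 : n * s ≤ 1 := by
      have := hss.trans (hs₀.le.trans (min_le_right _ _))
      rwa [le_div_iff₀ hn0, mul_comm] at this
    refine (measure_mono fun g hg => ?_).trans ((hCμ (n * s) (by positivity) hs2).trans
      (ENNReal.ofReal_le_ofReal ?_))
    · obtain ⟨h, hh, hgh, hg1⟩ := norm_le_of_mem_thickening hX hs1 hg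
      refine ⟨hg1, ?_⟩
      have h2 := (abs_le.1 (abs_abnDist_sub_le hn g h)).2
      rw [h0 h hh, sub_zero] at h2
      exact h2.trans (by gcongr)
    · calc C * (n * s) ^ 2 = C * n ^ 2 * s * s := by ring
        _ ≤ C * n ^ 2 * s₀ * s := by gcongr
  have hlim : Filter.Tendsto (fun s₀ : ℝ => ENNReal.ofReal (C * n ^ 2 * s₀ * (2 * 4 ^ d)) / b)
      (nhdsWithin 0 (Ioi 0)) (nhds 0) := by
    have h1 : Filter.Tendsto (fun s₀ : ℝ => ENNReal.ofReal (C * n ^ 2 * s₀ * (2 * 4 ^ d)))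
        (nhds 0) (nhds 0) := by
      have : Continuous fun s₀ : ℝ => ENNReal.ofReal (C * n ^ 2 * s₀ * (2 * 4 ^ d)) :=
        ENNReal.continuous_ofReal.comp (by fun_prop)
      simpa using this.tendsto 0
    have h2 := ENNReal.Tendsto.div_const h1 (b := b) (Or.inr hb)
    rw [ENNReal.zero_div] at h2
    exact h2.mono_left nhdsWithin_le_nhds
  exact le_antisymm (ge_of_tendsto hlim key) bot_le

/-- The value at `g` of the generator of the dilations. -/
def eulerField (g : G n) : G n := (g.1, (2 : ℝ) • g.2)

theorem norm_eulerField_sub_le (g h : G n) : ‖eulerField g - eulerField h‖ ≤ 2 * ‖g - h‖ := by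
  have h1 := norm_fst_le (g - h)
  have h2 := norm_snd_le (g - h)
  refine max_le ?_ ?_
  · change ‖(g - h).1‖ ≤ _
    linarith [norm_nonneg (g - h)]
  · have h3 : (eulerField g - eulerField h).2 = (2 : ℝ) • (g - h).2 := (smul_sub _ _ _).symm
    rw [h3, norm_smul, Real.norm_ofNat]
    exact mul_le_mul_of_nonneg_left h2 zero_le_two

theorem dil_one_add (c : ℝ) (g : G n) :
    dil (1 + c) g = g + c • eulerField g + c ^ 2 • ((0, g.2) : G n) := by
  refine Prod.ext ?_ ?_
  · simp [eulerField, add_smul]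
  · simp only [dil_snd, eulerField, Prod.snd_add, Prod.smul_snd]
    module

theorem eulerField_ne_zero {g : G n} (hg : g ∈ ccSphere N) : eulerField g ≠ 0 := by
  intro h
  have h1 : g = 1 := by
    rw [Prod.ext_iff] at h
    exact Prod.ext h.1 ((smul_eq_zero.1 h.2).resolve_left two_ne_zero)
  rw [ccSphere, mem_ofPred_eq, h1, ccDist_self] at hg
  exact zero_ne_one hg

/-- Near a point off the abnormal set, the sphere is transverse to the dilations. -/
theorem exists_norm_sub_le_of_transverse (hn : 2 ≤ n) (hN : ∀ v, N v = 0 → v = 0) {g₀ : G n}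
    (h0 : 0 < abnDist g₀) (ψ : G n →L[ℝ] ℝ) :
    ∃ r > 0, ∃ K ≥ 0, ∀ g ∈ ccSphere N ∩ Metric.closedBall g₀ r,
      ∀ h ∈ ccSphere N ∩ Metric.closedBall g₀ r,
        ‖g - h‖ ≤ K * ‖g - h - ψ (g - h) • eulerField g₀‖ := by
  have hn0 : (0 : ℝ) < n := by exact_mod_cast (by omega : 0 < n)
  set B := ‖g₀‖ + 1 with hB
  have hB0 : 0 < B := by positivity
  obtain ⟨C, hC, hCN⟩ := exists_abnDist_mul_le hn hN (show 0 < 4 * B by positivity)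
  set δ := abnDist g₀ / 2 with hδ
  have hδ0 : 0 < δ := by positivity
  -- Every smallness condition on `r` asks that `r` times one of these terms be at most `1` or `δ /
  -- 2`.
  set D := 1 + n + 2 * ‖ψ‖ + 2 * (C * (1 + ‖ψ‖ * B)) with hD
  have hD0 : 0 < D := by positivity
  set r := min 1 (δ / 2) / D with hr
  have hr0 : 0 < r := by positivity
  have hrD : r * D = min 1 (δ / 2) := div_mul_cancel₀ _ hD0.ne'
  have e1 : 0 ≤ r * n := by positivity
  have e2 : 0 ≤ r * (2 * ‖ψ‖) := by positivity
  have e3 : 0 ≤ r * (2 * (C * (1 + ‖ψ‖ * B))) := by positivity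
  have e4 : r * D = r + r * n + r * (2 * ‖ψ‖) + r * (2 * (C * (1 + ‖ψ‖ * B))) := by
    rw [hD]
    ring
  have e5 := min_le_left 1 (δ / 2)
  have e6 := min_le_right 1 (δ / 2)
  have hball : ∀ g ∈ Metric.closedBall g₀ r, ‖g - g₀‖ ≤ r ∧ ‖g‖ ≤ B ∧ δ ≤ abnDist g := by
    intro g hg
    rw [mem_closedBall_iff_norm] at hg
    refine ⟨hg, ?_, ?_⟩
    · linarith [norm_sub_norm_le g g₀]
    · have h1 := (abs_le.1 (abs_abnDist_sub_le hn g g₀)).1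
      have h2 : n * ‖g - g₀‖ ≤ r * n := by
        rw [mul_comm]
        gcongr
      linarith
  -- Compare `h` with the dilate of `g` by `1 + c`, `c = ψ (h - g)`: their values of `F` differ by
  -- exactly `c`, so `δ c ≤ C ‖h - dil (1 + c) g‖`. This vector is `w` up to an error `O(r c)`,
  -- absorbed by the left side. The sign of `c` is fixed so that the factor is in `[1, 2]`.
  have hstep : ∀ g ∈ ccSphere N ∩ Metric.closedBall g₀ r,
      ∀ h ∈ ccSphere N ∩ Metric.closedBall g₀ r, 0 ≤ ψ (h - g) →
        ψ (h - g) ≤ 2 * C / δ * ‖h - g - ψ (h - g) • eulerField g₀‖ := by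
    rintro g ⟨hgS, hg⟩ h ⟨hhS, hh⟩ hc
    obtain ⟨hg1, hg2, hg3⟩ := hball g hg
    obtain ⟨hh1, hh2, hh3⟩ := hball h hh
    set c := ψ (h - g) with hcdef
    set w := h - g - c • eulerField g₀ with hw
    have hcr : c ≤ r * (2 * ‖ψ‖) := by
      have h1 := (le_abs_self _).trans (ψ.le_opNorm (h - g))
      have h2 : ‖h - g‖ ≤ 2 * r := by
        have := norm_sub_le_norm_sub_add_norm_sub h g₀ g
        rw [norm_sub_rev g₀] at this
        linarith
      calc c ≤ ‖ψ‖ * ‖h - g‖ := h1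
        _ ≤ ‖ψ‖ * (2 * r) := by gcongr
        _ = _ := by ring
    have hdiff : h - dil (1 + c) g =
        w + c • (eulerField g₀ - eulerField g) - c ^ 2 • ((0, g.2) : G n) := by
      rw [dil_one_add, hw]
      module
    have hg0 : ‖((0, g.2) : G n)‖ ≤ B := by
      refine max_le ?_ ((norm_snd_le g).trans hg2)
      rw [norm_zero]
      exact hB0.le
    have hnorm : ‖h - dil (1 + c) g‖ ≤ ‖w‖ + c * (2 * r) + c * (r * (2 * ‖ψ‖)) * B := by
      rw [hdiff]
      refine (norm_sub_le _ _).trans (add_le_add ((norm_add_le _ _).trans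
        (add_le_add le_rfl ?_)) ?_)
      · rw [norm_smul, Real.norm_of_nonneg hc]
        gcongr
        refine (norm_eulerField_sub_le _ _).trans ?_
        rw [norm_sub_rev]
        gcongr
      · rw [norm_smul, Real.norm_of_nonneg (sq_nonneg c), sq]
        gcongr
    have hmain := hCN h (dil (1 + c) g) (by linarith)
      ((norm_dil_le (by linarith) (by linarith) g).trans (by gcongr))
    rw [ccNorm_dil N (by linarith), mem_ccSphere_iff.1 hgS, mem_ccSphere_iff.1 hhS,
      show |(1 : ℝ) - (1 + c) * 1| = c by rw [abs_sub_comm, mul_one, add_sub_cancel_left,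
        abs_of_nonneg hc]] at hmain
    have h5 : δ * c ≤ C * ‖w‖ + c * (r * (2 * (C * (1 + ‖ψ‖ * B)))) := by
      calc δ * c ≤ abnDist h * c := by gcongr
        _ ≤ C * ‖h - dil (1 + c) g‖ := hmain
        _ ≤ C * (‖w‖ + c * (2 * r) + c * (r * (2 * ‖ψ‖)) * B) := by gcongr
        _ = _ := by ring
    have h6 : c * (r * (2 * (C * (1 + ‖ψ‖ * B)))) ≤ c * (δ / 2) := by
      gcongr
      linarith
    rw [div_mul_eq_mul_div, le_div_iff₀ hδ0]
    linarith
  refine ⟨r, hr0, 1 + 2 * C / δ * ‖eulerField g₀‖, by positivity, fun g hg h hh => ?_⟩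
  set w := g - h - ψ (g - h) • eulerField g₀ with hw
  have habs : |ψ (g - h)| ≤ 2 * C / δ * ‖w‖ := by
    rcases le_total 0 (ψ (g - h)) with hc | hc
    · rw [abs_of_nonneg hc]
      exact hstep h hh g hg hc
    · have h1 : ψ (h - g) = -ψ (g - h) := by rw [← neg_sub, map_neg]
      have h2 : h - g - ψ (h - g) • eulerField g₀ = -w := by
        rw [h1, hw]
        module
      have h3 := hstep g hg h hh (by rw [h1]; linarith)
      rw [h2, norm_neg, h1] at h3
      rwa [abs_of_nonpos hc]
  calc ‖g - h‖ = ‖w + ψ (g - h) • eulerField g₀‖ := by rw [hw, sub_add_cancel]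
    _ ≤ ‖w‖ + |ψ (g - h)| * ‖eulerField g₀‖ := by
        refine (norm_add_le _ _).trans ?_
        rw [norm_smul, Real.norm_eq_abs]
    _ ≤ ‖w‖ + 2 * C / δ * ‖w‖ * ‖eulerField g₀‖ := by gcongr
    _ = _ := by ring

/-- With `ψ` equal to one on the dilation vector at `g₀`, the projection along that vector is
bi-Lipschitz on the sphere near `g₀`; its inverse is the parametrization. -/
theorem exists_lipschitz_parametrization (hn : 2 ≤ n) (hN : ∀ v, N v = 0 → v = 0) {g₀ : G n}
    (hg₀ : g₀ ∈ ccSphere N) (h0 : 0 < abnDist g₀) :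
    ∃ r > 0, ∃ (A : Set (EuclideanSpace ℝ (Fin (Module.finrank ℝ (G n) - 1))))
      (f : EuclideanSpace ℝ (Fin (Module.finrank ℝ (G n) - 1)) → G n),
      MeasurableSet A ∧ (∃ K, LipschitzOnWith K f A) ∧
        f '' A = ccSphere N ∩ Metric.closedBall g₀ r := by
  obtain ⟨ψ, hψ⟩ := SeparatingDual.exists_eq_one (R := ℝ) (eulerField_ne_zero hg₀)
  obtain ⟨r, hr, K, hK, h⟩ := exists_norm_sub_le_of_transverse hn hN h0 ψ
  refine ⟨r, hr, ?_⟩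
  obtain ⟨p, L, hL, hp⟩ := exists_norm_sub_smul_le ψ hψ
  obtain ⟨A, f, hA, hf, hfA⟩ := exists_lipschitz_inverse
    ((isCompact_ccSphere hN).inter_right Metric.isClosed_closedBall (t := Metric.closedBall g₀ r))
    p (K := K * L) (by positivity) fun g hg k hk => by
      refine (h g hg k hk).trans ?_
      rw [mul_assoc]
      exact mul_le_mul_of_nonneg_left (hp _) hK
  exact ⟨A, f, hA, ⟨_, hf⟩, hfA⟩

theorem exists_countable_lipschitz_cover (hn : 2 ≤ n) (hN : ∀ v, N v = 0 → v = 0) :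
    ∃ (A : ℕ → Set (EuclideanSpace ℝ (Fin (Module.finrank ℝ (G n) - 1))))
      (f : ℕ → EuclideanSpace ℝ (Fin (Module.finrank ℝ (G n) - 1)) → G n),
      (∀ i, MeasurableSet (A i)) ∧ (∀ i, ∃ K, LipschitzOnWith K (f i) (A i)) ∧
      (∀ i, MapsTo (f i) (A i) (ccSphere N)) ∧
      Measure.hausdorffMeasure ((Module.finrank ℝ (G n) - 1 : ℕ) : ℝ)
        (ccSphere N \ ⋃ i, f i '' A i) = 0 := by
  set S' : Set (G n) := {g | g ∈ ccSphere N ∧ 0 < abnDist g} with hS'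
  choose! r hr A f hA hf hfA using fun g (hg : g ∈ S') =>
    exists_lipschitz_parametrization hn hN hg.1 hg.2
  -- Lindelöf: countably many charts cover the points with positive `abnDist`, and the rest of the
  -- sphere is null.
  obtain ⟨T, hTS, hTc, hT⟩ := TopologicalSpace.countable_cover_nhdsWithin
    (s := S') (f := fun g => Metric.closedBall g (r g))
    fun g hg => mem_nhdsWithin_of_mem_nhds (Metric.closedBall_mem_nhds g (hr g hg))
  obtain ⟨R, hR, hRS⟩ := isBounded_ccSphere hN
  have hzero : ∀ U : Set (G n), S' ⊆ U →
      Measure.hausdorffMeasure ((Module.finrank ℝ (G n) - 1 : ℕ) : ℝ) (ccSphere N \ U) = 0 := by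
    intro U hU
    refine hausdorffMeasure_abnDist_eq_zero hn hR (fun g hg => hRS g hg.1) fun g hg => ?_
    by_contra h
    exact hg.2 (hU ⟨hg.1, lt_of_le_of_ne (abnDist_nonneg g) (Ne.symm h)⟩)
  rcases T.eq_empty_or_nonempty with rfl | hne
  · refine ⟨fun _ => ∅, fun _ _ => 0, by simp, fun _ => ⟨0, by simp⟩,
      fun _ => mapsTo_empty _ _, hzero _ ?_⟩
    simpa using hT
  · obtain ⟨u, rfl⟩ := hTc.exists_eq_range hne
    have hu : ∀ i, u i ∈ S' := fun i => hTS (mem_range_self i)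
    refine ⟨fun i => A (u i), fun i => f (u i), fun i => hA _ (hu i), fun i => hf _ (hu i),
      fun i x hx => ?_, hzero _ fun g hg => ?_⟩
    · have : f (u i) x ∈ f (u i) '' A (u i) := mem_image_of_mem _ hx
      rw [hfA _ (hu i)] at this
      exact this.1
    · obtain ⟨_, ⟨i, rfl⟩, hi⟩ := mem_iUnion₂.1 (hT hg)
      refine mem_iUnion.2 ⟨i, ?_⟩
      rw [hfA _ (hu i)]
      exact ⟨hg.1, hi⟩

end FreeCarnotStepTwo

/-! ### Comparison of a Riemannian distance with the norm on compact sets. -/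

section VectorSpace

variable {E : Type*} [NormedAddCommGroup E] [NormedSpace ℝ E]
  [RiemannianBundle (fun x : E => TangentSpace 𝓘(ℝ, E) x)]
  [IsContinuousRiemannianBundle E (fun x : E => TangentSpace 𝓘(ℝ, E) x)]

theorem eventually_enorm_tangentSpace_le (x : E) :
    ∃ C : ℝ≥0, ∀ᶠ y in nhds x, ∀ v : E, ‖(show TangentSpace 𝓘(ℝ, E) y from v)‖ₑ ≤ C * ‖v‖ₑ := by
  obtain ⟨C, hC, h⟩ := eventually_norm_symmL_trivializationAt_lt E
    (fun x : E => TangentSpace 𝓘(ℝ, E) x) x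
  refine ⟨C.toNNReal, h.mono fun y hy v => ?_⟩
  have h1 := ((trivializationAt E (fun x : E => TangentSpace 𝓘(ℝ, E) x) x).symmL ℝ y).le_opNorm v
  have h2 : (trivializationAt E (fun x : E => TangentSpace 𝓘(ℝ, E) x) x).symmL ℝ y v =
      (show TangentSpace 𝓘(ℝ, E) y from v) := by
    rw [TangentBundle.symmL_model_space]
    rfl
  rw [h2] at h1
  have h3 : ‖(show TangentSpace 𝓘(ℝ, E) y from v)‖₊ ≤ C.toNNReal * ‖v‖₊ := by
    rw [← NNReal.coe_le_coe, NNReal.coe_mul, Real.coe_toNNReal _ hC.le]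
    exact h1.trans (mul_le_mul_of_nonneg_right hy.le (norm_nonneg _))
  rw [enorm_eq_nnnorm, enorm_eq_nnnorm]
  exact_mod_cast h3

theorem IsCompact.exists_enorm_tangentSpace_le {X : Set E} (hX : IsCompact X) :
    ∃ C : ℝ≥0, ∀ y ∈ X, ∀ v : E, ‖(show TangentSpace 𝓘(ℝ, E) y from v)‖ₑ ≤ C * ‖v‖ₑ := by
  refine hX.induction_on (p := fun X => ∃ C : ℝ≥0, ∀ y ∈ X, ∀ v : E,
    ‖(show TangentSpace 𝓘(ℝ, E) y from v)‖ₑ ≤ C * ‖v‖ₑ) ⟨0, by simp⟩ ?_ ?_ ?_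
  · rintro s t hst ⟨C, hC⟩
    exact ⟨C, fun y hy => hC y (hst hy)⟩
  · rintro s t ⟨C, hC⟩ ⟨C', hC'⟩
    refine ⟨max C C', fun y hy v => ?_⟩
    rcases hy with hy | hy
    · exact (hC y hy v).trans (by gcongr; exact le_max_left _ _)
    · exact (hC' y hy v).trans (by gcongr; exact le_max_right _ _)
  · intro x _
    obtain ⟨C, hC⟩ := eventually_enorm_tangentSpace_le x
    exact ⟨_, mem_nhdsWithin_of_mem_nhds hC, C, fun y hy => hy⟩

/-- Convexity keeps the segment from `x` to `y` inside the compact set, where the Riemannian norm is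
at most `C` times the given one. -/
theorem IsCompact.exists_riemannianEDist_le {X : Set E} (hX : IsCompact X) (hconv : Convex ℝ X) :
    ∃ C : ℝ≥0, ∀ x ∈ X, ∀ y ∈ X, Manifold.riemannianEDist 𝓘(ℝ, E) x y ≤ C * edist x y := by
  obtain ⟨C, hC⟩ := hX.exists_enorm_tangentSpace_le
  refine ⟨C, fun x hx y hy => ?_⟩
  let γ := ContinuousAffineMap.lineMap (R := ℝ) x y
  have h1 : Manifold.riemannianEDist 𝓘(ℝ, E) x y ≤ Manifold.pathELength 𝓘(ℝ, E) γ 0 1 := by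
    apply Manifold.riemannianEDist_le_pathELength ?_
      (by simp [γ, ContinuousAffineMap.coe_lineMap_eq])
      (by simp [γ, ContinuousAffineMap.coe_lineMap_eq]) zero_le_one
    rw [contMDiffOn_iff_contDiffOn]
    exact γ.contDiff.contDiffOn
  refine h1.trans ?_
  rw [Manifold.pathELength_eq_lintegral_mfderivWithin_Icc, ← lintegral_fderiv_lineMap_eq_edist,
    ← lintegral_const_mul' _ _ ENNReal.coe_ne_top]
  refine setLIntegral_mono' measurableSet_Icc fun t ht => ?_
  simp only [mfderivWithin_eq_fderivWithin]
  refine hC _ ?_ _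
  rw [ContinuousAffineMap.coe_lineMap_eq]
  exact hconv.lineMap_mem hx hy ht

end VectorSpace

theorem LipschitzOnWith.hausdorffMeasure_image_lt_top {X Y : Type*} [EMetricSpace X]
    [EMetricSpace Y] [MeasurableSpace X] [BorelSpace X] [MeasurableSpace Y] [BorelSpace Y]
    {K : ℝ≥0} {φ : X → Y} {S : Set X} (h : LipschitzOnWith K φ S) {d : ℝ} (hd : 0 ≤ d)
    (hS : Measure.hausdorffMeasure d S < ⊤) : Measure.hausdorffMeasure d (φ '' S) < ⊤ :=
  (h.hausdorffMeasure_image_le hd).trans_lt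
    (ENNReal.mul_lt_top (ENNReal.rpow_lt_top_of_nonneg hd ENNReal.coe_ne_top) hS)

/-- Rectifiability is inherited by Lipschitz images. -/
theorem LipschitzOnWith.exists_countable_lipschitz_cover {X Y F : Type*} [EMetricSpace X]
    [EMetricSpace Y] [MeasurableSpace X] [BorelSpace X] [MeasurableSpace Y] [BorelSpace Y]
    [EMetricSpace F] [MeasurableSpace F]
    {K : ℝ≥0} {φ : X → Y} {S : Set X} (h : LipschitzOnWith K φ S) {d : ℝ} (hd : 0 ≤ d)
    (hS : ∃ (A : ℕ → Set F) (f : ℕ → F → X), (∀ i, MeasurableSet (A i)) ∧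
      (∀ i, ∃ K, LipschitzOnWith K (f i) (A i)) ∧ (∀ i, MapsTo (f i) (A i) S) ∧
      Measure.hausdorffMeasure d (S \ ⋃ i, f i '' A i) = 0) :
    ∃ (A : ℕ → Set F) (f : ℕ → F → Y), (∀ i, MeasurableSet (A i)) ∧
      (∀ i, ∃ K, LipschitzOnWith K (f i) (A i)) ∧
      Measure.hausdorffMeasure d (φ '' S \ ⋃ i, f i '' A i) = 0 := by
  obtain ⟨A, f, hA, hf, hfS, h0⟩ := hS
  refine ⟨A, fun i => φ ∘ f i, hA, fun i => ?_, le_antisymm ?_ bot_le⟩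
  · obtain ⟨K', hK'⟩ := hf i
    exact ⟨K * K', h.comp hK' (hfS i)⟩
  · calc Measure.hausdorffMeasure d (φ '' S \ ⋃ i, (φ ∘ f i) '' A i)
        ≤ Measure.hausdorffMeasure d (φ '' (S \ ⋃ i, f i '' A i)) := by
          refine measure_mono ?_
          simp_rw [image_comp, ← image_iUnion]
          rintro _ ⟨⟨x, hx, rfl⟩, hxU⟩
          exact mem_image_of_mem φ ⟨hx, fun hU => hxU (mem_image_of_mem φ hU)⟩
      _ ≤ (K : ENNReal) ^ d * Measure.hausdorffMeasure d (S \ ⋃ i, f i '' A i) :=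
          (h.mono sdiff_subset).hausdorffMeasure_image_le hd
      _ = 0 := by rw [h0, mul_zero]

/-- In a vector space, rectifiability of a bounded set with respect to the norm implies
rectifiability with respect to any Riemannian metric. -/
theorem isEuclideanRectifiable_of_norm {E : Type*} [NormedAddCommGroup E] [NormedSpace ℝ E]
    [FiniteDimensional ℝ E] [mX : MeasurableSpace E] [bX : BorelSpace E]
    (ρ : ContMDiffRiemannianMetric 𝓘(ℝ, E) ∞ E (fun x : E => TangentSpace 𝓘(ℝ, E) x)) {k : ℕ}
    {S : Set E} {R : ℝ} (hR : ∀ x ∈ S, ‖x‖ ≤ R) (hfin : Measure.hausdorffMeasure (k : ℝ) S < ⊤)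
    (hcov : ∃ (A : ℕ → Set (EuclideanSpace ℝ (Fin k))) (f : ℕ → EuclideanSpace ℝ (Fin k) → E),
      (∀ i, MeasurableSet (A i)) ∧ (∀ i, ∃ K, LipschitzOnWith K (f i) (A i)) ∧
      (∀ i, MapsTo (f i) (A i) S) ∧
      Measure.hausdorffMeasure (k : ℝ) (S \ ⋃ i, f i '' A i) = 0) :
    IsEuclideanRectifiable 𝓘(ℝ, E) ρ k S := by
  let _ : RiemannianBundle (fun x : E => TangentSpace 𝓘(ℝ, E) x) := ⟨ρ.toRiemannianMetric⟩
  have _ : IsContinuousRiemannianBundle E (fun x : E => TangentSpace 𝓘(ℝ, E) x) :=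
    ⟨ρ.inner, ρ.contMDiff.continuous, fun _ _ _ => rfl⟩
  obtain ⟨C, hC⟩ := (isCompact_closedBall (0 : E) R).exists_riemannianEDist_le
    (convex_closedBall 0 R)
  let eX : EMetricSpace E := inferInstance
  let eY : EMetricSpace E := EMetricSpace.ofRiemannianMetric 𝓘(ℝ, E) E
  let mY : MeasurableSpace E := borel E
  have bY : @BorelSpace E _ mY := ⟨rfl⟩
  -- The identity, from the norm distance to the Riemannian one. Only this direction is needed,
  -- since both finiteness and coverings are pushed forward.
  have hLip : @LipschitzOnWith E E eX.toPseudoEMetricSpace eY.toPseudoEMetricSpace C id S :=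
    fun x hx y hy =>
    hC x (mem_closedBall_zero_iff.2 (hR x hx)) y (mem_closedBall_zero_iff.2 (hR y hy))
  have hfin' := @LipschitzOnWith.hausdorffMeasure_image_lt_top E E eX eY mX bX mY bY C id S hLip _
    (Nat.cast_nonneg k) hfin
  have hcov' := @LipschitzOnWith.exists_countable_lipschitz_cover E E
    (EuclideanSpace ℝ (Fin k)) eX eY mX bX mY bY _ _ C id S hLip _ (Nat.cast_nonneg k) hcov
  rw [image_id] at hfin' hcov'
  exact ⟨hfin', hcov'⟩

theorem theorem1p2 (n : ℕ) (hn : 2 ≤ n)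
    (N : Seminorm ℝ (Fin n → ℝ)) (hN : ∀ v, N v = 0 → v = 0)
    (ρ : ContMDiffRiemannianMetric 𝓘(ℝ, FreeCarnotStepTwo.G n) ∞ (FreeCarnotStepTwo.G n)
      (fun g : FreeCarnotStepTwo.G n => TangentSpace 𝓘(ℝ, FreeCarnotStepTwo.G n) g)) :
    IsEuclideanRectifiable 𝓘(ℝ, FreeCarnotStepTwo.G n) ρ
      (Module.finrank ℝ (FreeCarnotStepTwo.G n) - 1) (FreeCarnotStepTwo.ccSphere N) := by
  obtain ⟨R, -, hR⟩ := FreeCarnotStepTwo.isBounded_ccSphere hN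
  exact isEuclideanRectifiable_of_norm ρ hR
    (FreeCarnotStepTwo.hausdorffMeasure_ccSphere_lt_top hn hN)
    (FreeCarnotStepTwo.exists_countable_lipschitz_cover hn hN)

end
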